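/- Fix a smooth even function $\chi:\mathbb{R}\to\mathbb{R}$, nonincreasing in $|x|$, with $\chi(x)=1$ for $|x|\le 1$ and $\chi(x)=0$ for $|x|\ge 2$, and let $\varphi(x)=\chi(x)-\chi(x/2)$. For $k\in\mathbb{Z}$ and $p,q\in\mathbb{Z}_{\le 0}$ define the projection $P_{k,p,q}$ on $L^2(\mathbb{R}^3;\mathbb{C})$ by $$\widehat{P_{k,p,q}f}(\xi)=\varphi(2^{-k}|\xi|)\,\varphi\big(2^{-2(p+k)}(\xi_1^2+\xi_2^2)\big)\,\varphi(2^{-q-k}\xi_3)\,\hat f(\xi),$$ and let $e^{it\Lambda}$ be the Fourier multiplier with symbol $e^{it\Lambda(\xi)}$, $\Lambda(\xi)=\xi_3/|\xi|$ (frequencies being normalized by the convention $e^{i x\cdot\xi}$). Let $S=x\cdot\nabla$ be the scaling vector field and $\Upsilon=\partial_\phi$ the derivative in the polar angle of the spherical coordinates $x=(\rho\cos\theta\sin\phi,\rho\sin\theta\sin\phi,\rho\cos\phi)$, both understood in the weak sense ($\Upsilon$ away from the $x_3$-axis). Set $$\|f\|_B=\sup_{k\in\mathbb{Z},\;p,q\in\mathbb{Z}_{\le0}}2^{-p-\frac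 q2}\|P_{k,p,q}f\|_{L^2},\qquad \|f\|_D=\sup_{0\le a\le 3}\left\{\|S^af\|_B+\|\Upsilon S^af\|_{L^2}\right\},$$ where $\|f\|_D=\infty$ unless $S^af$ and $\Upsilon S^af$ exist in $L^2$ for $0\le a\le3$. Then there is a constant $C>0$, depending only on $\chi$, such that for every $f\in L^2(\mathbb{R}^3;\mathbb{C})$ that is axisymmetric (invariant under rotations about the $x_3$-axis), all $k\in\mathbb{Z}$, $p,q\in\mathbb{Z}_{\le0}$ and all $t>0$, $$\|P_{k,p,q}e^{it\Lambda}f\|_{L^\infty}\le C\,t^{-1}\,2^{\frac{3k}{2}}\,\|f\|_D .$$ -/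

import Mathlib

open MeasureTheory FourierTransform
open scoped ContDiff ENNReal

noncomputable section

namespace RotatingEuler

/-- Physical (and frequency) space `ℝ³`; the coordinates `0, 1` are horizontal, `2` is vertical. -/
abbrev E3 : Type := EuclideanSpace ℝ (Fin 3)

/-- Complex valued `L²(ℝ³)`. -/
abbrev L2 : Type := Lp (α := E3) ℂ 2 (volume : Measure E3)

/-! ### Fourier multipliers -/

/-- The Fourier multiplier on `L²(ℝ³)` with bounded symbol `m`, where frequencies are normalized by
the convention `e^{i x·ξ}`.  Mathlib's transform `𝓕` uses `e^{-2πi x·ξ}`, so that the frequency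
called `ξ` by Mathlib is `2πξ` in this convention. -/
def fourierMul (m : E3 → ℂ)
    (hm : MemLp (fun ξ : E3 => m ((2 * Real.pi) • ξ)) ⊤ (volume : Measure E3)) (f : L2) : L2 :=
  𝓕⁻ ((MemLp.mul' (r := 2) (Lp.memLp (𝓕 f)) hm).toLp
    (fun ξ : E3 => m ((2 * Real.pi) • ξ) * (𝓕 f : L2) ξ))

/-- The dispersion relation `Λ(ξ) = ξ₃ / |ξ|`. -/
def Lam (ξ : E3) : ℝ := ξ 2 / ‖ξ‖

/-- The symbol `e^{itΛ(ξ)}`. -/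
def flowSymbol (t : ℝ) (ξ : E3) : ℂ := Complex.exp (Complex.I * ((t * Lam ξ : ℝ) : ℂ))

theorem memLp_flowSymbol (t : ℝ) :
    MemLp (fun ξ : E3 => flowSymbol t ((2 * Real.pi) • ξ)) ⊤ (volume : Measure E3) := by
  refine memLp_top_of_bound ?_ 1 (Filter.Eventually.of_forall fun ξ => ?_)
  · have h : Measurable (fun ξ : E3 => Lam ξ) := by
      unfold Lam
      fun_prop
    have h2 : Measurable (fun ξ : E3 => flowSymbol t ξ) := by
      unfold flowSymbol
      fun_prop
    exact (h2.comp (measurable_const_smul (2 * Real.pi))).aestronglyMeasurable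
  · rw [flowSymbol, mul_comm, Complex.norm_exp_ofReal_mul_I]

/-- The linear semigroup `e^{itΛ}` on `L²(ℝ³)`. -/
def flow (t : ℝ) (f : L2) : L2 := fourierMul (flowSymbol t) (memLp_flowSymbol t) f

/-! ### Anisotropic frequency localization -/

/-- A smooth, even bump function `χ` on `ℝ`, nonincreasing in `|x|`, equal to `1` for `|x| ≤ 1` and
vanishing for `|x| ≥ 2`. -/
structure RadialBump where
  toFun : ℝ → ℝ
  smooth : ContDiff ℝ ∞ toFun
  even : ∀ x, toFun (-x) = toFun x
  antitone : AntitoneOn toFun (Set.Ici 0)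
  eq_one : ∀ x, |x| ≤ 1 → toFun x = 1
  eq_zero : ∀ x, 2 ≤ |x| → toFun x = 0

/-- `φ(x) = χ(x) - χ(x/2)`. -/
def RadialBump.phi (χ : RadialBump) (x : ℝ) : ℝ := χ.toFun x - χ.toFun (x / 2)

/-- The symbol
`φ(2^{-k}|ξ|) φ(2^{-2(p+k)}(ξ₁² + ξ₂²)) φ(2^{-q-k}ξ₃)` of the projection `P_{k,p,q}`. -/
def projSymbol (χ : RadialBump) (k p q : ℤ) (ξ : E3) : ℂ :=
  ((χ.phi ((2 : ℝ) ^ (-k) * ‖ξ‖) * χ.phi ((2 : ℝ) ^ (-2 * (p + k)) * ((ξ 0) ^ 2 + (ξ 1) ^ 2)) *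
    χ.phi ((2 : ℝ) ^ (-q - k) * ξ 2) : ℝ) : ℂ)

theorem RadialBump.abs_toFun_le (χ : RadialBump) (x : ℝ) : |χ.toFun x| ≤ 1 := by
  have key : ∀ y, 0 ≤ y → |χ.toFun y| ≤ 1 := by
    intro y hy
    have h0 : χ.toFun y ≤ 1 := by
      rw [← χ.eq_one 0 (by simp)]
      exact χ.antitone (by simp) hy hy
    have h1 : 0 ≤ χ.toFun y := by
      have hm : χ.toFun (max y 2) = 0 := χ.eq_zero _ ((le_max_right y 2).trans (le_abs_self _))
      rw [← hm]
      exact χ.antitone hy (hy.trans (le_max_left _ _)) (le_max_left _ _)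
    rw [abs_of_nonneg h1]
    exact h0
  rcases le_total 0 x with h | h
  · exact key x h
  · rw [← χ.even]
    exact key (-x) (by linarith)

theorem RadialBump.abs_phi_le (χ : RadialBump) (x : ℝ) : |χ.phi x| ≤ 2 := by
  have h1 := χ.abs_toFun_le x
  have h2 := χ.abs_toFun_le (x / 2)
  have h3 := abs_sub (χ.toFun x) (χ.toFun (x / 2))
  unfold RadialBump.phi
  linarith

theorem memLp_projSymbol (χ : RadialBump) (k p q : ℤ) :
    MemLp (fun ξ : E3 => projSymbol χ k p q ((2 * Real.pi) • ξ)) ⊤ (volume : Measure E3) := by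
  refine memLp_top_of_bound ?_ (2 * 2 * 2) (Filter.Eventually.of_forall fun ξ => ?_)
  · have h : Measurable χ.phi := by
      have := χ.smooth.continuous.measurable
      unfold RadialBump.phi
      fun_prop
    have h2 : Measurable (fun ξ : E3 => projSymbol χ k p q ξ) := by
      unfold projSymbol
      fun_prop
    exact (h2.comp (measurable_const_smul (2 * Real.pi))).aestronglyMeasurable
  · rw [projSymbol, Complex.norm_real, norm_mul, norm_mul]
    gcongr <;> exact χ.abs_phi_le _

/-- The anisotropic Littlewood-Paley projection `P_{k,p,q}` on `L²(ℝ³)`. -/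
def proj (χ : RadialBump) (k p q : ℤ) (f : L2) : L2 :=
  fourierMul (projSymbol χ k p q) (memLp_projSymbol χ k p q) f

/-! ### Axisymmetry and vector fields -/

/-- The rotation by the angle `θ` about the vertical axis. -/
def rot (θ : ℝ) (x : E3) : E3 :=
  !₂[Real.cos θ * x 0 - Real.sin θ * x 1, Real.sin θ * x 0 + Real.cos θ * x 1, x 2]

/-- `f` is invariant under all rotations about the vertical axis. -/
def IsAxisymmetric (f : L2) : Prop := ∀ θ : ℝ, ∀ᵐ x : E3, f (rot θ x) = f x

/-- The divergence of a vector field on `ℝ³`. -/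
def divergence (W : E3 → E3) (x : E3) : ℝ :=
  ∑ j : Fin 3, fderiv ℝ W x (EuclideanSpace.single j 1) j

/-- `g = V·∇f` on the open set `U` in the sense of distributions: `∫ g ψ = -∫ f div(ψ V)` for all
test functions `ψ` on `U`. -/
def IsWeakDerivAlong (U : Set E3) (V : E3 → E3) (f g : L2) : Prop :=
  ∀ ψ : E3 → ℝ, ContDiff ℝ ∞ ψ → HasCompactSupport ψ → tsupport ψ ⊆ U →
    ∫ x : E3, g x * ((ψ x : ℝ) : ℂ) =
      -∫ x : E3, f x * ((divergence (fun y => ψ y • V y) x : ℝ) : ℂ)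

/-- `g = S f`, where `S = x·∇` is the scaling vector field. -/
def IsS (f g : L2) : Prop := IsWeakDerivAlong Set.univ (fun x => x) f g

/-- `ℝ³` without the vertical axis. -/
def offAxis : Set E3 := {x | x 0 ≠ 0 ∨ x 1 ≠ 0}

/-- The vector field `∂_φ`, with `φ` the polar angle of the spherical coordinates
`x = (ρ cos θ sin φ, ρ sin θ sin φ, ρ cos φ)`.  In Cartesian coordinates it is
`(x₃ x₁ / |x_h|, x₃ x₂ / |x_h|, -|x_h|)` with `|x_h| = √(x₁² + x₂²)`; it is smooth off the axis. -/
def polarField (x : E3) : E3 :=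
  !₂[x 2 * x 0 / √((x 0) ^ 2 + (x 1) ^ 2), x 2 * x 1 / √((x 0) ^ 2 + (x 1) ^ 2),
    -√((x 0) ^ 2 + (x 1) ^ 2)]

/-- `g = Υ f`, where `Υ = ∂_φ`. The axis is a null set, so `g` is determined by `f`. -/
def IsUpsilon (f g : L2) : Prop := IsWeakDerivAlong offAxis polarField f g

/-! ### The norms -/

/-- `‖f‖_B = sup_{k ∈ ℤ, p, q ∈ ℤ_{≤ 0}} 2^{-p-q/2} ‖P_{k,p,q} f‖_{L²}`. -/
def normB (χ : RadialBump) (f : L2) : ℝ≥0∞ :=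
  ⨆ (k : ℤ) (p : ℤ) (q : ℤ) (_ : p ≤ 0) (_ : q ≤ 0),
    ENNReal.ofReal ((2 : ℝ) ^ (-(p : ℝ) - (q : ℝ) / 2)) * ‖proj χ k p q f‖ₑ

/-- `‖f‖_D = sup_{0 ≤ a ≤ 3} (‖S^a f‖_B + ‖Υ S^a f‖_{L²})`.  The families `g a = S^a f` and
`u a = Υ S^a f` of elements of `L²` are determined by `f`; the infimum only expresses that the norm
is `∞` if they do not exist. -/
def normD (χ : RadialBump) (f : L2) : ℝ≥0∞ :=
  ⨅ (g : Fin 4 → L2) (u : Fin 4 → L2)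
    (_ : g 0 = f ∧ (∀ a : Fin 3, IsS (g a.castSucc) (g a.succ)) ∧ ∀ a, IsUpsilon (g a) (u a)),
    ⨆ a : Fin 4, (normB χ (g a) + ‖u a‖ₑ)

end RotatingEuler

end

/-! ### Weak derivatives along linear fields and their Fourier transforms. -/

noncomputable section

namespace RotatingEuler

open Filter Topology SchwartzMap LineDeriv

/-! On the Fourier side the claim concerns the integral of `e^{iΨ} m f̂` with phase Ψ = 2π x·ξ +
tΛ(ξ). The symbol m lives on a shell |ξ| ~ 1/a, |ξ_h| ~ 1/b, |ξ₃| ~ 1/c, where a = 2π 2^{-k} and a ≤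
b, a ≤ c because p, q ≤ 0. If D bounds ‖S^i f‖_B + ‖ΥS^i f‖ for i ≤ 3, the target is C D / (t
a^{3/2}).

The first ingredient is the pointwise bound |ĝ(ξ)| ≤ C D |ξ|^{-3/2} for g = f, Sf, S²f
(`pointwise_bound`). An axisymmetric ĝ depends only on the radius ρ and the polar angle. S becomes
-(3 + ρ∂_ρ) in frequency. On axisymmetric functions Υ is, up to the bounded factors x_j/|x_h|, one
of the rotation fields x₃∂_j - x_j∂₃, which commute with the Fourier transform; hence ∂_φ ĝ is in L²
as well (`IsUpsilon.weakPolar_fourier`). A Sobolev inequality on rectangles ρ ~ ρ₀, φ ≲ τ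
(`rectangle_sobolev`) bounds ĝ by itself and by ∂_ρ, ∂_φ, ∂_ρ∂_φ. Against the measure ρ² sin φ dρ dφ
the scale τ cancels in Cauchy-Schwarz for the terms with ∂_φ. The terms without ∂_φ are averaged
over an angular window of length ~ τ and lose 1/τ, which the weight 2^{-p} of the B norm repays
(`azInt_rect_bound`). As the cutoff `phi` may be small inside its support, the window must be put
where the symbol is bounded below (`RadialBump.window`).

The oscillatory integral is then split according to the size of x. If |x| b ≲ t a², the polar
derivative of the phase is dominated by t|ξ_h|/|ξ| ≳ t a/b, and one integration by parts along ∂_φ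
suffices; its losses in b and c are paid by the volume ~ 1/(b²c) of the shell (`oscIntegral_near`).
Otherwise, since Λ is homogeneous of degree zero, the scaling field sees only y = 2π x·ξ. Two
integrations by parts along it produce the weight 1/(1+y²), whose integral over the shell is ≲ 1/(a
b |x|); with the pointwise bound this gives √a/(b|x|) ≲ 1/(t a^{3/2}) (`oscIntegral_far`). These two
uses of S and the one inside the pointwise bound account for S³. -/

/-- `g` is the weak derivative of `f` along the linear vector field `A` of divergence `τ`. -/
def WeakLin (A : E3 →L[ℝ] E3) (τ : ℝ) (f g : E3 → ℂ) : Prop :=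
  ∀ ψ : E3 → ℂ, ContDiff ℝ ∞ ψ → HasCompactSupport ψ →
    ∫ x, g x * ψ x = -∫ x, f x * (fderiv ℝ ψ x (A x) + τ * ψ x)

/-- The coordinate vector `e_k`. -/
abbrev ebasis (k : Fin 3) : E3 := EuclideanSpace.single k 1

theorem sum_coord (x : E3) : x = ∑ k, x k • ebasis k := by
  ext i
  fin_cases i <;> simp [Fin.sum_univ_three, ebasis]

/-- A smooth cutoff on `ℝ³`. -/
def cutoffBump : ContDiffBump (0 : E3) := ⟨1, 2, one_pos, one_lt_two⟩

/-- The quantity |∇η(y)||y| is invariant under dilation, so the derivatives of all dilated cutoffs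
along a linear field are bounded uniformly in the scale. -/
theorem cutoff_deriv_bound : ∃ C : ℝ, ∀ y : E3, ‖fderiv ℝ cutoffBump y‖ * ‖y‖ ≤ C := by
  have h1 : Continuous (fun y : E3 => ‖fderiv ℝ cutoffBump y‖ * ‖y‖) := by
    have := (cutoffBump.contDiff (n := 1)).continuous_fderiv one_ne_zero
    fun_prop
  have h2 : HasCompactSupport (fun y : E3 => ‖fderiv ℝ cutoffBump y‖ * ‖y‖) := by
    have := cutoffBump.hasCompactSupport.fderiv (𝕜 := ℝ)
    exact this.norm.mul_right
  obtain ⟨C, hC⟩ := h1.bounded_above_of_compact_support h2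
  exact ⟨C, fun y => (le_abs_self _).trans (hC y)⟩

theorem integrable_L2_mul_schwartz (f : L2) (ψ : 𝓢(E3, ℂ)) : Integrable (fun x => f x * ψ x) := by
  have := (ψ.memLp 2 (volume : Measure E3))
  exact (Lp.memLp f).integrable_mul this

/-- Enlarges the class of test functions to Schwartz functions, which the Fourier transform
preserves, by dilated cutoffs and dominated convergence. Presenting the derivative of ψ along A as a
Schwartz function χ makes the dominating function integrable. -/
theorem WeakLin.schwartz {A : E3 →L[ℝ] E3} {τ : ℝ} {f g : L2} (h : WeakLin A τ f g)
    (ψ χ : 𝓢(E3, ℂ)) (hχ : ∀ x, χ x = fderiv ℝ ψ x (A x)) :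
    ∫ x, g x * ψ x = -∫ x, f x * (fderiv ℝ ψ x (A x) + τ * ψ x) := by
  obtain ⟨C, hC⟩ := cutoff_deriv_bound
  have hC0 : 0 ≤ C := (by positivity : (0 : ℝ) ≤ _).trans (hC 0)
  let η : ℕ → E3 → ℝ := fun n x => cutoffBump ((1 / (n + 1 : ℝ)) • x)
  have hηs : ∀ n, ContDiff ℝ ∞ (η n) := fun n =>
    cutoffBump.contDiff.comp (contDiff_const_smul _)
  have hη1 : ∀ n x, ‖((η n x : ℝ) : ℂ)‖ ≤ 1 := fun n x => by
    rw [Complex.norm_real, Real.norm_of_nonneg cutoffBump.nonneg]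
    exact cutoffBump.le_one
  have hηc : ∀ n, HasCompactSupport (η n) := fun n =>
    cutoffBump.hasCompactSupport.comp_smul (by positivity)
  have hηd : ∀ n x, fderiv ℝ (η n) x (A x) =
      (1 / (n + 1 : ℝ)) * fderiv ℝ cutoffBump ((1 / (n + 1 : ℝ)) • x) (A x) := by
    intro n x
    have h1 : HasFDerivAt cutoffBump (fderiv ℝ cutoffBump ((1 / (n + 1 : ℝ)) • x))
        ((1 / (n + 1 : ℝ)) • x) :=
      ((cutoffBump.contDiff (n := 1)).differentiable one_ne_zero _).hasFDerivAt
    have h2 : HasFDerivAt (fun x : E3 => (1 / (n + 1 : ℝ)) • x)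
        ((1 / (n + 1 : ℝ)) • ContinuousLinearMap.id ℝ E3) x :=
      (hasFDerivAt_id x).fun_const_smul _
    have h3 := (h1.comp x h2).fderiv
    change fderiv ℝ (cutoffBump ∘ fun x => (1 / (n + 1 : ℝ)) • x) x (A x) = _
    rw [h3]
    simp
  have hηb : ∀ n x, ‖((fderiv ℝ (η n) x (A x) : ℝ) : ℂ)‖ ≤ ‖A‖ * C := by
    intro n x
    rw [hηd, Complex.norm_real, norm_mul, Real.norm_of_nonneg (by positivity)]
    set c : ℝ := 1 / (n + 1 : ℝ)
    have hc : 0 ≤ c := by positivity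
    calc c * ‖fderiv ℝ cutoffBump (c • x) (A x)‖
        ≤ c * (‖fderiv ℝ cutoffBump (c • x)‖ * (‖A‖ * ‖x‖)) := by
          gcongr
          exact (ContinuousLinearMap.le_opNorm _ _).trans
            (by gcongr; exact ContinuousLinearMap.le_opNorm _ _)
      _ = ‖A‖ * (‖fderiv ℝ cutoffBump (c • x)‖ * ‖c • x‖) := by
          rw [norm_smul, Real.norm_of_nonneg hc]; ring
      _ ≤ ‖A‖ * C := by gcongr; exact hC _
  have hev : ∀ x : E3, ∀ᶠ n : ℕ in atTop, η n =ᶠ[𝓝 x] fun _ => 1 := by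
    intro x
    obtain ⟨N, hN⟩ := exists_nat_gt (‖x‖)
    filter_upwards [eventually_ge_atTop N] with n hn
    have hlt : ‖x‖ < n + 1 := hN.trans_le (by exact_mod_cast hn.trans (Nat.le_succ n))
    have : ∀ᶠ y in 𝓝 x, ‖y‖ < (n + 1 : ℝ) := continuous_norm.continuousAt.eventually_lt_const hlt
    filter_upwards [this] with y hy
    apply cutoffBump.one_of_mem_closedBall
    simp only [mem_closedBall_zero_iff, norm_smul]
    rw [Real.norm_of_nonneg (by positivity)]
    change 1 / (n + 1 : ℝ) * ‖y‖ ≤ 1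
    rw [one_div, inv_mul_le_one₀ (by positivity)]
    exact hy.le
  have hψs : ContDiff ℝ ∞ ψ := ψ.smooth ⊤
  have hcut : ∀ n, ∫ x, g x * (η n x * ψ x) = -∫ x, f x * (η n x * (χ x + τ * ψ x) +
      (fderiv ℝ (η n) x (A x) : ℝ) * ψ x) := by
    intro n
    have := h (fun x => (η n x : ℂ) * ψ x)
      ((Complex.ofRealCLM.contDiff.comp (hηs n)).mul hψs)
      (((hηc n).comp_left (g := fun r : ℝ => (r : ℂ)) Complex.ofReal_zero).mul_right)
    rw [this]
    congr 2
    ext x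
    have h1 : HasFDerivAt (fun x => ((η n x : ℝ) : ℂ))
        (Complex.ofRealCLM.comp (fderiv ℝ (η n) x)) x :=
      Complex.ofRealCLM.hasFDerivAt.comp x
        (((hηs n).differentiable (by simp)) x).hasFDerivAt
    have h2 := (ψ.differentiable x).hasFDerivAt
    rw [(h1.fun_mul h2).fderiv, hχ]
    simp only [_root_.add_apply, _root_.smul_apply,
      ContinuousLinearMap.comp_apply, Complex.ofRealCLM_apply, smul_eq_mul]
    ring
  have hL : Tendsto (fun n => ∫ x, g x * (η n x * ψ x)) atTop (𝓝 (∫ x, g x * ψ x)) := by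
    apply tendsto_integral_of_dominated_convergence (fun x => ‖g x * ψ x‖)
    · intro n
      have h1 := (hηs n).continuous
      have h2 := ψ.continuous
      exact (Lp.aestronglyMeasurable g).mul (by fun_prop)
    · exact (integrable_L2_mul_schwartz g ψ).norm
    · intro n
      refine .of_forall fun x => ?_
      rw [norm_mul, norm_mul, norm_mul]
      gcongr
      exact mul_le_of_le_one_left (norm_nonneg _) (hη1 n x)
    · refine .of_forall fun x => ?_
      apply tendsto_const_nhds.congr'
      filter_upwards [hev x] with n hn
      simp [hn.self_of_nhds]
  have hR : Tendsto (fun n => -∫ x, f x * (η n x * (χ x + τ * ψ x) +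
      (fderiv ℝ (η n) x (A x) : ℝ) * ψ x)) atTop (𝓝 (-∫ x, f x * (χ x + τ * ψ x))) := by
    apply Tendsto.neg
    have hb1 := integrable_L2_mul_schwartz f χ
    have hb2 := integrable_L2_mul_schwartz f ψ
    apply tendsto_integral_of_dominated_convergence
      (fun x => ‖f x * χ x‖ + (|τ| + ‖A‖ * C) * ‖f x * ψ x‖)
    · intro n
      have h1 := (hηs n).continuous
      have h1' := (hηs n).continuous_fderiv (by simp)
      have h2 := ψ.continuous
      have h3 := χ.continuous
      exact (Lp.aestronglyMeasurable f).mul (by fun_prop)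
    · exact hb1.norm.add (hb2.norm.const_mul _)
    · intro n
      refine .of_forall fun x => ?_
      have e1 : ‖(η n x : ℂ) * (χ x + τ * ψ x)‖ ≤ ‖χ x‖ + |τ| * ‖ψ x‖ := by
        rw [norm_mul]
        refine (mul_le_of_le_one_left (norm_nonneg _) (hη1 n x)).trans ?_
        refine (norm_add_le _ _).trans (by simp)
      have e2 : ‖((fderiv ℝ (η n) x (A x) : ℝ) : ℂ) * ψ x‖ ≤ ‖A‖ * C * ‖ψ x‖ := by
        rw [norm_mul]
        gcongr
        exact hηb n x
      calc _ ≤ ‖f x‖ * ((‖χ x‖ + |τ| * ‖ψ x‖) + ‖A‖ * C * ‖ψ x‖) := by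
            rw [norm_mul]
            gcongr
            exact (norm_add_le _ _).trans (add_le_add e1 e2)
        _ = _ := by rw [norm_mul, norm_mul]; ring
    · refine .of_forall fun x => ?_
      apply tendsto_const_nhds.congr'
      filter_upwards [hev x] with n hn
      rw [hn.self_of_nhds, hn.fderiv_eq]
      simp
  have := tendsto_nhds_unique (hL.congr hcut) hR
  simpa only [hχ] using this

theorem integral_fourier_mul_schwartz (f : L2) (ψ : 𝓢(E3, ℂ)) :
    ∫ x, (𝓕 f : L2) x * ψ x = ∫ x, f x * (𝓕 ψ) x := by
  have h := congrArg (fun T : 𝓢'(E3, ℂ) => T ψ) (Lp.fourier_toTemperedDistribution_eq f)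
  simp only [TemperedDistribution.fourier_apply, Lp.toTemperedDistribution_apply, smul_eq_mul] at h
  simp_rw [mul_comm _ (ψ _), mul_comm _ ((𝓕 ψ) _)]
  exact h.symm

theorem hasTemperateGrowth_inner (m : E3) : (fun x : E3 => inner ℝ x m).HasTemperateGrowth := by
  fun_prop

/-- Multiplication and differentiation exchange under the transform, so A is replaced by its
transpose B. Commuting ∂_k past the linear coefficient produces the trace of A, which is exactly τ;
therefore no zero-order term is left on the test function. -/
theorem WeakLin.fourier {A B : E3 →L[ℝ] E3} {τ : ℝ} {f g : L2} (h : WeakLin A τ f g)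
    (hAB : ∀ x y, inner ℝ x (A y) = inner ℝ (B x) y)
    (hτ : τ = ∑ k, inner ℝ (ebasis k) (A (ebasis k))) (ψ : 𝓢(E3, ℂ)) :
    ∫ x, (𝓕 g : L2) x * ψ x = ∫ x, (𝓕 f : L2) x * fderiv ℝ ψ x (B x) := by
  -- The derivative along a linear field is written as a finite sum of coordinate multiplications
  -- and constant-direction derivatives, to stay within Schwartz space.
  let χ : 𝓢(E3, ℂ) := ∑ k, smulLeftCLM ℂ (fun x : E3 => inner ℝ x (A (ebasis k))) (∂_{ebasis k} ψ)
  have hχ : ∀ x, χ x = fderiv ℝ ψ x (B x) := by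
    intro x
    conv_rhs => rw [sum_coord (B x)]
    simp only [χ, _root_.sum_apply, map_sum, map_smul]
    refine Finset.sum_congr rfl fun k _ => ?_
    rw [smulLeftCLM_apply_apply (hasTemperateGrowth_inner _), lineDerivOp_apply_eq_fderiv, hAB]
    simp [ebasis, EuclideanSpace.inner_single_right]
  let ζ : 𝓢(E3, ℂ) := ∑ k, smulLeftCLM ℂ (fun x : E3 => inner ℝ x (ebasis k))
    (∂_{A (ebasis k)} (𝓕 ψ))
  have hζ : ∀ x, ζ x = fderiv ℝ (𝓕 ψ : 𝓢(E3, ℂ)) x (A x) := by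
    intro x
    conv_rhs => rw [sum_coord x]
    simp only [ζ, _root_.sum_apply, map_sum, map_smul]
    refine Finset.sum_congr rfl fun k _ => ?_
    rw [smulLeftCLM_apply_apply (hasTemperateGrowth_inner _), lineDerivOp_apply_eq_fderiv,
      ← sum_coord]
    simp [ebasis, EuclideanSpace.inner_single_right]
  have hkey : ζ + (τ : ℂ) • 𝓕 ψ = -𝓕 χ := by
    have h1 : ∀ k, smulLeftCLM ℂ (fun x : E3 => inner ℝ x (ebasis k))
        (∂_{A (ebasis k)} (𝓕 ψ)) = -𝓕 (smulLeftCLM ℂ (fun x : E3 => inner ℝ x (A (ebasis k)))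
          (∂_{ebasis k} ψ)) - ((inner ℝ (ebasis k) (A (ebasis k)) : ℝ) : ℂ) • 𝓕 ψ := by
      intro k
      have hc : (2 * Real.pi * Complex.I : ℂ) ≠ 0 := by simp [Real.pi_ne_zero]
      have e1 := SchwartzMap.lineDerivOp_fourier_eq ψ (A (ebasis k))
      have e2 := SchwartzMap.fourier_lineDerivOp_eq
        (smulLeftCLM ℂ (fun x : E3 => inner ℝ x (A (ebasis k))) ψ) (ebasis k)
      have e3 : ∂_{ebasis k} (smulLeftCLM ℂ (fun x : E3 => inner ℝ x (A (ebasis k))) ψ) =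
          smulLeftCLM ℂ (fun x : E3 => inner ℝ x (A (ebasis k))) (∂_{ebasis k} ψ) +
          ((inner ℝ (ebasis k) (A (ebasis k)) : ℝ) : ℂ) • ψ := by
        ext x
        rw [_root_.add_apply, smulLeftCLM_apply_apply (hasTemperateGrowth_inner _),
          lineDerivOp_apply_eq_fderiv, lineDerivOp_apply_eq_fderiv,
          smulLeftCLM_apply (hasTemperateGrowth_inner _)]
        have d1 : HasFDerivAt (fun x : E3 => inner ℝ x (A (ebasis k)))
            ((innerSL ℝ).flip (A (ebasis k))) x := ((innerSL ℝ).flip (A (ebasis k))).hasFDerivAt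
        have d2 := (ψ.differentiable x).hasFDerivAt
        rw [(d1.fun_smul d2).fderiv]
        simp only [_root_.add_apply, _root_.smul_apply, ContinuousLinearMap.smulRight_apply,
          ContinuousLinearMap.flip_apply, innerSL_apply_apply, Complex.real_smul, smul_eq_mul]
      have e4 : ∀ (c : ℂ) (φ : 𝓢(E3, ℂ)), smulLeftCLM ℂ (fun x : E3 => inner ℝ x (ebasis k)) (c • φ) =
          c • smulLeftCLM ℂ (fun x : E3 => inner ℝ x (ebasis k)) φ := by
        intro c φ
        ext x
        simp only [smulLeftCLM_apply_apply (hasTemperateGrowth_inner _), _root_.smul_apply]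
        exact smul_comm _ _ _
      rw [e1, FourierTransform.fourier_smul, e4, neg_smul]
      rw [e3, FourierTransform.fourier_add, FourierTransform.fourier_smul] at e2
      rw [← e2]
      abel
    simp only [ζ, χ, h1]
    rw [Finset.sum_sub_distrib, Finset.sum_neg_distrib, ← Finset.sum_smul]
    have : 𝓕 (∑ k, smulLeftCLM ℂ (fun x : E3 => inner ℝ x (A (ebasis k))) (∂_{ebasis k} ψ)) =
        ∑ k, 𝓕 (smulLeftCLM ℂ (fun x : E3 => inner ℝ x (A (ebasis k))) (∂_{ebasis k} ψ)) :=
      map_sum (fourierCLM ℂ 𝓢(E3, ℂ)) _ _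
    rw [this, hτ]
    push_cast
    abel
  rw [integral_fourier_mul_schwartz, h.schwartz (𝓕 ψ) ζ hζ]
  simp_rw [← hχ]
  rw [integral_fourier_mul_schwartz, ← integral_neg]
  congr 1
  ext x
  have := DFunLike.congr_fun hkey x
  simp only [_root_.add_apply, _root_.smul_apply, _root_.neg_apply, smul_eq_mul] at this
  rw [← hζ, this]
  ring

end RotatingEuler
end

/-! ### A Sobolev inequality on rectangles for weak derivatives in the plane. -/

noncomputable section

namespace RotatingEuler

open Filter Topology Convolution Set

/-- `H` is the weak derivative of `G` in the direction `v` on the open set `U`. -/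
def WeakDir (U : Set (ℝ × ℝ)) (v : ℝ × ℝ) (G H : ℝ × ℝ → ℂ) : Prop :=
  ∀ ψ : ℝ × ℝ → ℝ, ContDiff ℝ ∞ ψ → HasCompactSupport ψ → tsupport ψ ⊆ U →
    ∫ z, ψ z • H z = -∫ z, (fderiv ℝ ψ z v) • G z

section Smooth

variable {F F1 F2 F12 : ℝ × ℝ → ℂ} {s₁ s₂ a b c d : ℝ}

theorem enorm_le_add_setLIntegral {u u' : ℝ → ℂ} {x y : ℝ} (hx : x ∈ Icc a b) (hy : y ∈ Icc a b)
    (hc : Continuous u') (h : ∀ t ∈ Icc a b, HasDerivAt u (u' t) t) :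
    ‖u x‖ₑ ≤ ‖u y‖ₑ + ∫⁻ t in Icc a b, ‖u' t‖ₑ := by
  have e := intervalIntegral.integral_eq_sub_of_hasDerivAt (a := y) (b := x)
    (fun t ht => h t (uIcc_subset_Icc hy hx ht)) (hc.intervalIntegrable _ _)
  have e2 : u x = u y + ∫ t in y..x, u' t := by rw [e]; ring
  rw [e2]
  refine (enorm_add_le _ _).trans ?_
  gcongr
  rw [intervalIntegral.intervalIntegral_eq_integral_uIoc]
  refine (le_of_eq ?_).trans ((enorm_integral_le_lintegral_enorm (fun t => u' t)).trans
    (lintegral_mono_set (uIoc_subset_uIcc.trans (uIcc_subset_Icc hy hx))))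
  split_ifs <;> simp

/-- Move from (s, φ) to (s', φ), then to (s', φ') with φ' in the smaller interval, move also the
s-derivative from φ to φ', and integrate over (s', φ'). The form matters: F and F1, which carry no
φ-derivative, are integrated only over the window [c, d]; the φ-derivatives F2 and F12 need the
whole interval [a, b]. -/
theorem rectangle_sobolev_smooth (hF1 : Continuous F1) (hF2 : Continuous F2)
    (hF12 : Continuous F12) (hF : Continuous F)
    (d1 : ∀ s ∈ Icc s₁ s₂, ∀ φ ∈ Icc a b, HasDerivAt (fun s => F (s, φ)) (F1 (s, φ)) s)
    (d2 : ∀ s ∈ Icc s₁ s₂, ∀ φ ∈ Icc a b, HasDerivAt (fun φ => F (s, φ)) (F2 (s, φ)) φ)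
    (d12 : ∀ s ∈ Icc s₁ s₂, ∀ φ ∈ Icc a b, HasDerivAt (fun φ => F1 (s, φ)) (F12 (s, φ)) φ)
    (hJ : Icc c d ⊆ Icc a b) {s φ : ℝ} (hs : s ∈ Icc s₁ s₂) (hφ : φ ∈ Icc a b) :
    volume (Icc s₁ s₂) * volume (Icc c d) * ‖F (s, φ)‖ₑ ≤
      (∫⁻ z in Icc s₁ s₂ ×ˢ Icc c d, ‖F z‖ₑ) +
      volume (Icc c d) * (∫⁻ z in Icc s₁ s₂ ×ˢ Icc a b, ‖F2 z‖ₑ) +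
      volume (Icc s₁ s₂) * (∫⁻ z in Icc s₁ s₂ ×ˢ Icc c d, ‖F1 z‖ₑ) +
      volume (Icc s₁ s₂) * volume (Icc c d) * (∫⁻ z in Icc s₁ s₂ ×ˢ Icc a b, ‖F12 z‖ₑ) := by
  have key : ∀ s' ∈ Icc s₁ s₂, ∀ φ' ∈ Icc c d, ‖F (s, φ)‖ₑ ≤ ‖F (s', φ')‖ₑ +
      (∫⁻ α in Icc a b, ‖F2 (s', α)‖ₑ) + (∫⁻ τ in Icc s₁ s₂, ‖F1 (τ, φ')‖ₑ) +
      ∫⁻ z in Icc s₁ s₂ ×ˢ Icc a b, ‖F12 z‖ₑ := by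
    intro s' hs' φ' hφ'
    have e1 := enorm_le_add_setLIntegral (u := fun s => F (s, φ)) (u' := fun s => F1 (s, φ)) hs hs'
      (by fun_prop) (fun t ht => d1 t ht φ hφ)
    have e2 := enorm_le_add_setLIntegral (u := fun φ => F (s', φ)) (u' := fun φ => F2 (s', φ))
      hφ (hJ hφ') (by fun_prop) (fun t ht => d2 s' hs' t ht)
    have e3 : ∫⁻ τ in Icc s₁ s₂, ‖F1 (τ, φ)‖ₑ ≤ (∫⁻ τ in Icc s₁ s₂, ‖F1 (τ, φ')‖ₑ) +
        ∫⁻ z in Icc s₁ s₂ ×ˢ Icc a b, ‖F12 z‖ₑ := by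
      have hm1 : Measurable fun τ => ‖F1 (τ, φ')‖ₑ :=
        (hF1.comp (by fun_prop : Continuous fun τ => (τ, φ'))).enorm.measurable
      rw [Measure.volume_eq_prod, setLIntegral_prod _ (by fun_prop), ← lintegral_add_left hm1]
      refine setLIntegral_mono' measurableSet_Icc fun τ hτ => ?_
      exact enorm_le_add_setLIntegral (u := fun φ => F1 (τ, φ)) (u' := fun φ => F12 (τ, φ))
        hφ (hJ hφ') (by fun_prop) (fun t ht => d12 τ hτ t ht)
    calc _ ≤ _ := e1
      _ ≤ _ := add_le_add e2 e3
      _ = _ := by ring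
  have hm : ∫⁻ z in Icc s₁ s₂ ×ˢ Icc c d, ‖F (s, φ)‖ₑ ≤ ∫⁻ z in Icc s₁ s₂ ×ˢ Icc c d,
      (‖F z‖ₑ + (∫⁻ α in Icc a b, ‖F2 (z.1, α)‖ₑ) + (∫⁻ τ in Icc s₁ s₂, ‖F1 (τ, z.2)‖ₑ) +
      ∫⁻ z in Icc s₁ s₂ ×ˢ Icc a b, ‖F12 z‖ₑ) :=
    setLIntegral_mono' (measurableSet_Icc.prod measurableSet_Icc) fun z hz => key _ hz.1 _ hz.2
  have m2 : Measurable fun s' => ∫⁻ α in Icc a b, ‖F2 (s', α)‖ₑ :=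
    Measurable.lintegral_prod_right' (f := fun z => ‖F2 z‖ₑ) (by fun_prop)
  have m1 : Measurable fun φ' => ∫⁻ τ in Icc s₁ s₂, ‖F1 (τ, φ')‖ₑ :=
    Measurable.lintegral_prod_left' (f := fun z => ‖F1 z‖ₑ) (by fun_prop)
  have m1' : Measurable fun z : ℝ × ℝ => ∫⁻ τ in Icc s₁ s₂, ‖F1 (τ, z.2)‖ₑ := m1.comp measurable_snd
  rw [setLIntegral_const, lintegral_add_right _ (by fun_prop), lintegral_add_right _ m1',
    lintegral_add_left (by fun_prop), setLIntegral_const] at hm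
  have hv : volume (Icc s₁ s₂ ×ˢ Icc c d) = volume (Icc s₁ s₂) * volume (Icc c d) := by
    rw [Measure.volume_eq_prod, Measure.prod_prod]
  have i2 : ∫⁻ z in Icc s₁ s₂ ×ˢ Icc c d, (∫⁻ α in Icc a b, ‖F2 (z.1, α)‖ₑ) =
      volume (Icc c d) * ∫⁻ z in Icc s₁ s₂ ×ˢ Icc a b, ‖F2 z‖ₑ := by
    rw [Measure.volume_eq_prod, setLIntegral_prod _ (by fun_prop), setLIntegral_prod _ (by fun_prop)]
    simp only [setLIntegral_const]
    rw [lintegral_mul_const _ m2, mul_comm]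
  have i1 : ∫⁻ z in Icc s₁ s₂ ×ˢ Icc c d, (∫⁻ τ in Icc s₁ s₂, ‖F1 (τ, z.2)‖ₑ) =
      volume (Icc s₁ s₂) * ∫⁻ z in Icc s₁ s₂ ×ˢ Icc c d, ‖F1 z‖ₑ := by
    rw [Measure.volume_eq_prod, setLIntegral_prod _ (by fun_prop),
      setLIntegral_prod_symm _ (by fun_prop)]
    simp only [setLIntegral_const]
    rw [mul_comm]
  rw [hv, i1, i2] at hm
  calc _ = ‖F (s, φ)‖ₑ * (volume (Icc s₁ s₂) * volume (Icc c d)) := by ring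
    _ ≤ _ := hm
    _ = _ := by ring

end Smooth

section Mollify

variable (η : ContDiffBump (0 : ℝ × ℝ))

/-- Mollification in the plane. -/
def moll (G : ℝ × ℝ → ℂ) : ℝ × ℝ → ℂ :=
  (η.normed volume ⋆[ContinuousLinearMap.lsmul ℝ ℝ, volume] G : ℝ × ℝ → ℂ)

theorem moll_eq (G : ℝ × ℝ → ℂ) (x : ℝ × ℝ) : moll η G x = ∫ t, η.normed volume (x - t) • G t := by
  rw [moll, convolution_lsmul_swap]

variable {G H : ℝ × ℝ → ℂ}

theorem moll_contDiff (hG : LocallyIntegrable G) : ContDiff ℝ 1 (moll η G) :=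
  η.hasCompactSupport_normed.contDiff_convolution_left _ η.contDiff_normed hG

theorem hasFDerivAt_moll (hG : LocallyIntegrable G) (x v : ℝ × ℝ) :
    fderiv ℝ (moll η G) x v = ∫ t, (fderiv ℝ (η.normed volume) (x - t) v) • G t := by
  have h1 := (HasCompactSupport.hasFDerivAt_convolution_right
    (ContinuousLinearMap.lsmul ℝ ℝ : ℝ →L[ℝ] ℂ →L[ℝ] ℂ).flip η.hasCompactSupport_normed hG
    (η.contDiff_normed (μ := volume)) x)
  rw [convolution_flip] at h1
  have h2 : fderiv ℝ (moll η G) x = _ := h1.fderiv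
  rw [h2, convolution_precompR_apply _ hG (η.hasCompactSupport_normed.fderiv ℝ)
    ((η.contDiff_normed (n := 1)).continuous_fderiv one_ne_zero)]
  rfl

/-- The translated mollifier is an admissible test function as soon as its closed ball lies in U. -/
theorem fderiv_moll {U : Set (ℝ × ℝ)} {v : ℝ × ℝ} (hG : LocallyIntegrable G)
    (h : WeakDir U v G H) {x : ℝ × ℝ} (hx : Metric.closedBall x η.rOut ⊆ U) :
    fderiv ℝ (moll η G) x v = moll η H x := by
  have hd : ∀ t, fderiv ℝ (fun t => η.normed volume (x - t)) t v =
      -(fderiv ℝ (η.normed volume) (x - t) v) := by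
    intro t
    have e1 : HasFDerivAt (η.normed volume) (fderiv ℝ (η.normed volume) (x - t)) (x - t) :=
      ((η.contDiff_normed (n := 1)).differentiable one_ne_zero _).hasFDerivAt
    have e2 : HasFDerivAt (fun t : ℝ × ℝ => x - t) (-ContinuousLinearMap.id ℝ (ℝ × ℝ)) t :=
      (hasFDerivAt_id t).const_sub x
    have := (e1.comp t e2).fderiv
    change fderiv ℝ (η.normed volume ∘ fun t => x - t) t v = _
    rw [this]
    simp
  have hts : tsupport (fun t => η.normed volume (x - t)) ⊆ Metric.closedBall x η.rOut := by
    refine closure_minimal (fun t ht => ?_) Metric.isClosed_closedBall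
    have : x - t ∈ tsupport (η.normed volume) := subset_tsupport _ ht
    rw [η.tsupport_normed_eq] at this
    rw [mem_closedBall_zero_iff] at this
    rwa [Metric.mem_closedBall, dist_comm, dist_eq_norm]
  have := h (fun t => η.normed volume (x - t))
    (η.contDiff_normed.comp (contDiff_const.sub contDiff_id))
    (HasCompactSupport.of_support_subset_isCompact (isCompact_closedBall x η.rOut)
      ((subset_tsupport _).trans hts)) (hts.trans hx)
  rw [hasFDerivAt_moll η hG, moll_eq, this, ← integral_neg]
  congr 1
  ext t
  rw [hd, neg_smul, neg_neg]

/-- A local form of Young's inequality: the kernel has mass one, and only values of G within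
distance `rOut` of A enter. -/
theorem setLIntegral_moll_le (hG : AEStronglyMeasurable G) {A B : Set (ℝ × ℝ)}
    (hA : MeasurableSet A) (hB : MeasurableSet B)
    (hAB : ∀ x ∈ A, Metric.closedBall x η.rOut ⊆ B) :
    ∫⁻ x in A, ‖moll η G x‖ₑ ≤ ∫⁻ x in B, ‖G x‖ₑ := by
  have hη : Measurable (η.normed volume : ℝ × ℝ → ℝ) :=
    (η.continuous_normed (μ := volume)).measurable
  calc ∫⁻ x in A, ‖moll η G x‖ₑ
      ≤ ∫⁻ x in A, ∫⁻ t, ‖η.normed volume (x - t)‖ₑ * ‖G t‖ₑ := by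
        refine lintegral_mono fun x => ?_
        rw [moll_eq]
        refine (enorm_integral_le_lintegral_enorm _).trans (le_of_eq ?_)
        simp_rw [enorm_smul]
    _ = ∫⁻ t, ∫⁻ x in A, ‖η.normed volume (x - t)‖ₑ * ‖G t‖ₑ := by
        refine lintegral_lintegral_swap ?_
        refine AEMeasurable.mul (M := ENNReal) ?_ ?_
        · exact (by fun_prop : Measurable fun p : (ℝ × ℝ) × (ℝ × ℝ) =>
            ‖η.normed volume (p.1 - p.2)‖ₑ).aemeasurable
        · exact (hG.comp_snd (μ := volume.restrict A)).enorm
    _ ≤ ∫⁻ t, B.indicator (fun t => ‖G t‖ₑ) t := by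
        refine lintegral_mono fun t => ?_
        by_cases ht : t ∈ B
        · rw [indicator_of_mem ht, lintegral_mul_const _ (by fun_prop)]
          refine mul_le_of_le_one_left' ?_
          calc _ ≤ ∫⁻ x, ‖η.normed volume (x - t)‖ₑ := setLIntegral_le_lintegral _ _
            _ = ∫⁻ x, ‖η.normed volume x‖ₑ :=
              lintegral_sub_right_eq_self (fun x => ‖η.normed volume x‖ₑ) t
            _ = ENNReal.ofReal (∫ x, η.normed volume x) := by
              rw [ofReal_integral_eq_lintegral_ofReal η.integrable_normed
                (.of_forall fun x => η.nonneg_normed x)]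
              refine lintegral_congr fun x => ?_
              rw [Real.enorm_of_nonneg (η.nonneg_normed x)]
            _ ≤ 1 := by rw [η.integral_normed, ENNReal.ofReal_one]
        · rw [indicator_of_notMem ht]
          refine le_of_eq ((setLIntegral_congr_fun hA (g := fun _ => 0) fun x hx => ?_).trans (by simp))
          have : η.normed volume (x - t) = 0 := by
            by_contra hne
            have : x - t ∈ tsupport (η.normed volume) := subset_tsupport _ hne
            rw [η.tsupport_normed_eq, mem_closedBall_zero_iff] at this
            exact ht (hAB x hx (by rwa [Metric.mem_closedBall, dist_comm, dist_eq_norm]))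
          simp [this]
    _ = _ := lintegral_indicator hB _

end Mollify

/-- The smooth inequality is applied to mollifications, at the cost of enlarging the domains by ε.
The left side converges at almost every point by Lebesgue differentiation, while the right side is
already independent of the mollification scale. -/
theorem rectangle_sobolev {G H1 H2 H12 : ℝ × ℝ → ℂ} {s₁ s₂ a b c d ε : ℝ} (hε : 0 < ε)
    (hJ : Icc c d ⊆ Icc a b) (hG : Integrable G) (hH1 : Integrable H1) (hH2 : Integrable H2)
    (hH12 : Integrable H12)
    (w1 : WeakDir (Ioo (s₁ - ε) (s₂ + ε) ×ˢ Ioo (a - ε) (b + ε)) (1, 0) G H1)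
    (w2 : WeakDir (Ioo (s₁ - ε) (s₂ + ε) ×ˢ Ioo (a - ε) (b + ε)) (0, 1) G H2)
    (w12 : WeakDir (Ioo (s₁ - ε) (s₂ + ε) ×ˢ Ioo (a - ε) (b + ε)) (0, 1) H1 H12) :
    ∀ᵐ z : ℝ × ℝ, z ∈ Icc s₁ s₂ ×ˢ Icc a b →
      volume (Icc s₁ s₂) * volume (Icc c d) * ‖G z‖ₑ ≤
      (∫⁻ z in Icc (s₁ - ε) (s₂ + ε) ×ˢ Icc (c - ε) (d + ε), ‖G z‖ₑ) +
      volume (Icc c d) * (∫⁻ z in Icc (s₁ - ε) (s₂ + ε) ×ˢ Icc (a - ε) (b + ε), ‖H2 z‖ₑ) +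
      volume (Icc s₁ s₂) * (∫⁻ z in Icc (s₁ - ε) (s₂ + ε) ×ˢ Icc (c - ε) (d + ε), ‖H1 z‖ₑ) +
      volume (Icc s₁ s₂) * volume (Icc c d) *
        (∫⁻ z in Icc (s₁ - ε) (s₂ + ε) ×ˢ Icc (a - ε) (b + ε), ‖H12 z‖ₑ) := by
  -- Outer radius twice the inner one: the differentiation theorem below needs a bounded ratio, here
  -- K = 2.
  let η : ℕ → ContDiffBump (0 : ℝ × ℝ) := fun n =>
    ⟨ε / (4 * (n + 1)), ε / (2 * (n + 1)), by positivity, by gcongr; norm_num⟩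
  have hηε : ∀ n, (η n).rOut < ε := by
    intro n
    change ε / (2 * (n + 1)) < ε
    rw [div_lt_iff₀ (by positivity)]
    nlinarith [(Nat.cast_nonneg n : (0 : ℝ) ≤ n)]
  have hlim : Tendsto (fun n => (η n).rOut) atTop (𝓝 0) := by
    have h1 : Tendsto (fun n : ℕ => ε / 2 * (1 / ((n : ℝ) + 1))) atTop (𝓝 (ε / 2 * 0)) :=
      tendsto_one_div_add_atTop_nhds_zero_nat.const_mul _
    rw [mul_zero] at h1
    refine h1.congr fun n => ?_
    change _ = ε / (2 * (n + 1))
    field_simp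
  have hball : ∀ n (x : ℝ × ℝ) (p q r s : ℝ), x ∈ Icc p q ×ˢ Icc r s →
      Metric.closedBall x (η n).rOut ⊆ Ioo (p - ε) (q + ε) ×ˢ Ioo (r - ε) (s + ε) := by
    intro n x p q r s hx y hy
    rw [Metric.mem_closedBall, Prod.dist_eq, Real.dist_eq, Real.dist_eq, max_le_iff,
      abs_le, abs_le] at hy
    have := hηε n
    obtain ⟨⟨h1, h2⟩, h3, h4⟩ := hx
    exact ⟨⟨by linarith, by linarith⟩, by linarith, by linarith⟩
  have hball' : ∀ n (x : ℝ × ℝ) (p q r s : ℝ), x ∈ Icc p q ×ˢ Icc r s →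
      Metric.closedBall x (η n).rOut ⊆ Icc (p - ε) (q + ε) ×ˢ Icc (r - ε) (s + ε) :=
    fun n x p q r s hx => (hball n x p q r s hx).trans
      (prod_mono Ioo_subset_Icc_self Ioo_subset_Icc_self)
  have hms : ∀ p q r s : ℝ, MeasurableSet (Icc p q ×ˢ Icc r s) := fun p q r s =>
    measurableSet_Icc.prod measurableSet_Icc
  filter_upwards [ContDiffBump.ae_convolution_tendsto_right_of_locallyIntegrable (K := 2) hlim
    (.of_forall fun n => le_of_eq (by
      change ε / (2 * (n + 1)) = 2 * (ε / (4 * (n + 1))); field_simp; norm_num))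
      hG.locallyIntegrable] with z hz hzm
  have hc : ∀ (n) {K : ℝ × ℝ → ℂ}, Integrable K → Continuous (moll (η n) K) := fun n K hK =>
    (moll_contDiff (η n) hK.locallyIntegrable).continuous
  have hder1 : ∀ (n) {K K' : ℝ × ℝ → ℂ}, Integrable K →
      WeakDir (Ioo (s₁ - ε) (s₂ + ε) ×ˢ Ioo (a - ε) (b + ε)) (1, 0) K K' →
      ∀ s ∈ Icc s₁ s₂, ∀ φ ∈ Icc a b,
        HasDerivAt (fun s => moll (η n) K (s, φ)) (moll (η n) K' (s, φ)) s := by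
    intro n K K' hK hw s hs φ hφ
    rw [← fderiv_moll (η n) hK.locallyIntegrable hw (hball n (s, φ) _ _ _ _ ⟨hs, hφ⟩)]
    have h1 := ((moll_contDiff (η n) hK.locallyIntegrable).differentiable one_ne_zero
      (s, φ)).hasFDerivAt
    exact h1.comp_hasDerivAt (f := fun s => (s, φ)) s
      ((hasDerivAt_id s).prodMk (hasDerivAt_const s φ))
  have hder2 : ∀ (n) {K K' : ℝ × ℝ → ℂ}, Integrable K →
      WeakDir (Ioo (s₁ - ε) (s₂ + ε) ×ˢ Ioo (a - ε) (b + ε)) (0, 1) K K' →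
      ∀ s ∈ Icc s₁ s₂, ∀ φ ∈ Icc a b,
        HasDerivAt (fun φ => moll (η n) K (s, φ)) (moll (η n) K' (s, φ)) φ := by
    intro n K K' hK hw s hs φ hφ
    rw [← fderiv_moll (η n) hK.locallyIntegrable hw (hball n (s, φ) _ _ _ _ ⟨hs, hφ⟩)]
    have h1 := ((moll_contDiff (η n) hK.locallyIntegrable).differentiable one_ne_zero
      (s, φ)).hasFDerivAt
    exact h1.comp_hasDerivAt (f := fun φ => (s, φ)) φ
      ((hasDerivAt_const φ s).prodMk (hasDerivAt_id φ))
  have hzt : Tendsto (fun n => volume (Icc s₁ s₂) * volume (Icc c d) * ‖moll (η n) G z‖ₑ) atTop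
      (𝓝 (volume (Icc s₁ s₂) * volume (Icc c d) * ‖G z‖ₑ)) :=
    ENNReal.Tendsto.const_mul hz.enorm (Or.inr (by
      simp [Real.volume_Icc, ENNReal.mul_eq_top]))
  refine le_of_tendsto' hzt fun n => ?_
  refine (rectangle_sobolev_smooth (F := moll (η n) G) (hc n hH1) (hc n hH2) (hc n hH12) (hc n hG)
    (hder1 n hG w1) (hder2 n hG w2) (hder2 n hH1 w12) hJ hzm.1 hzm.2).trans ?_
  gcongr (?_ + _ * ?_ + _ * ?_ + _ * ?_)
  all_goals
    refine setLIntegral_moll_le (η n) (Integrable.aestronglyMeasurable ‹_›) (hms _ _ _ _) (hms _ _ _ _)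
      fun x hx => hball' n x _ _ _ _ hx

end RotatingEuler
end

noncomputable section

namespace RotatingEuler

open Filter Topology Set

theorem contDiff_of_tsupport_subset {E F : Type*} [NormedAddCommGroup E] [NormedSpace ℝ E]
    [NormedAddCommGroup F] [NormedSpace ℝ F] {n : WithTop ℕ∞} {f : E → F} {U : Set E}
    (hU : IsOpen U) (hf : ContDiffOn ℝ n f U) (hs : tsupport f ⊆ U) : ContDiff ℝ n f := by
  rw [contDiff_iff_contDiffAt]
  intro x
  by_cases hx : x ∈ tsupport f
  · exact hf.contDiffAt (hU.mem_nhds (hs hx))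
  · have : f =ᶠ[𝓝 x] fun _ => 0 := notMem_tsupport_iff_eventuallyEq.1 hx
    exact contDiffAt_const.congr_of_eventuallyEq this

/-! ### The distance to the axis -/

/-- The distance to the vertical axis. -/
def axisDist (x : E3) : ℝ := √((x 0) ^ 2 + (x 1) ^ 2)

theorem axisDist_sq (x : E3) : axisDist x ^ 2 = (x 0) ^ 2 + (x 1) ^ 2 :=
  Real.sq_sqrt (by positivity)

theorem axisDist_nonneg (x : E3) : 0 ≤ axisDist x := Real.sqrt_nonneg _

theorem mem_offAxis_iff {x : E3} : x ∈ offAxis ↔ 0 < axisDist x := by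
  rw [axisDist, Real.sqrt_pos]
  constructor
  · rintro (h | h)
    · have := sq_pos_of_ne_zero h; positivity
    · have := sq_pos_of_ne_zero h; positivity
  · intro h
    by_contra hx
    simp only [offAxis, mem_ofPred_eq, not_or, not_not] at hx
    simp [hx.1, hx.2] at h

theorem norm_sq_eq (x : E3) : ‖x‖ ^ 2 = (x 0) ^ 2 + (x 1) ^ 2 + (x 2) ^ 2 := by
  rw [EuclideanSpace.norm_sq_eq]
  simp [Fin.sum_univ_three]

theorem abs_coord_le (x : E3) (i : Fin 3) : |x i| ≤ ‖x‖ := by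
  rw [← Real.norm_eq_abs]
  exact PiLp.norm_apply_le x i

theorem axisDist_le_norm (x : E3) : axisDist x ≤ ‖x‖ := by
  have h1 := axisDist_sq x
  have h2 := norm_sq_eq x
  nlinarith [axisDist_nonneg x, norm_nonneg x, sq_nonneg (x 2)]

theorem continuous_axisDist : Continuous axisDist := by
  unfold axisDist; fun_prop

theorem isOpen_offAxis : IsOpen offAxis := by
  have : offAxis = axisDist ⁻¹' Ioi 0 := by
    ext x; exact mem_offAxis_iff
  rw [this]
  exact isOpen_Ioi.preimage continuous_axisDist

theorem contDiff_coord {n : WithTop ℕ∞} (i : Fin 3) : ContDiff ℝ n (fun x : E3 => x i) := by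
  fun_prop

theorem hasFDerivAt_coord (i : Fin 3) (x : E3) :
    HasFDerivAt (fun x : E3 => x i) (EuclideanSpace.proj i : E3 →L[ℝ] ℝ) x :=
  (EuclideanSpace.proj i : E3 →L[ℝ] ℝ).hasFDerivAt

theorem contDiffOn_axisDist {n : WithTop ℕ∞} : ContDiffOn ℝ n axisDist offAxis := by
  intro x hx
  have h := mem_offAxis_iff.1 hx
  refine ContDiffAt.contDiffWithinAt (ContDiffAt.sqrt ?_ ?_)
  · exact (((contDiff_coord 0).pow 2).add ((contDiff_coord 1).pow 2)).contDiffAt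
  · exact (Real.sqrt_pos.1 h).ne'

theorem hasFDerivAt_axisDist {x : E3} (hx : x ∈ offAxis) :
    HasFDerivAt axisDist ((axisDist x)⁻¹ • (x 0 • (EuclideanSpace.proj 0 : E3 →L[ℝ] ℝ) +
      x 1 • (EuclideanSpace.proj 1 : E3 →L[ℝ] ℝ))) x := by
  have h := mem_offAxis_iff.1 hx
  have h1 := (((hasFDerivAt_coord 0 x).pow 2).add ((hasFDerivAt_coord 1 x).pow 2)).sqrt
    (Real.sqrt_pos.1 h).ne'
  convert! h1 using 1
  rw [axisDist] at h
  ext v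
  simp [axisDist]
  field_simp

/-! ### Boxes and the Cauchy-Schwarz inequality -/

/-- A symmetric box. -/
def box (a b c : ℝ) : Set E3 := {x | |x 0| ≤ a ∧ |x 1| ≤ b ∧ |x 2| ≤ c}

theorem measurableSet_box (a b c : ℝ) : MeasurableSet (box a b c) := by
  have : IsClosed (box a b c) := by
    have h : ∀ (i : Fin 3) (a : ℝ), IsClosed {x : E3 | |x i| ≤ a} := fun i a =>
      isClosed_le (contDiff_coord (n := 0) i).continuous.abs continuous_const
    exact (h 0 a).inter ((h 1 b).inter (h 2 c))
  exact this.measurableSet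

theorem volume_box {a b c : ℝ} (ha : 0 ≤ a) (hb : 0 ≤ b) :
    volume (box a b c) = ENNReal.ofReal (8 * (a * b * c)) := by
  have h := (EuclideanSpace.volume_preserving_symm_measurableEquiv_toLp (Fin 3)).symm
  have e : (MeasurableEquiv.toLp 2 (Fin 3 → ℝ)) ⁻¹' (box a b c) =
      Set.pi univ ![Icc (-a) a, Icc (-b) b, Icc (-c) c] := by
    ext x
    simp [box, Fin.forall_fin_succ, abs_le]
  have h2 := h.measure_preimage_equiv (box a b c)
  rw [MeasurableEquiv.symm_symm] at h2
  rw [← h2, e, volume_pi_pi]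
  simp only [Fin.prod_univ_three, Matrix.cons_val_zero, Matrix.cons_val_one, Matrix.cons_val,
    Real.volume_Icc]
  rw [← ENNReal.ofReal_mul (by linarith), ← ENNReal.ofReal_mul (by nlinarith)]
  congr 1
  ring

theorem sq_lintegral_le {α : Type*} [MeasurableSpace α] (μ : Measure α) {f : α → ℝ≥0∞}
    (hf : AEMeasurable f μ) : (∫⁻ x, f x ∂μ) ^ 2 ≤ μ univ * ∫⁻ x, f x ^ 2 ∂μ := by
  have h := ENNReal.lintegral_mul_le_Lp_mul_Lq μ (p := 2) (q := 2) Real.HolderConjugate.two_two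
    (f := fun _ => 1) (g := f) aemeasurable_const hf
  simp only [Pi.mul_apply, one_mul, ENNReal.one_rpow, lintegral_const] at h
  calc (∫⁻ x, f x ∂μ) ^ 2 ≤ (μ univ ^ (1 / 2 : ℝ) * (∫⁻ x, f x ^ (2 : ℝ) ∂μ) ^ (1 / 2 : ℝ)) ^ 2 := by
        gcongr
    _ = _ := by
        rw [mul_pow, ← ENNReal.rpow_natCast, ← ENNReal.rpow_natCast, ← ENNReal.rpow_mul,
          ← ENNReal.rpow_mul]
        simp

theorem lintegral_enorm_sq_L2 (f : L2) : ∫⁻ x, ‖f x‖ₑ ^ 2 = ‖f‖ₑ ^ 2 := by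
  rw [Lp.enorm_def, eLpNorm_eq_lintegral_rpow_enorm_toReal (by simp) (by simp),
    ← ENNReal.rpow_natCast, ← ENNReal.rpow_mul]
  simp

/-! ### Weak derivatives along linear fields -/

theorem locallyIntegrable_L2 (f : L2) : LocallyIntegrable f :=
  (Lp.memLp f).locallyIntegrable one_le_two

theorem integrable_L2_mul (f : L2) {φ : E3 → ℂ} (hφ : Continuous φ) (hc : HasCompactSupport φ) :
    Integrable (fun x => f x * φ x) :=
  (Lp.memLp f).integrable_mul (hφ.memLp_of_hasCompactSupport (p := 2) hc)

theorem hasCompactSupport_fderiv_apply {ψ : E3 → ℂ} (hc : HasCompactSupport ψ) (V : E3 → E3) :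
    HasCompactSupport (fun x => fderiv ℝ ψ x (V x)) := by
  refine HasCompactSupport.intro hc.isCompact fun x hx => ?_
  have : fderiv ℝ ψ x = 0 := by
    by_contra h
    exact hx (support_fderiv_subset ℝ h)
  simp [this]

theorem integral_ofReal_smul (f : E3 → ℂ) (ψ : E3 → ℝ) :
    ∫ x, ψ x • f x = ∫ x, f x * (ψ x : ℂ) := by
  congr 1; ext x; rw [Complex.real_smul, mul_comm]

/-- Serves to transfer symmetries from f to its weak derivative. -/
theorem WeakLin.unique {A : E3 →L[ℝ] E3} {τ : ℝ} {f : E3 → ℂ} {g g' : L2} (h : WeakLin A τ f g)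
    (h' : WeakLin A τ f g') : ∀ᵐ x, g x = g' x := by
  refine ae_eq_of_integral_contDiff_smul_eq (locallyIntegrable_L2 g) (locallyIntegrable_L2 g') ?_
  intro ψ hψ hc
  rw [integral_ofReal_smul, integral_ofReal_smul]
  have hs := Complex.ofRealCLM.contDiff.comp hψ
  have hcs := hc.comp_left (g := fun r : ℝ => (r : ℂ)) Complex.ofReal_zero
  exact (h _ hs hcs).trans (h' _ hs hcs).symm

theorem fderiv_ofReal_comp {ψ : E3 → ℝ} {x : E3} (hψ : DifferentiableAt ℝ ψ x) (v : E3) :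
    fderiv ℝ (fun x => ((ψ x : ℝ) : ℂ)) x v = ((fderiv ℝ ψ x v : ℝ) : ℂ) := by
  have : HasFDerivAt (fun x => ((ψ x : ℝ) : ℂ)) (Complex.ofRealCLM.comp (fderiv ℝ ψ x)) x :=
    Complex.ofRealCLM.hasFDerivAt.comp x hψ.hasFDerivAt
  rw [this.fderiv]
  simp

theorem WeakLin.of_real {A : E3 →L[ℝ] E3} {τ : ℝ} {f g : L2}
    (h : ∀ ψ : E3 → ℝ, ContDiff ℝ ∞ ψ → HasCompactSupport ψ →
      ∫ x, g x * (ψ x : ℂ) = -∫ x, f x * ((fderiv ℝ ψ x (A x) + τ * ψ x : ℝ) : ℂ)) :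
    WeakLin A τ f g := by
  intro ψ hψ hc
  have hr : ContDiff ℝ ∞ fun x => (ψ x).re := Complex.reCLM.contDiff.comp hψ
  have hi : ContDiff ℝ ∞ fun x => (ψ x).im := Complex.imCLM.contDiff.comp hψ
  have hrc : HasCompactSupport fun x => (ψ x).re := hc.comp_left (g := Complex.re) rfl
  have hic : HasCompactSupport fun x => (ψ x).im := hc.comp_left (g := Complex.im) rfl
  have hcr : ∀ {θ : E3 → ℝ}, HasCompactSupport θ → HasCompactSupport fun x => (θ x : ℂ) :=
    fun hθ => hθ.comp_left (g := fun r : ℝ => (r : ℂ)) Complex.ofReal_zero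
  have hD : ∀ {θ : E3 → ℝ}, ContDiff ℝ ∞ θ → HasCompactSupport θ →
      Integrable fun x => f x * ((fderiv ℝ θ x (A x) + τ * θ x : ℝ) : ℂ) := by
    intro θ hθ hθc
    have h1 := hθ.continuous
    have h2 := hθ.continuous_fderiv (by simp)
    refine integrable_L2_mul f (by fun_prop) (hcr (HasCompactSupport.add ?_ hθc.mul_left))
    refine HasCompactSupport.intro hθc.isCompact fun x hx => ?_
    have : fderiv ℝ θ x = 0 := by
      by_contra h
      exact hx (support_fderiv_subset ℝ h)
    simp [this]
  have e1 : ∀ x, g x * ψ x = g x * ((ψ x).re : ℂ) + (g x * ((ψ x).im : ℂ)) * Complex.I := by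
    intro x
    conv_lhs => rw [← Complex.re_add_im (ψ x)]
    ring
  have e2 : ∀ x, f x * (fderiv ℝ ψ x (A x) + τ * ψ x) =
      f x * ((fderiv ℝ (fun x => (ψ x).re) x (A x) + τ * (ψ x).re : ℝ) : ℂ) +
      (f x * ((fderiv ℝ (fun x => (ψ x).im) x (A x) + τ * (ψ x).im : ℝ) : ℂ)) * Complex.I := by
    intro x
    have hd := (hψ.differentiable (by simp) x).hasFDerivAt
    have d1 : fderiv ℝ (fun x => (ψ x).re) x (A x) = (fderiv ℝ ψ x (A x)).re := by
      have : HasFDerivAt (fun x => (ψ x).re) (Complex.reCLM.comp (fderiv ℝ ψ x)) x :=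
        Complex.reCLM.hasFDerivAt.comp x hd
      rw [this.fderiv]; rfl
    have d2 : fderiv ℝ (fun x => (ψ x).im) x (A x) = (fderiv ℝ ψ x (A x)).im := by
      have : HasFDerivAt (fun x => (ψ x).im) (Complex.imCLM.comp (fderiv ℝ ψ x)) x :=
        Complex.imCLM.hasFDerivAt.comp x hd
      rw [this.fderiv]; rfl
    rw [d1, d2]
    conv_lhs => rw [← Complex.re_add_im (ψ x), ← Complex.re_add_im (fderiv ℝ ψ x (A x))]
    push_cast
    ring
  simp_rw [e1, e2]
  rw [integral_add, integral_add, integral_mul_const, integral_mul_const, h _ hr hrc, h _ hi hic]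
  · ring
  · exact hD hr hrc
  · exact (hD hi hic).mul_const _
  · exact integrable_L2_mul g (Complex.continuous_ofReal.comp hr.continuous) (hcr hrc)
  · exact (integrable_L2_mul g (Complex.continuous_ofReal.comp hi.continuous) (hcr hic)).mul_const _

/-! ### Divergence -/

theorem divergence_smul {ψ : E3 → ℝ} {V : E3 → E3} {x : E3} (hψ : DifferentiableAt ℝ ψ x)
    (hV : DifferentiableAt ℝ V x) :
    divergence (fun y => ψ y • V y) x = fderiv ℝ ψ x (V x) + ψ x * divergence V x := by
  unfold divergence
  rw [(hψ.hasFDerivAt.fun_smul hV.hasFDerivAt).fderiv]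
  conv_rhs => rw [sum_coord (V x)]
  simp only [map_sum, map_smul, _root_.add_apply, _root_.smul_apply,
    ContinuousLinearMap.smulRight_apply, PiLp.add_apply, PiLp.smul_apply, smul_eq_mul,
    Finset.sum_add_distrib, Finset.mul_sum]
  rw [add_comm]
  congr 1
  refine Finset.sum_congr rfl fun k _ => ?_
  rw [mul_comm]

theorem divergence_linear (A : E3 →L[ℝ] E3) (x : E3) :
    divergence A x = ∑ j, A (ebasis j) j := by
  simp [divergence]

theorem divergence_add {V W : E3 → E3} {x : E3} (hV : DifferentiableAt ℝ V x)
    (hW : DifferentiableAt ℝ W x) :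
    divergence (fun y => V y + W y) x = divergence V x + divergence W x := by
  unfold divergence
  rw [(hV.hasFDerivAt.fun_add hW.hasFDerivAt).fderiv]
  simp [Finset.sum_add_distrib]

theorem IsS.weakLin {f g : L2} (h : IsS f g) : WeakLin (ContinuousLinearMap.id ℝ E3) 3 f g := by
  refine WeakLin.of_real fun ψ hψ hc => ?_
  rw [h ψ hψ hc (subset_univ _)]
  congr 2
  ext x
  rw [divergence_smul (V := fun y => y) (hψ.differentiable (by simp) x) differentiableAt_id]
  have := divergence_linear (ContinuousLinearMap.id ℝ E3) x
  simp only [ContinuousLinearMap.coe_id', ContinuousLinearMap.id_apply] at this ⊢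
  have e : divergence (fun y : E3 => y) x = 3 := by
    change divergence id x = 3
    rw [this]
    simp
  rw [e]
  ring_nf

/-! ### Rotations about the axis -/

/-- The generator of the rotations about the vertical axis. -/
def rotGen : E3 →L[ℝ] E3 :=
  (EuclideanSpace.proj 0 : E3 →L[ℝ] ℝ).smulRight (ebasis 1) -
    (EuclideanSpace.proj 1 : E3 →L[ℝ] ℝ).smulRight (ebasis 0)

theorem rotGen_apply (x : E3) : rotGen x = !₂[-x 1, x 0, 0] := by
  ext i
  fin_cases i <;> simp [rotGen, ebasis]

theorem rot_eq (θ : ℝ) (x : E3) : rot θ x = Real.cos θ • (x 0 • ebasis 0 + x 1 • ebasis 1) +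
    Real.sin θ • rotGen x + x 2 • ebasis 2 := by
  rw [rotGen_apply]
  ext i
  fin_cases i <;> simp [rot, ebasis] <;> ring

/-- Rotation about the vertical axis as a linear isometry. -/
def rotL (θ : ℝ) : E3 ≃ₗᵢ[ℝ] E3 where
  toFun := rot θ
  invFun := rot (-θ)
  map_add' x y := by
    ext i
    fin_cases i <;> simp [rot] <;> ring
  map_smul' c x := by
    ext i
    fin_cases i <;> simp [rot] <;> ring
  left_inv x := by
    ext i
    fin_cases i <;> simp [rot]
    · linear_combination (x 0) * Real.sin_sq_add_cos_sq θ
    · linear_combination (x 1) * Real.sin_sq_add_cos_sq θ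
  right_inv x := by
    ext i
    fin_cases i <;> simp [rot]
    · linear_combination (x 0) * Real.sin_sq_add_cos_sq θ
    · linear_combination (x 1) * Real.sin_sq_add_cos_sq θ
  norm_map' x := by
    refine (sq_eq_sq₀ (norm_nonneg _) (norm_nonneg _)).1 ?_
    rw [norm_sq_eq, norm_sq_eq]
    simp [rot]
    linear_combination (x 0 ^ 2 + x 1 ^ 2) * Real.sin_sq_add_cos_sq θ

theorem rotL_symm_apply (θ : ℝ) (x : E3) : (rotL θ).symm x = rot (-θ) x := rfl

theorem measurePreserving_rot (θ : ℝ) : MeasurePreserving (rot θ) (volume : Measure E3) volume :=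
  (rotL θ).measurePreserving

theorem rot_neg_rot (θ : ℝ) (x : E3) : rot (-θ) (rot θ x) = x := (rotL θ).symm_apply_apply x

theorem norm_rot (θ : ℝ) (x : E3) : ‖rot θ x‖ = ‖x‖ := (rotL θ).norm_map x

theorem integral_comp_rot (θ : ℝ) (F : E3 → ℂ) : ∫ x, F (rot θ x) = ∫ x, F x :=
  (measurePreserving_rot θ).integral_comp (rotL θ).toHomeomorph.measurableEmbedding F

theorem hasDerivAt_rot (θ : ℝ) (x : E3) :
    HasDerivAt (fun θ => rot θ x) (rotGen (rot θ x)) θ := by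
  have h := (((Real.hasDerivAt_cos θ).smul_const (x 0 • ebasis 0 + x 1 • ebasis 1)).add
    ((Real.hasDerivAt_sin θ).smul_const (rotGen x))).add_const (x 2 • ebasis 2)
  have e : (fun θ => rot θ x) = fun θ => Real.cos θ • (x 0 • ebasis 0 + x 1 • ebasis 1) +
    Real.sin θ • rotGen x + x 2 • ebasis 2 := funext fun θ => rot_eq θ x
  rw [e]
  convert! h using 1
  rw [rotGen_apply, rotGen_apply]
  ext i
  fin_cases i <;> simp [rot, ebasis] <;> ring

/-- The scaling field commutes with rotations, so the rotated g is again a weak derivative of the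
rotation-invariant f, and weak derivatives are unique. -/
theorem IsAxisymmetric.of_weakLin_id {f g : L2} (hf : IsAxisymmetric f)
    (h : WeakLin (ContinuousLinearMap.id ℝ E3) 3 f g) : IsAxisymmetric g := by
  intro θ
  let g' : L2 := Lp.compMeasurePreserving (rot θ) (measurePreserving_rot θ) g
  have hg' : g' =ᵐ[volume] g ∘ rot θ := Lp.coeFn_compMeasurePreserving g (measurePreserving_rot θ)
  have hw : WeakLin (ContinuousLinearMap.id ℝ E3) 3 f g' := by
    intro ψ hψ hc
    let ψ' : E3 → ℂ := ψ ∘ (rotL θ).symm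
    have hψ' : ContDiff ℝ ∞ ψ' := hψ.comp (rotL θ).symm.contDiff
    have hc' : HasCompactSupport ψ' :=
      hc.comp_homeomorph (rotL θ).symm.toHomeomorph
    have hd : ∀ x, fderiv ℝ ψ' (rot θ x) (rot θ x) = fderiv ℝ ψ x x := by
      intro x
      have h1 : HasFDerivAt ψ (fderiv ℝ ψ x) ((rotL θ).symm (rot θ x)) := by
        rw [rotL_symm_apply, rot_neg_rot]
        exact (hψ.differentiable (by simp) x).hasFDerivAt
      have h2 := h1.comp (rot θ x) (rotL θ).symm.toContinuousLinearEquiv.hasFDerivAt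
      rw [HasFDerivAt.fderiv h2]
      change fderiv ℝ ψ x ((rotL θ).symm (rot θ x)) = _
      rw [rotL_symm_apply, rot_neg_rot]
    have e0 : ∀ x, ψ' (rot θ x) = ψ x := fun x => by
      change ψ (rot (-θ) (rot θ x)) = _
      rw [rot_neg_rot]
    calc ∫ x, g' x * ψ x = ∫ x, g (rot θ x) * ψ' (rot θ x) := by
          refine integral_congr_ae ?_
          filter_upwards [hg'] with x hx
          rw [hx, e0]; rfl
      _ = ∫ x, g x * ψ' x := integral_comp_rot θ fun x => g x * ψ' x
      _ = -∫ x, f x * (fderiv ℝ ψ' x x + (3 : ℝ) * ψ' x) := h ψ' hψ' hc'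
      _ = -∫ x, f (rot θ x) * (fderiv ℝ ψ' (rot θ x) (rot θ x) + (3 : ℝ) * ψ' (rot θ x)) := by
          rw [integral_comp_rot θ fun x => f x * (fderiv ℝ ψ' x x + (3 : ℝ) * ψ' x)]
      _ = _ := by
          congr 1
          refine integral_congr_ae ?_
          filter_upwards [hf θ] with x hx
          rw [hx, e0, hd]; rfl
  filter_upwards [hw.unique h, hg'] with x h1 h2
  rw [← h1, h2]; rfl

/-- By invariance of f the integral of f · (h ∘ rot θ) does not depend on θ; differentiate under the
integral sign at θ = 0. Domination is available because centred balls are rotation invariant. -/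
theorem integral_rotGen_eq_zero {f : L2} (hf : IsAxisymmetric f) {h : E3 → ℝ}
    (hh : ContDiff ℝ ∞ h) (hc : HasCompactSupport h) :
    ∫ x, f x * ((fderiv ℝ h x (rotGen x) : ℝ) : ℂ) = 0 := by
  have hcont := hh.continuous
  have hdc := hh.continuous_fderiv (by simp)
  let D : E3 → ℂ := fun x => ((fderiv ℝ h x (rotGen x) : ℝ) : ℂ)
  have hDc : Continuous D := by fun_prop
  have hDs : HasCompactSupport D := by
    refine HasCompactSupport.intro hc.isCompact fun x hx => ?_
    have : fderiv ℝ h x = 0 := by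
      by_contra h'
      exact hx (support_fderiv_subset ℝ h')
    simp [D, this]
  obtain ⟨M, hM⟩ := hDc.bounded_above_of_compact_support hDs
  obtain ⟨R, hR⟩ := hDs.isCompact.isBounded.subset_closedBall (0 : E3)
  have hcs : HasCompactSupport fun x => (h x : ℂ) :=
    hc.comp_left (g := fun r : ℝ => (r : ℂ)) Complex.ofReal_zero
  have hrc : ∀ θ, Continuous (rot θ) := fun θ => (rotL θ).continuous
  have key := hasDerivAt_integral_of_dominated_loc_of_deriv_le (μ := (volume : Measure E3))
    (x₀ := (0 : ℝ)) (s := univ)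
    (bound := fun x => ‖f x‖ * (Metric.closedBall (0 : E3) R).indicator (fun _ => M) x)
    (F := fun θ x => f x * (h (rot θ x) : ℂ)) (F' := fun θ x => f x * D (rot θ x))
    univ_mem (.of_forall fun θ => (Lp.aestronglyMeasurable f).mul
      (by have := hrc θ; exact (by fun_prop : Continuous fun x => (h (rot θ x) : ℂ)).aestronglyMeasurable))
    (by
      have : (fun x => f x * (h (rot 0 x) : ℂ)) = fun x => f x * (h x : ℂ) := by
        ext x
        have : rot 0 x = x := by ext i; fin_cases i <;> simp [rot]
        rw [this]
      rw [this]
      exact integrable_L2_mul f (by fun_prop) hcs)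
    ((Lp.aestronglyMeasurable f).mul (hDc.comp (hrc 0)).aestronglyMeasurable)
    (.of_forall fun x θ _ => by
      rw [norm_mul]
      gcongr
      by_cases hx : x ∈ Metric.closedBall (0 : E3) R
      · rw [indicator_of_mem hx]; exact hM _
      · rw [indicator_of_notMem hx]
        have : D (rot θ x) = 0 := by
          refine image_eq_zero_of_notMem_tsupport fun h' => hx ?_
          have := hR h'
          rw [mem_closedBall_zero_iff, norm_rot] at this
          rwa [mem_closedBall_zero_iff]
        simp [this])
    (by
      have : MemLp ((Metric.closedBall (0 : E3) R).indicator (fun _ => M)) 2 volume :=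
        memLp_indicator_const 2 Metric.isClosed_closedBall.measurableSet M
          (Or.inr (isCompact_closedBall (0 : E3) R).measure_lt_top.ne)
      exact (Lp.memLp f).norm.integrable_mul this)
    (.of_forall fun x θ _ => by
      have h1 := ((hh.differentiable (by simp) (rot θ x)).hasFDerivAt).comp_hasDerivAt θ
        (hasDerivAt_rot θ x)
      exact (h1.ofReal_comp).const_mul (f x))
  have hconst : (fun θ => ∫ x, f x * (h (rot θ x) : ℂ)) = fun _ => ∫ x, f x * (h x : ℂ) := by
    ext θ
    rw [← integral_comp_rot θ fun x => f x * (h x : ℂ)]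
    refine integral_congr_ae ?_
    filter_upwards [hf θ] with x hx
    rw [hx]
  have h0 := key.2
  rw [hconst] at h0
  have := h0.unique (hasDerivAt_const _ _)
  rw [← this]
  congr 1
  ext x
  have : rot 0 x = x := by ext i; fin_cases i <;> simp [rot]
  rw [this]

/-! ### The rotation fields about horizontal axes -/

/-- The field `x₃ ∂_j - x_j ∂₃`. -/
def tiltGen (j : Fin 3) : E3 →L[ℝ] E3 :=
  (EuclideanSpace.proj 2 : E3 →L[ℝ] ℝ).smulRight (ebasis j) -
    (EuclideanSpace.proj j : E3 →L[ℝ] ℝ).smulRight (ebasis 2)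

theorem tiltGen_apply (j : Fin 3) (x : E3) :
    tiltGen j x = x 2 • ebasis j - x j • ebasis 2 := rfl

theorem divergence_tiltGen (j : Fin 3) (x : E3) : divergence (tiltGen j) x = 0 := by
  rw [divergence_linear]
  fin_cases j <;> simp [Fin.sum_univ_three, tiltGen_apply, ebasis]

theorem divergence_rotGen (x : E3) :
    divergence rotGen x = 0 := by
  rw [divergence_linear]
  simp [Fin.sum_univ_three, rotGen_apply, ebasis]

theorem contDiffOn_coord_div (i : Fin 3) {n : WithTop ℕ∞} :
    ContDiffOn ℝ n (fun x : E3 => x i / axisDist x) offAxis :=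
  (contDiff_coord i).contDiffOn.div contDiffOn_axisDist fun _ hx => (mem_offAxis_iff.1 hx).ne'

/-- Off the axis, (x_j/|x_h|) ∂_φ equals the linear field x₃∂_j - x_j∂₃ plus a multiple of the
generator of rotations about the axis. The latter integrates to zero against an axisymmetric f, so
the singular field is traded for a linear one that the Fourier transform can handle. -/
theorem polar_test_offAxis {f u : L2} (hf : IsAxisymmetric f) (hu : IsUpsilon f u) {j : Fin 3}
    (hj : j ≠ 2) {ψ : E3 → ℝ} (hψ : ContDiff ℝ ∞ ψ) (hc : HasCompactSupport ψ)
    (hs : tsupport ψ ⊆ offAxis) :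
    ∫ x, u x * ((ψ x * (x j / axisDist x) : ℝ) : ℂ) =
      -∫ x, f x * ((fderiv ℝ ψ x (tiltGen j x) : ℝ) : ℂ) := by
  -- The coefficient of `rotGen` in that decomposition: ψ x₂x₃/|x_h|² for the first horizontal
  -- coordinate, -ψ x₁x₃/|x_h|² for the second.
  let h : E3 → ℝ := fun x => if j = 0 then ψ x * ((x 1 / axisDist x) * (x 2 / axisDist x)) else
    -(ψ x * ((x 0 / axisDist x) * (x 2 / axisDist x)))
  have hsm : ∀ i k : Fin 3, ContDiff ℝ ∞ fun x => ψ x * ((x i / axisDist x) * (x k / axisDist x)) :=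
    fun i k => contDiff_of_tsupport_subset isOpen_offAxis (hψ.contDiffOn.mul
      ((contDiffOn_coord_div i).mul (contDiffOn_coord_div k)))
      ((tsupport_mul_subset_left).trans hs)
  have hh : ContDiff ℝ ∞ h := by
    unfold h
    split_ifs
    · exact hsm 1 2
    · exact (hsm 0 2).neg
  have hhc : HasCompactSupport h := by
    refine HasCompactSupport.intro hc.isCompact fun x hx => ?_
    simp [h, image_eq_zero_of_notMem_tsupport hx]
  have hψ' : ContDiff ℝ ∞ fun x => ψ x * (x j / axisDist x) :=
    contDiff_of_tsupport_subset isOpen_offAxis (hψ.contDiffOn.mul (contDiffOn_coord_div j))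
      ((tsupport_mul_subset_left).trans hs)
  rw [hu _ hψ' hc.mul_right ((tsupport_mul_subset_left).trans hs)]
  have hid : (fun y => (ψ y * (y j / axisDist y)) • polarField y) =
      fun y => ψ y • tiltGen j y + h y • rotGen y := by
    ext1 y
    by_cases hy : y ∈ offAxis
    · have h0 := mem_offAxis_iff.1 hy
      have h1 := axisDist_sq y
      have hp : polarField y = !₂[y 2 * y 0 / axisDist y, y 2 * y 1 / axisDist y, -axisDist y] := rfl
      have hj' : j = 0 ∨ j = 1 := by fin_cases j <;> simp_all
      have h2 : y 0 ^ 2 = axisDist y ^ 2 - y 1 ^ 2 := by linarith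
      rw [hp, rotGen_apply, tiltGen_apply]
      rcases hj' with rfl | rfl
      · ext i
        fin_cases i <;> simp [h, ebasis] <;> field_simp
        · linear_combination (ψ y * y 2) * h2
      · ext i
        fin_cases i <;> simp [h, ebasis] <;> field_simp
        linear_combination (ψ y * y 2) * h2
    · have : ψ y = 0 := image_eq_zero_of_notMem_tsupport fun h => hy (hs h)
      simp [h, this]
  have hdiv : ∀ x, divergence (fun y => (ψ y * (y j / axisDist y)) • polarField y) x =
      fderiv ℝ ψ x (tiltGen j x) + fderiv ℝ h x (rotGen x) := by
    intro x
    have d1 := hψ.differentiable (by simp) x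
    have d2 := hh.differentiable (by simp) x
    have d3 := (tiltGen j).differentiableAt (x := x)
    have d4 := rotGen.differentiableAt (x := x)
    rw [hid, divergence_add (d1.fun_smul d3) (d2.fun_smul d4), divergence_smul d1 d3,
      divergence_smul d2 d4, divergence_tiltGen, divergence_rotGen]
    ring
  simp_rw [hdiv]
  have hi : ∀ {θ : E3 → ℝ} (A : E3 →L[ℝ] E3), ContDiff ℝ ∞ θ → HasCompactSupport θ →
      Integrable fun x => f x * ((fderiv ℝ θ x (A x) : ℝ) : ℂ) := by
    intro θ A hθ hθc
    have h2 := hθ.continuous_fderiv (by simp)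
    refine integrable_L2_mul f (by fun_prop) ?_
    refine HasCompactSupport.intro hθc.isCompact fun x hx => ?_
    have : fderiv ℝ θ x = 0 := by
      by_contra h'
      exact hx (support_fderiv_subset ℝ h')
    simp [this]
  have hz := integral_rotGen_eq_zero hf hh hhc
  congr 1
  push_cast
  simp_rw [mul_add]
  rw [integral_add (hi _ hψ hc) (hi _ hh hhc), hz, add_zero]

/-- Multiplication of an `L²` function by the bounded function `x_j / |x_h|`. -/
theorem measurable_coord_div (j : Fin 3) : Measurable fun x : E3 => x j / axisDist x :=
  (contDiff_coord (n := 0) j).continuous.measurable.div continuous_axisDist.measurable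

theorem abs_coord_div_le {j : Fin 3} (hj : j ≠ 2) (x : E3) : |x j / axisDist x| ≤ 1 := by
  rw [abs_div, abs_of_nonneg (axisDist_nonneg x)]
  refine div_le_one_of_le₀ (abs_le_of_sq_le_sq ?_ (axisDist_nonneg x)) (axisDist_nonneg x)
  rw [axisDist_sq]
  have : j = 0 ∨ j = 1 := by fin_cases j <;> simp_all
  rcases this with rfl | rfl <;> nlinarith [sq_nonneg (x 0), sq_nonneg (x 1)]

theorem norm_axisMul_le {j : Fin 3} (hj : j ≠ 2) (u : E3 → ℂ) (x : E3) :
    ‖((x j / axisDist x : ℝ) : ℂ) * u x‖ ≤ ‖u x‖ := by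
  rw [norm_mul, Complex.norm_real]
  exact mul_le_of_le_one_left (norm_nonneg _) (abs_coord_div_le hj x)

theorem memLp_axisMul {j : Fin 3} (hj : j ≠ 2) (u : L2) :
    MemLp (fun x => ((x j / axisDist x : ℝ) : ℂ) * u x) 2 (volume : Measure E3) :=
  (Lp.memLp u).of_le
    ((Complex.measurable_ofReal.comp (measurable_coord_div j)).aestronglyMeasurable.mul
      (Lp.aestronglyMeasurable u)) (.of_forall fun x => norm_axisMul_le hj u x)

/-- The product of `x_j / |x_h|` and `u`. -/
def axisMul {j : Fin 3} (hj : j ≠ 2) (u : L2) : L2 := (memLp_axisMul hj u).toLp _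

theorem coeFn_axisMul {j : Fin 3} (hj : j ≠ 2) (u : L2) :
    axisMul hj u =ᵐ[volume] fun x => ((x j / axisDist x : ℝ) : ℂ) * u x :=
  (memLp_axisMul hj u).coeFn_toLp

theorem norm_axisMul {j : Fin 3} (hj : j ≠ 2) (u : L2) : ‖axisMul hj u‖ ≤ ‖u‖ := by
  refine Lp.norm_le_norm_of_ae_le ?_
  filter_upwards [coeFn_axisMul hj u] with x hx
  rw [hx]
  exact norm_axisMul_le hj u x

/-! ### Removing the axis -/

theorem smoothTransition_deriv_bound : ∃ C : ℝ, 0 ≤ C ∧ ∀ y, |deriv Real.smoothTransition y| ≤ C := by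
  have h1 : Continuous (deriv Real.smoothTransition) :=
    (Real.smoothTransition.contDiff (n := 1)).continuous_deriv le_rfl
  have h2 : HasCompactSupport (deriv Real.smoothTransition) := by
    refine HasCompactSupport.intro (isCompact_Icc (a := (0 : ℝ)) (b := 1)) fun y hy => ?_
    rw [mem_Icc, not_and_or, not_le, not_le] at hy
    rcases hy with hy | hy
    · have : Real.smoothTransition =ᶠ[𝓝 y] fun _ => 0 := by
        filter_upwards [gt_mem_nhds hy] with z hz
        exact Real.smoothTransition.zero_of_nonpos hz.le
      rw [this.deriv_eq, deriv_const]
    · have : Real.smoothTransition =ᶠ[𝓝 y] fun _ => 1 := by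
        filter_upwards [lt_mem_nhds hy] with z hz
        exact Real.smoothTransition.one_of_one_le hz.le
      rw [this.deriv_eq, deriv_const]
  obtain ⟨C, hC⟩ := h1.bounded_above_of_compact_support h2
  exact ⟨C, (norm_nonneg _).trans (hC 0), hC⟩

/-- A cutoff vanishing for `|x_h| ≤ ε` and equal to one for `|x_h|² ≥ 2 ε²`. -/
def axisCutoff (ε : ℝ) (x : E3) : ℝ :=
  Real.smoothTransition (((x 0) ^ 2 + (x 1) ^ 2) / ε ^ 2 - 1)

theorem contDiff_axisCutoff (ε : ℝ) : ContDiff ℝ ∞ (axisCutoff ε) := by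
  have : ContDiff ℝ ∞ fun x : E3 => ((x 0) ^ 2 + (x 1) ^ 2) / ε ^ 2 - 1 := by fun_prop
  exact Real.smoothTransition.contDiff.comp this

theorem fderiv_axisCutoff {ε : ℝ} {j : Fin 3} (hj : j ≠ 2) (x : E3) :
    fderiv ℝ (axisCutoff ε) x (tiltGen j x) =
      deriv Real.smoothTransition (((x 0) ^ 2 + (x 1) ^ 2) / ε ^ 2 - 1) *
        (2 * x j * x 2 / ε ^ 2) := by
  have h1 : HasDerivAt Real.smoothTransition
      (deriv Real.smoothTransition (((x 0) ^ 2 + (x 1) ^ 2) / ε ^ 2 - 1))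
      (((x 0) ^ 2 + (x 1) ^ 2) / ε ^ 2 - 1) :=
    ((Real.smoothTransition.contDiff (n := 1)).differentiable one_ne_zero _).hasDerivAt
  have h2 := ((((hasFDerivAt_coord 0 x).pow 2).fun_add ((hasFDerivAt_coord 1 x).pow 2)).mul_const
    ((ε ^ 2)⁻¹)).sub_const 1
  have h3 : fderiv ℝ (axisCutoff ε) x = _ := (h1.comp_hasFDerivAt x h2).fderiv
  rw [h3]
  have : j = 0 ∨ j = 1 := by fin_cases j <;> simp_all
  rw [_root_.smul_apply, smul_eq_mul]
  congr 1
  rcases this with rfl | rfl <;> simp [tiltGen_apply, ebasis] <;> ring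

theorem tsupport_mul_axisCutoff {ψ : E3 → ℝ} {ε : ℝ} (hε : 0 < ε) :
    tsupport (fun x => axisCutoff ε x * ψ x) ⊆ offAxis := by
  have h1 : tsupport (fun x => axisCutoff ε x * ψ x) ⊆ {x | ε ^ 2 ≤ (x 0) ^ 2 + (x 1) ^ 2} := by
    refine closure_minimal (fun x hx => ?_) (isClosed_le (by fun_prop) (by fun_prop))
    by_contra h
    rw [mem_ofPred_eq, not_le] at h
    refine hx ?_
    have : axisCutoff ε x = 0 := Real.smoothTransition.zero_of_nonpos (by
      rw [sub_nonpos, div_le_one (by positivity)]; exact h.le)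
    simp [this]
  intro x hx
  rw [mem_offAxis_iff, axisDist, Real.sqrt_pos]
  exact lt_of_lt_of_le (by positivity) (h1 hx)

theorem norm_integral_mul_le {f : L2} {φ : E3 → ℂ} {S : Set E3} (hS : MeasurableSet S) {K : ℝ}
    (hφ : ∀ x, ‖φ x‖ ≤ S.indicator (fun _ => K) x) :
    ‖∫ x, f x * φ x‖ₑ ^ 2 ≤ ENNReal.ofReal K ^ 2 * (volume S * ∫⁻ x in S, ‖f x‖ₑ ^ 2) := by
  calc ‖∫ x, f x * φ x‖ₑ ^ 2 ≤ (ENNReal.ofReal K * ∫⁻ x in S, ‖f x‖ₑ) ^ 2 := by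
        gcongr
        refine (enorm_integral_le_lintegral_enorm _).trans ?_
        rw [← lintegral_const_mul' _ _ ENNReal.ofReal_ne_top, ← lintegral_indicator hS]
        refine lintegral_mono fun x => ?_
        have := hφ x
        by_cases hx : x ∈ S
        · rw [indicator_of_mem hx] at this ⊢
          rw [enorm_mul, mul_comm, ← ofReal_norm (φ x)]
          gcongr
        · rw [indicator_of_notMem hx] at this ⊢
          rw [norm_le_zero_iff.1 this]
          simp
    _ ≤ _ := by
        rw [mul_pow]
        gcongr
        have := sq_lintegral_le (volume.restrict S) (f := fun x => ‖f x‖ₑ)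
          (Lp.aestronglyMeasurable f).enorm.restrict
        rwa [Measure.restrict_apply_univ] at this

/-- The axis is removable because it has codimension two: a cutoff at distance ε costs a derivative
of size 1/ε on a set of volume ~ ε². By Cauchy-Schwarz the error is at most a constant times the L²
norm of f on shrinking boxes, hence tends to zero. -/
theorem IsUpsilon.weakLin {f u : L2} (hf : IsAxisymmetric f) (hu : IsUpsilon f u) {j : Fin 3}
    (hj : j ≠ 2) : WeakLin (tiltGen j) 0 f (axisMul hj u) := by
  refine WeakLin.of_real fun ψ hψ hc => ?_
  obtain ⟨C, hC0, hC⟩ := smoothTransition_deriv_bound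
  have hψc := hψ.continuous
  have hdψc := hψ.continuous_fderiv (by simp)
  obtain ⟨M, hM⟩ := hψc.bounded_above_of_compact_support hc
  have hM0 : 0 ≤ M := (norm_nonneg _).trans (hM 0)
  obtain ⟨R, hR⟩ := hc.isCompact.isBounded.subset_closedBall (0 : E3)
  let R' := max R 0
  have hR' : 0 ≤ R' := le_max_right _ _
  let ε : ℕ → ℝ := fun n => 1 / (n + 1 : ℝ)
  have hε : ∀ n, 0 < ε n := fun n => by positivity
  have hεlim : Tendsto ε atTop (𝓝 0) := tendsto_one_div_add_atTop_nhds_zero_nat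
  let η : ℕ → E3 → ℝ := fun n => axisCutoff (ε n)
  have hη : ∀ n, ContDiff ℝ ∞ (η n) := fun n => contDiff_axisCutoff _
  have hη1 : ∀ n x, |η n x| ≤ 1 := fun n x => by
    simp only [η, axisCutoff]
    rw [abs_of_nonneg (Real.smoothTransition.nonneg _)]
    exact Real.smoothTransition.le_one _
  have hev : ∀ x ∈ offAxis, ∀ᶠ n in atTop, η n x = 1 := by
    intro x hx
    have h0 : 0 < (x 0) ^ 2 + (x 1) ^ 2 := Real.sqrt_pos.1 (mem_offAxis_iff.1 hx)
    have : ∀ᶠ n in atTop, 2 * ε n ^ 2 < (x 0) ^ 2 + (x 1) ^ 2 := by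
      have h1 : Tendsto (fun n => 2 * ε n ^ 2) atTop (𝓝 (2 * 0 ^ 2)) := (hεlim.pow 2).const_mul 2
      exact h1.eventually_lt_const (by simpa using h0)
    filter_upwards [this] with n hn
    refine Real.smoothTransition.one_of_one_le ?_
    have := hε n
    rw [le_sub_iff_add_le, le_div_iff₀ (by positivity)]
    linarith
  have hoff : ∀ᵐ x : E3, x ∈ offAxis := by
    have hb : (offAxisᶜ : Set E3) ⊆ ⋃ m : ℕ, box 0 0 m := by
      intro x hx
      simp only [offAxis, mem_compl_iff, mem_ofPred_eq, not_or, not_not] at hx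
      obtain ⟨m, hm⟩ := exists_nat_ge |x 2|
      exact mem_iUnion.2 ⟨m, by simp [box, hx.1, hx.2, hm]⟩
    refine measure_mono_null hb (measure_iUnion_null fun m => ?_)
    rw [volume_box le_rfl le_rfl]
    simp
  let w : E3 → ℂ := fun x => ((fderiv ℝ ψ x (tiltGen j x) : ℝ) : ℂ)
  let δ : ℕ → E3 → ℂ := fun n x => ((ψ x * fderiv ℝ (η n) x (tiltGen j x) : ℝ) : ℂ)
  have hwc : Continuous w := by fun_prop
  have hfd : ∀ {θ : E3 → ℝ} {x}, x ∉ tsupport ψ → ψ x = 0 ∧ fderiv ℝ ψ x = 0 := by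
    intro θ x hx
    refine ⟨image_eq_zero_of_notMem_tsupport hx, ?_⟩
    by_contra h'
    exact hx (support_fderiv_subset ℝ h')
  have hws : HasCompactSupport w :=
    HasCompactSupport.intro hc.isCompact fun x hx => by simp [w, (hfd (θ := ψ) hx).2]
  have hδc : ∀ n, Continuous (δ n) := fun n => by
    have := (hη n).continuous_fderiv (by simp)
    fun_prop
  have hδs : ∀ n, HasCompactSupport (δ n) := fun n =>
    HasCompactSupport.intro hc.isCompact fun x hx => by simp [δ, (hfd (θ := ψ) hx).1]
  have hδb : ∀ n x, ‖δ n x‖ ≤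
      (box (2 * ε n) (2 * ε n) R').indicator (fun _ => M * C * 4 * R' / ε n) x := by
    intro n x
    have hεn := hε n
    by_cases hx : x ∈ box (2 * ε n) (2 * ε n) R'
    · rw [indicator_of_mem hx]
      have hxj : |x j| ≤ 2 * ε n := by
        have : j = 0 ∨ j = 1 := by fin_cases j <;> simp_all
        rcases this with rfl | rfl
        exacts [hx.1, hx.2.1]
      simp only [δ, η]
      rw [fderiv_axisCutoff hj, Complex.norm_real, norm_mul, norm_mul, Real.norm_eq_abs (2 * _ * _ / _),
        abs_div, abs_mul, abs_mul, abs_two, abs_of_nonneg (sq_nonneg (ε n))]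
      calc _ ≤ M * (C * (2 * (2 * ε n) * R' / ε n ^ 2)) := by
            gcongr
            exacts [hM x, hC _, hx.2.2]
        _ = _ := by field_simp; ring
    · rw [indicator_of_notMem hx]
      refine le_of_eq (norm_eq_zero.2 ?_)
      simp only [δ, η]
      by_cases hxs : x ∈ tsupport ψ
      · rw [fderiv_axisCutoff hj]
        have hx2 : |x 2| ≤ R' := (abs_coord_le x 2).trans
          ((mem_closedBall_zero_iff.1 (hR hxs)).trans (le_max_left _ _))
        have hbig : 4 * ε n ^ 2 ≤ (x 0) ^ 2 + (x 1) ^ 2 := by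
          by_contra hlt
          rw [not_le] at hlt
          refine hx ⟨abs_le_of_sq_le_sq ?_ (by positivity), abs_le_of_sq_le_sq ?_ (by positivity), hx2⟩
          · nlinarith [sq_nonneg (x 1)]
          · nlinarith [sq_nonneg (x 0)]
        have : Real.smoothTransition =ᶠ[𝓝 (((x 0) ^ 2 + (x 1) ^ 2) / ε n ^ 2 - 1)] fun _ => 1 := by
          have h1 : 1 < ((x 0) ^ 2 + (x 1) ^ 2) / ε n ^ 2 - 1 := by
            rw [lt_sub_iff_add_lt, lt_div_iff₀ (by positivity)]
            nlinarith [sq_pos_of_pos hεn]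
          filter_upwards [lt_mem_nhds h1] with z hz
          exact Real.smoothTransition.one_of_one_le hz.le
        rw [this.deriv_eq]
        simp
      · simp [(hfd (θ := ψ) hxs).1]
  have hcut : ∀ n, ∫ x, axisMul hj u x * ((η n x * ψ x : ℝ) : ℂ) =
      -((∫ x, f x * (η n x * w x)) + ∫ x, f x * δ n x) := by
    intro n
    have hs := tsupport_mul_axisCutoff (ψ := ψ) (hε n)
    have h1 := polar_test_offAxis hf hu hj (ψ := fun x => η n x * ψ x) ((hη n).mul hψ)
      (hc.mul_left) hs
    have e1 : ∫ x, axisMul hj u x * ((η n x * ψ x : ℝ) : ℂ) =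
        ∫ x, u x * (((η n x * ψ x) * (x j / axisDist x) : ℝ) : ℂ) := by
      refine integral_congr_ae ?_
      filter_upwards [coeFn_axisMul hj u] with x hx
      rw [hx]
      push_cast
      ring
    have hηc := (hη n).continuous
    rw [e1, h1, ← integral_add (integrable_L2_mul f (φ := fun x => η n x * w x) (by fun_prop)
      (HasCompactSupport.mul_left (f := fun x => (η n x : ℂ)) hws))
      (integrable_L2_mul f (hδc n) (hδs n))]
    congr 2
    ext x
    have d := (((hη n).differentiable (by simp) x).hasFDerivAt.fun_mul
      (hψ.differentiable (by simp) x).hasFDerivAt).fderiv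
    rw [d]
    simp only [w, δ, _root_.add_apply, _root_.smul_apply, smul_eq_mul]
    push_cast
    ring
  have hL : Tendsto (fun n => ∫ x, axisMul hj u x * ((η n x * ψ x : ℝ) : ℂ)) atTop
      (𝓝 (∫ x, axisMul hj u x * (ψ x : ℂ))) := by
    have hcs : HasCompactSupport fun x => (ψ x : ℂ) :=
      hc.comp_left (g := fun r : ℝ => (r : ℂ)) Complex.ofReal_zero
    have hi := integrable_L2_mul (axisMul hj u) (φ := fun x => (ψ x : ℂ)) (by fun_prop) hcs
    refine tendsto_integral_of_dominated_convergence (fun x => ‖axisMul hj u x * (ψ x : ℂ)‖) ?_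
      hi.norm ?_ ?_
    · intro n
      have hηc := (hη n).continuous
      exact (Lp.aestronglyMeasurable _).mul
        (by fun_prop : Continuous fun x => ((η n x * ψ x : ℝ) : ℂ)).aestronglyMeasurable
    · refine fun n => .of_forall fun x => ?_
      rw [norm_mul, norm_mul, Complex.norm_real, Complex.norm_real, norm_mul]
      gcongr
      exact mul_le_of_le_one_left (norm_nonneg _) (hη1 n x)
    · filter_upwards [hoff] with x hx
      apply tendsto_const_nhds.congr'
      filter_upwards [hev x hx] with n hn
      rw [hn, one_mul]
  have hR1 : Tendsto (fun n => ∫ x, f x * (η n x * w x)) atTop (𝓝 (∫ x, f x * w x)) := by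
    refine tendsto_integral_of_dominated_convergence (fun x => ‖f x * w x‖) ?_
      (integrable_L2_mul f hwc hws).norm ?_ ?_
    · intro n
      have hηc := (hη n).continuous
      exact (Lp.aestronglyMeasurable _).mul
        (by fun_prop : Continuous fun x => (η n x : ℂ) * w x).aestronglyMeasurable
    · refine fun n => .of_forall fun x => ?_
      rw [norm_mul, norm_mul, norm_mul, Complex.norm_real]
      gcongr
      exact mul_le_of_le_one_left (norm_nonneg _) (hη1 n x)
    · filter_upwards [hoff] with x hx
      apply tendsto_const_nhds.congr'
      filter_upwards [hev x hx] with n hn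
      rw [hn, Complex.ofReal_one, one_mul]
  have hR2 : Tendsto (fun n => ∫ x, f x * δ n x) atTop (𝓝 0) := by
    let B : ℕ → Set E3 := fun n => box (2 * ε n) (2 * ε n) R'
    have hvol : ∀ n, volume (B n) = ENNReal.ofReal (8 * (2 * ε n * (2 * ε n) * R')) := fun n =>
      volume_box (by have := hε n; positivity) (by have := hε n; positivity)
    have hfin : ∫⁻ x, ‖f x‖ₑ ^ 2 ≠ ⊤ := by
      rw [lintegral_enorm_sq_L2]
      exact ENNReal.pow_ne_top enorm_ne_top
    have hvl : Tendsto (volume ∘ B) atTop (𝓝 0) := by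
      have : Tendsto (fun n => ENNReal.ofReal (8 * (2 * ε n * (2 * ε n) * R'))) atTop
          (𝓝 (ENNReal.ofReal (8 * (2 * 0 * (2 * 0) * R')))) :=
        ENNReal.tendsto_ofReal ((((hεlim.const_mul 2).mul (hεlim.const_mul 2)).mul_const R').const_mul 8)
      simp only [mul_zero, zero_mul, ENNReal.ofReal_zero] at this
      exact this.congr fun n => (hvol n).symm
    have h0 := tendsto_setLIntegral_zero hfin hvl
    -- Squared derivative bound times volume of the box: the powers of ε cancel, so K is independent
    -- of n and the remaining integral tends to zero.
    let K : ℝ≥0∞ := ENNReal.ofReal ((M * C * 4 * R') ^ 2 * 32 * R')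
    have hb : ∀ n, ‖∫ x, f x * δ n x‖ₑ ^ 2 ≤ K * ∫⁻ x in B n, ‖f x‖ₑ ^ 2 := by
      intro n
      have hεn := hε n
      refine (norm_integral_mul_le (measurableSet_box _ _ _) (hδb n)).trans (le_of_eq ?_)
      change _ * (volume (B n) * _) = _
      rw [hvol, ← mul_assoc, ← ENNReal.ofReal_pow (by positivity), ← ENNReal.ofReal_mul (by positivity)]
      congr 2
      field_simp
      ring
    have h1 : Tendsto (fun n => K * ∫⁻ x in B n, ‖f x‖ₑ ^ 2) atTop (𝓝 0) := by
      have := ENNReal.Tendsto.const_mul (a := K) h0 (Or.inr ENNReal.ofReal_ne_top)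
      rwa [mul_zero] at this
    have h2 : Tendsto (fun n => ‖∫ x, f x * δ n x‖ₑ ^ 2) atTop (𝓝 0) :=
      tendsto_of_tendsto_of_tendsto_of_le_of_le tendsto_const_nhds h1 (fun _ => zero_le) hb
    have h3 : Tendsto (fun n => (‖∫ x, f x * δ n x‖ₑ ^ 2) ^ (1 / 2 : ℝ)) atTop (𝓝 (0 ^ (1 / 2 : ℝ))) :=
      h2.ennrpow_const _
    rw [ENNReal.zero_rpow_of_pos (by norm_num)] at h3
    refine tendsto_iff_enorm_sub_tendsto_zero.2 (h3.congr fun n => ?_)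
    rw [sub_zero, ← ENNReal.rpow_natCast, ← ENNReal.rpow_mul]
    simp
  have := tendsto_nhds_unique (hL.congr hcut) (hR1.add hR2).neg
  rw [this, add_zero]
  simp [w]

/-! ### Scaling and polar derivatives of the Fourier transform. -/

/-- In frequency space, `h₁` is the transform of `S` applied to the inverse transform of `h`. -/
def WeakScale (h h₁ : E3 → ℂ) : Prop :=
  ∀ B : E3 → ℂ, ContDiff ℝ ∞ B → HasCompactSupport B →
    ∫ ξ, h₁ ξ * B ξ = ∫ ξ, h ξ * fderiv ℝ B ξ ξ

/-- `w` is the weak derivative of `h` along `∂_φ` away from the axis. -/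
def WeakPolar (h w : E3 → ℂ) : Prop :=
  ∀ B : E3 → ℂ, ContDiff ℝ ∞ B → HasCompactSupport B → tsupport B ⊆ offAxis →
    ∫ ξ, w ξ * B ξ = -∫ ξ, h ξ * (fderiv ℝ B ξ (polarField ξ) + ((ξ 2 / axisDist ξ : ℝ) : ℂ) * B ξ)

theorem IsS.weakScale_fourier {f g : L2} (h : IsS f g) : WeakScale (𝓕 f : L2) (𝓕 g : L2) := by
  intro B hB hc
  exact h.weakLin.fourier (B := ContinuousLinearMap.id ℝ E3) (fun _ _ => rfl)
    (by simp [ebasis]) (hc.toSchwartzMap hB)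

/-- The field x₃∂_j - x_j∂₃ is antisymmetric and divergence free, so its transpose is its negative
and it keeps its form in frequency. -/
theorem tilt_fourier {f u : L2} (hf : IsAxisymmetric f) (hu : IsUpsilon f u) {j : Fin 3}
    (hj : j ≠ 2) {B : E3 → ℂ} (hB : ContDiff ℝ ∞ B) (hc : HasCompactSupport B) :
    ∫ ξ, (𝓕 (axisMul hj u) : L2) ξ * B ξ = -∫ ξ, (𝓕 f : L2) ξ * fderiv ℝ B ξ (tiltGen j ξ) := by
  have h := (hu.weakLin hf hj).fourier (B := -tiltGen j) (fun x y => by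
      have : j = 0 ∨ j = 1 := by fin_cases j <;> simp_all
      rcases this with rfl | rfl <;>
        simp [tiltGen_apply, EuclideanSpace.inner_eq_star_dotProduct, dotProduct,
          Fin.sum_univ_three, ebasis] <;> ring)
    (by
      have : j = 0 ∨ j = 1 := by fin_cases j <;> simp_all
      rcases this with rfl | rfl <;> simp [Fin.sum_univ_three, ebasis, tiltGen_apply, EuclideanSpace.inner_single_left])
    (hc.toSchwartzMap hB)
  have e : ∀ ξ, (hc.toSchwartzMap hB) ξ = B ξ := fun _ => rfl
  simp only [e] at h
  rw [h, ← integral_neg]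
  congr 1
  ext ξ
  have e2 : fderiv ℝ (hc.toSchwartzMap hB) ξ = fderiv ℝ B ξ := rfl
  rw [e2]
  simp

theorem fderiv_coord_div {x : E3} (hx : x ∈ offAxis) (i : Fin 3) (v : E3) :
    fderiv ℝ (fun x : E3 => x i / axisDist x) x v =
      v i / axisDist x - x i * (x 0 * v 0 + x 1 * v 1) / axisDist x ^ 3 := by
  have h0 := (mem_offAxis_iff.1 hx).ne'
  have h1 := (hasDerivAt_inv h0).comp_hasFDerivAt x (hasFDerivAt_axisDist hx)
  have h2 : fderiv ℝ (fun x : E3 => x i / axisDist x) x = _ :=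
    ((hasFDerivAt_coord i x).mul h1).fderiv
  rw [h2]
  simp
  field_simp
  ring

/-- In frequency, ∂_φ is the sum over j = 0, 1 of (ξ_j/|ξ_h|) times the j-th tilt field, each of
which acts on f̂ in L². The two multipliers x_j/|x_h| in space and ξ_j/|ξ_h| in frequency are
bounded by one; the two summands give the factor 2. -/
theorem IsUpsilon.weakPolar_fourier {f u : L2} (hf : IsAxisymmetric f) (hu : IsUpsilon f u) :
    ∃ w : L2, ‖w‖ ≤ 2 * ‖u‖ ∧ WeakPolar (𝓕 f : L2) w := by
  have h0 : (0 : Fin 3) ≠ 2 := by decide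
  have h1 : (1 : Fin 3) ≠ 2 := by decide
  refine ⟨axisMul h0 (𝓕 (axisMul h0 u)) + axisMul h1 (𝓕 (axisMul h1 u)), ?_, ?_⟩
  · refine (norm_add_le _ _).trans ?_
    have a := (norm_axisMul h0 (𝓕 (axisMul h0 u)))
    have b := (norm_axisMul h1 (𝓕 (axisMul h1 u)))
    rw [Lp.norm_fourier_eq] at a b
    linarith [norm_axisMul h0 u, norm_axisMul h1 u]
  · intro B hB hc hs
    let b : Fin 3 → E3 → ℂ := fun j ξ => ((ξ j / axisDist ξ : ℝ) : ℂ) * B ξ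
    have hb : ∀ j, ContDiff ℝ ∞ (b j) := fun j =>
      contDiff_of_tsupport_subset isOpen_offAxis
        ((Complex.ofRealCLM.contDiff.comp_contDiffOn (contDiffOn_coord_div j)).mul hB.contDiffOn)
        (tsupport_mul_subset_right.trans hs)
    have hbc : ∀ j, HasCompactSupport (b j) := fun j => hc.mul_left
    have e0 := tilt_fourier hf hu h0 (hb 0) (hbc 0)
    have e1 := tilt_fourier hf hu h1 (hb 1) (hbc 1)
    have hd : ∀ (A : E3 →L[ℝ] E3) (j), Integrable
        (fun ξ => (𝓕 f : L2) ξ * fderiv ℝ (b j) ξ (A ξ)) := fun A j => by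
      have := (hb j).continuous_fderiv (by simp)
      exact integrable_L2_mul _ (by fun_prop) (hasCompactSupport_fderiv_apply (hbc j) _)
    have hl : ∫ ξ, (axisMul h0 (𝓕 (axisMul h0 u)) + axisMul h1 (𝓕 (axisMul h1 u)) : L2) ξ * B ξ =
        (∫ ξ, (𝓕 (axisMul h0 u) : L2) ξ * b 0 ξ) + ∫ ξ, (𝓕 (axisMul h1 u) : L2) ξ * b 1 ξ := by
      rw [← integral_add (integrable_L2_mul _ (hb 0).continuous (hbc 0))
        (integrable_L2_mul _ (hb 1).continuous (hbc 1))]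
      refine integral_congr_ae ?_
      filter_upwards [Lp.coeFn_add (axisMul h0 (𝓕 (axisMul h0 u))) (axisMul h1 (𝓕 (axisMul h1 u))),
        coeFn_axisMul h0 (𝓕 (axisMul h0 u)), coeFn_axisMul h1 (𝓕 (axisMul h1 u))] with ξ a1 a2 a3
      rw [a1, Pi.add_apply, a2, a3]
      simp only [b]
      ring
    rw [hl, e0, e1, ← neg_add, ← integral_add (hd _ 0) (hd _ 1)]
    congr 2
    ext ξ
    rw [← mul_add]
    congr 1
    by_cases hξ : ξ ∈ offAxis
    · have hr := mem_offAxis_iff.1 hξ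
      have hq := axisDist_sq ξ
      have db : ∀ j (v : E3), fderiv ℝ (b j) ξ v = ((ξ j / axisDist ξ : ℝ) : ℂ) * fderiv ℝ B ξ v +
          ((v j / axisDist ξ - ξ j * (ξ 0 * v 0 + ξ 1 * v 1) / axisDist ξ ^ 3 : ℝ) : ℂ) * B ξ := by
        intro j v
        have d1 : DifferentiableAt ℝ (fun x : E3 => x j / axisDist x) ξ :=
          ((contDiffOn_coord_div j (n := 1)).contDiffAt (isOpen_offAxis.mem_nhds hξ)).differentiableAt
            one_ne_zero
        have d2 : DifferentiableAt ℝ (fun x : E3 => ((x j / axisDist x : ℝ) : ℂ)) ξ :=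
          Complex.ofRealCLM.differentiableAt.comp ξ d1
        have := (d2.hasFDerivAt.fun_mul (hB.differentiable (by simp) ξ).hasFDerivAt).fderiv
        rw [this]
        simp only [_root_.add_apply, _root_.smul_apply, smul_eq_mul]
        rw [fderiv_ofReal_comp d1, fderiv_coord_div hξ]
        ring
      rw [db, db]
      have hp : polarField ξ = (ξ 0 / axisDist ξ) • tiltGen 0 ξ + (ξ 1 / axisDist ξ) • tiltGen 1 ξ := by
        have hp : polarField ξ =
          !₂[ξ 2 * ξ 0 / axisDist ξ, ξ 2 * ξ 1 / axisDist ξ, -axisDist ξ] := rfl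
        rw [hp, tiltGen_apply, tiltGen_apply]
        ext i
        fin_cases i <;> simp [ebasis] <;> field_simp
        linarith
      rw [hp, map_add, map_smul, map_smul, Complex.real_smul, Complex.real_smul]
      -- The derivatives falling on the coefficients ξ_j/|ξ_h| add up to ξ₃/|ξ_h|, the divergence of
      -- the polar field.
      have hc2 : ((tiltGen 0 ξ) 0 / axisDist ξ - ξ 0 * (ξ 0 * (tiltGen 0 ξ) 0 + ξ 1 * (tiltGen 0 ξ) 1)
          / axisDist ξ ^ 3) + ((tiltGen 1 ξ) 1 / axisDist ξ - ξ 1 * (ξ 0 * (tiltGen 1 ξ) 0 +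
          ξ 1 * (tiltGen 1 ξ) 1) / axisDist ξ ^ 3) = ξ 2 / axisDist ξ := by
        simp [tiltGen_apply, ebasis]
        field_simp
        linear_combination (ξ 2) * hq
      rw [← hc2]
      push_cast
      ring
    · have h1 : ξ ∉ tsupport B := fun h => hξ (hs h)
      have h2 : ∀ {φ : E3 → ℂ}, tsupport φ ⊆ tsupport B → fderiv ℝ φ ξ = 0 := by
        intro φ hφ
        by_contra h'
        exact h1 (hφ (support_fderiv_subset ℝ h'))
      rw [h2 (φ := b 0) tsupport_mul_subset_right, h2 (φ := b 1) tsupport_mul_subset_right,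
        h2 subset_rfl, image_eq_zero_of_notMem_tsupport h1]
      simp

/-! ### Spherical coordinates -/

/-- Spherical coordinates `((ρ, φ), θ)`. -/
def sph (q : (ℝ × ℝ) × ℝ) : E3 :=
  !₂[q.1.1 * Real.sin q.1.2 * Real.cos q.2, q.1.1 * Real.sin q.1.2 * Real.sin q.2,
    q.1.1 * Real.cos q.1.2]

theorem continuous_mk3 : Continuous fun p : ℝ × ℝ × ℝ => (!₂[p.1, p.2.1, p.2.2] : E3) := by
  refine (PiLp.continuous_toLp 2 _).comp (continuous_pi fun i => ?_)
  fin_cases i <;> simp <;> fun_prop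

theorem continuous_sph : Continuous sph := by
  have : sph = (fun p : ℝ × ℝ × ℝ => (!₂[p.1, p.2.1, p.2.2] : E3)) ∘ fun q : (ℝ × ℝ) × ℝ =>
    (q.1.1 * Real.sin q.1.2 * Real.cos q.2, q.1.1 * Real.sin q.1.2 * Real.sin q.2,
      q.1.1 * Real.cos q.1.2) := rfl
  rw [this]
  exact continuous_mk3.comp (by fun_prop)

/-- The meridian half plane. -/
def merid : Set (ℝ × ℝ) := Ioi 0 ×ˢ Ioo 0 Real.pi

theorem isOpen_merid : IsOpen merid := isOpen_Ioi.prod isOpen_Ioo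

/-- The domain of spherical coordinates. -/
def sphDom : Set ((ℝ × ℝ) × ℝ) := merid ×ˢ Ioo (-Real.pi) Real.pi

theorem measurableSet_sphDom : MeasurableSet sphDom :=
  isOpen_merid.measurableSet.prod measurableSet_Ioo

theorem lintegral_volume_prod {A B : Type*} [MeasureSpace A] [MeasureSpace B]
    [SFinite (volume : Measure B)] {f : A × B → ℝ≥0∞} (hf : Measurable f) :
    ∫⁻ z, f z = ∫⁻ x, ∫⁻ y, f (x, y) :=
  lintegral_prod f hf.aemeasurable

theorem setLIntegral_volume_prod {A B : Type*} [MeasureSpace A] [MeasureSpace B]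
    [SFinite (volume : Measure A)] [SFinite (volume : Measure B)] {f : A × B → ℝ≥0∞}
    (hf : Measurable f) (s : Set A) (t : Set B) :
    ∫⁻ z in s ×ˢ t, f z = ∫⁻ x in s, ∫⁻ y in t, f (x, y) :=
  setLIntegral_prod f hf.aemeasurable.restrict

theorem lintegral_E3_eq (F : E3 → ℝ≥0∞) (hF : Measurable F) :
    ∫⁻ ξ, F ξ = ∫⁻ z : ℝ, ∫⁻ p : ℝ × ℝ, F !₂[p.1, p.2, z] := by
  let e : (Fin 3 → ℝ) ≃ᵐ ℝ × (ℝ × ℝ) := (MeasurableEquiv.piFinSuccAbove (fun _ : Fin 3 => ℝ) 2).trans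
    ((MeasurableEquiv.refl ℝ).prodCongr MeasurableEquiv.finTwoArrow)
  have he : MeasurePreserving e :=
    (volume_preserving_piFinSuccAbove (fun _ : Fin 3 => ℝ) 2).trans
      ((MeasurePreserving.id volume).prod (volume_preserving_finTwoArrow ℝ))
  have h1 := (EuclideanSpace.volume_preserving_symm_measurableEquiv_toLp (Fin 3)).symm
  have h2 := h1.comp he.symm
  have h3 := h2.lintegral_comp hF
  refine h3.symm.trans ((lintegral_volume_prod (hF.comp h2.measurable)).trans ?_)
  refine lintegral_congr fun z => lintegral_congr fun p => congrArg F (?_ : WithLp.toLp 2 _ = _)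
  ext i
  fin_cases i <;> rfl

/-- Planar polar coordinates twice: (ξ₁, ξ₂) to (r, θ), then (ξ₃, r) to (ρ, φ). The Jacobians r and
ρ multiply to ρ² sin φ. -/
theorem lintegral_spherical (F : E3 → ℝ≥0∞) (hF : Measurable F) :
    ∫⁻ ξ, F ξ = ∫⁻ q in sphDom,
      ENNReal.ofReal (q.1.1 ^ 2 * Real.sin q.1.2) * F (sph q) := by
  let H : ℝ × ℝ → ℝ → ℝ≥0∞ := fun p θ => F !₂[p.2 * Real.cos θ, p.2 * Real.sin θ, p.1]
  have hH : Measurable (Function.uncurry H) := by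
    have : Function.uncurry H = F ∘ (fun p : ℝ × ℝ × ℝ => (!₂[p.1, p.2.1, p.2.2] : E3)) ∘
      fun q : (ℝ × ℝ) × ℝ => (q.1.2 * Real.cos q.2, q.1.2 * Real.sin q.2, q.1.1) := rfl
    rw [this]
    exact hF.comp (continuous_mk3.measurable.comp (by fun_prop))
  have e1 : ∀ z : ℝ, ∫⁻ p : ℝ × ℝ, F !₂[p.1, p.2, z] = ∫⁻ r in Ioi (0 : ℝ),
      ENNReal.ofReal r * ∫⁻ θ in Ioo (-Real.pi) Real.pi, H (z, r) θ := by
    intro z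
    rw [← lintegral_comp_polarCoord_symm, polarCoord_target, setLIntegral_volume_prod]
    · refine lintegral_congr fun r => ?_
      rw [← lintegral_const_mul' _ _ ENNReal.ofReal_ne_top]
      rfl
    · have : (fun p : ℝ × ℝ => ENNReal.ofReal p.1 • F !₂[(polarCoord.symm p).1, (polarCoord.symm p).2, z]) =
          fun p => ENNReal.ofReal p.1 * Function.uncurry H ((z, p.1), p.2) := rfl
      rw [this]
      exact (by fun_prop : Measurable fun p : ℝ × ℝ => ENNReal.ofReal p.1).mul
        (hH.comp (by fun_prop))
  let K : ℝ × ℝ → ℝ≥0∞ := fun p => ∫⁻ θ in Ioo (-Real.pi) Real.pi, H p θ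
  have hK : Measurable K := hH.lintegral_prod_right'
  -- Extension by zero to r ≤ 0. In the second change of variables the planar angle runs over (-π,
  -- π), and this extension cuts it down to (0, π), where sin φ > 0.
  let J : ℝ × ℝ → ℝ≥0∞ := fun p => (Ioi (0 : ℝ)).indicator (fun r => ENNReal.ofReal r * K (p.1, r)) p.2
  have hJ' : J = (Prod.snd ⁻¹' Ioi (0 : ℝ)).indicator (fun p : ℝ × ℝ => ENNReal.ofReal p.2 * K p) := by
    ext p; simp only [J, indicator, mem_preimage]
  have hJ : Measurable J := by
    rw [hJ']
    exact ((by fun_prop : Measurable fun p : ℝ × ℝ => ENNReal.ofReal p.2).mul hK).indicator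
      (measurable_snd measurableSet_Ioi)
  have e2 : ∫⁻ ξ, F ξ = ∫⁻ p, J p := by
    rw [lintegral_E3_eq F hF, lintegral_volume_prod hJ]
    refine lintegral_congr fun z => ?_
    rw [e1, ← lintegral_indicator measurableSet_Ioi]
  have e3 : ∫⁻ p, J p = ∫⁻ p in merid, ENNReal.ofReal (p.1 ^ 2 * Real.sin p.2) *
      K (p.1 * Real.cos p.2, p.1 * Real.sin p.2) := by
    rw [← lintegral_comp_polarCoord_symm, polarCoord_target]
    have hsub : merid ⊆ Ioi (0 : ℝ) ×ˢ Ioo (-Real.pi) Real.pi :=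
      prod_mono subset_rfl (Ioo_subset_Ioo_left (by linarith [Real.pi_pos]))
    rw [← lintegral_indicator (measurableSet_Ioi.prod measurableSet_Ioo),
      ← lintegral_indicator isOpen_merid.measurableSet]
    refine lintegral_congr fun p => ?_
    by_cases hp : p ∈ Ioi (0 : ℝ) ×ˢ Ioo (-Real.pi) Real.pi
    · rw [indicator_of_mem hp]
      have hp1 : 0 < p.1 := hp.1
      by_cases hm : p ∈ merid
      · have hs : 0 < Real.sin p.2 := Real.sin_pos_of_pos_of_lt_pi hm.2.1 hm.2.2
        rw [indicator_of_mem hm]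
        have : (polarCoord.symm p).2 ∈ Ioi (0 : ℝ) := mul_pos hp1 hs
        simp only [J]
        rw [indicator_of_mem this, smul_eq_mul, ← mul_assoc, ← ENNReal.ofReal_mul hp1.le]
        simp only [polarCoord_symm_apply]
        congr 2
        ring
      · rw [indicator_of_notMem hm]
        have hs : Real.sin p.2 ≤ 0 := by
          refine Real.sin_nonpos_of_nonpos_of_neg_pi_le ?_ hp.2.1.le
          by_contra h
          exact hm ⟨hp1, not_le.1 h, hp.2.2⟩
        have : (polarCoord.symm p).2 ∉ Ioi (0 : ℝ) := by
          simp only [polarCoord_symm_apply, mem_Ioi, not_lt]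
          exact mul_nonpos_of_nonneg_of_nonpos hp1.le hs
        simp only [J]
        rw [indicator_of_notMem this, smul_zero]
    · rw [indicator_of_notMem hp, indicator_of_notMem (fun h => hp (hsub h))]
  rw [e2, e3, sphDom, setLIntegral_volume_prod]
  · refine lintegral_congr fun p => ?_
    rw [← lintegral_const_mul' _ _ ENNReal.ofReal_ne_top]
    rfl
  · have := hF.comp continuous_sph.measurable
    exact (by fun_prop : Measurable fun q : (ℝ × ℝ) × ℝ =>
      ENNReal.ofReal (q.1.1 ^ 2 * Real.sin q.1.2)).mul this

/-- The measure `ρ² sin φ dρ dφ dθ`. -/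
def sphMeasure : Measure ((ℝ × ℝ) × ℝ) :=
  ((volume : Measure ((ℝ × ℝ) × ℝ)).restrict sphDom).withDensity
    fun q => ENNReal.ofReal (q.1.1 ^ 2 * Real.sin q.1.2)

theorem measurePreserving_sph : MeasurePreserving sph sphMeasure volume := by
  refine ⟨continuous_sph.measurable, ?_⟩
  ext s hs
  have hd : Measurable fun q : (ℝ × ℝ) × ℝ => ENNReal.ofReal (q.1.1 ^ 2 * Real.sin q.1.2) := by
    fun_prop
  rw [← lintegral_indicator_one hs, ← lintegral_indicator_one hs,
    lintegral_map (measurable_one.indicator hs) continuous_sph.measurable,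
    lintegral_spherical _ (measurable_one.indicator hs), sphMeasure,
    lintegral_withDensity_eq_lintegral_mul _ hd]
  · rfl
  · exact (measurable_one.indicator hs).comp continuous_sph.measurable

theorem integral_spherical {F : E3 → ℂ} (hF : AEStronglyMeasurable F) :
    ∫ ξ, F ξ = ∫ q in sphDom, (q.1.1 ^ 2 * Real.sin q.1.2) • F (sph q) := by
  have h := measurePreserving_sph
  have hd : Measurable fun q : (ℝ × ℝ) × ℝ => (q.1.1 ^ 2 * Real.sin q.1.2).toNNReal := by
    fun_prop
  rw [← h.map_eq] at hF ⊢
  rw [integral_map h.measurable.aemeasurable hF, sphMeasure]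
  have : (fun q : (ℝ × ℝ) × ℝ => ENNReal.ofReal (q.1.1 ^ 2 * Real.sin q.1.2)) =
    fun q => ((q.1.1 ^ 2 * Real.sin q.1.2).toNNReal : ℝ≥0∞) := rfl
  rw [this, integral_withDensity_eq_integral_smul hd]
  refine setIntegral_congr_fun measurableSet_sphDom fun q hq => ?_
  have : 0 ≤ q.1.1 ^ 2 * Real.sin q.1.2 :=
    mul_nonneg (sq_nonneg _) (Real.sin_nonneg_of_nonneg_of_le_pi hq.1.2.1.le hq.1.2.2.le)
  rw [NNReal.smul_def, Real.coe_toNNReal _ this]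

theorem integrableOn_spherical {F : E3 → ℂ} (hF : Integrable F) :
    IntegrableOn (fun q => (q.1.1 ^ 2 * Real.sin q.1.2) • F (sph q)) sphDom := by
  have h := measurePreserving_sph
  have hd : Measurable fun q : (ℝ × ℝ) × ℝ => (q.1.1 ^ 2 * Real.sin q.1.2).toNNReal := by
    fun_prop
  have h1 : Integrable (F ∘ sph) sphMeasure := h.integrable_comp_of_integrable hF
  have : (fun q : (ℝ × ℝ) × ℝ => ENNReal.ofReal (q.1.1 ^ 2 * Real.sin q.1.2)) =
    fun q => ((q.1.1 ^ 2 * Real.sin q.1.2).toNNReal : ℝ≥0∞) := rfl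
  rw [sphMeasure, this, integrable_withDensity_iff_integrable_smul hd] at h1
  refine (integrableOn_congr_fun (fun q hq => ?_) measurableSet_sphDom).1 h1
  have : 0 ≤ q.1.1 ^ 2 * Real.sin q.1.2 :=
    mul_nonneg (sq_nonneg _) (Real.sin_nonneg_of_nonneg_of_le_pi hq.1.2.1.le hq.1.2.2.le)
  rw [NNReal.smul_def, Real.coe_toNNReal _ this]
  rfl

theorem sph_zero (q : (ℝ × ℝ) × ℝ) : sph q 0 = q.1.1 * Real.sin q.1.2 * Real.cos q.2 := rfl
theorem sph_one (q : (ℝ × ℝ) × ℝ) : sph q 1 = q.1.1 * Real.sin q.1.2 * Real.sin q.2 := rfl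
theorem sph_two (q : (ℝ × ℝ) × ℝ) : sph q 2 = q.1.1 * Real.cos q.1.2 := rfl

theorem sin_pos_of_mem_merid {p : ℝ × ℝ} (hp : p ∈ merid) : 0 < Real.sin p.2 :=
  Real.sin_pos_of_pos_of_lt_pi hp.2.1 hp.2.2

theorem norm_sph {q : (ℝ × ℝ) × ℝ} (h : 0 ≤ q.1.1) : ‖sph q‖ = q.1.1 := by
  refine (sq_eq_sq₀ (norm_nonneg _) h).1 ?_
  rw [norm_sq_eq, sph_zero, sph_one, sph_two]
  linear_combination q.1.1 ^ 2 * Real.sin_sq_add_cos_sq q.1.2 +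
    q.1.1 ^ 2 * Real.sin q.1.2 ^ 2 * Real.sin_sq_add_cos_sq q.2

theorem axisDist_sph {q : (ℝ × ℝ) × ℝ} (h : q.1 ∈ merid) :
    axisDist (sph q) = q.1.1 * Real.sin q.1.2 := by
  have h1 : 0 < q.1.1 := h.1
  have h2 := sin_pos_of_mem_merid h
  refine (sq_eq_sq₀ (axisDist_nonneg _) (by positivity)).1 ?_
  rw [axisDist_sq, sph_zero, sph_one]
  linear_combination q.1.1 ^ 2 * Real.sin q.1.2 ^ 2 * Real.sin_sq_add_cos_sq q.2

/-- The polar angle. -/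
def polAng (ξ : E3) : ℝ := Real.arccos (ξ 2 / ‖ξ‖)

theorem polAng_sph {q : (ℝ × ℝ) × ℝ} (h : q.1 ∈ merid) : polAng (sph q) = q.1.2 := by
  have h1 : 0 < q.1.1 := h.1
  rw [polAng, norm_sph h1.le, sph_two, mul_div_cancel_left₀ _ h1.ne',
    Real.arccos_cos h.2.1.le h.2.2.le]

theorem norm_pos_of_offAxis {ξ : E3} (h : ξ ∈ offAxis) : 0 < ‖ξ‖ :=
  (mem_offAxis_iff.1 h).trans_le (axisDist_le_norm ξ)

theorem contDiffOn_polAng : ContDiffOn ℝ ∞ polAng offAxis := by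
  intro ξ hξ
  have h0 := norm_pos_of_offAxis hξ
  have h1 : |ξ 2 / ‖ξ‖| < 1 := by
    rw [abs_div, abs_norm, div_lt_one h0]
    refine abs_lt_of_sq_lt_sq ?_ h0.le
    have h2 := norm_sq_eq ξ
    have h3 := axisDist_sq ξ
    have h4 := mem_offAxis_iff.1 hξ
    nlinarith
  rw [abs_lt] at h1
  refine (ContDiffAt.comp ξ (Real.contDiffAt_arccos h1.1.ne' h1.2.ne) ?_).contDiffWithinAt
  exact (contDiff_coord 2).contDiffAt.div (contDiffAt_norm ℝ (norm_pos_iff.1 h0)) h0.ne'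

theorem axisDist_eq_norm_mul_sin (ξ : E3) : axisDist ξ = ‖ξ‖ * Real.sin (polAng ξ) := by
  rcases eq_or_ne ξ 0 with rfl | hξ
  · simp [axisDist]
  have h0 := norm_pos_iff.2 hξ
  rw [polAng, Real.sin_arccos, axisDist]
  rw [← Real.sqrt_sq (norm_nonneg ξ), ← Real.sqrt_mul (sq_nonneg _), Real.sqrt_sq (norm_nonneg ξ)]
  congr 1
  have := norm_sq_eq ξ
  field_simp
  linarith

/-- The axisymmetric function `ψ(ρ, φ) / (ρ^a |ξ_h|)`. -/
def lift (a : ℕ) (ψ : ℝ × ℝ → ℝ) (ξ : E3) : ℝ := ψ (‖ξ‖, polAng ξ) / (‖ξ‖ ^ a * axisDist ξ)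

theorem lift_sph (a : ℕ) (ψ : ℝ × ℝ → ℝ) {q : (ℝ × ℝ) × ℝ} (h : q.1 ∈ merid) :
    lift a ψ (sph q) = ψ q.1 / (q.1.1 ^ a * (q.1.1 * Real.sin q.1.2)) := by
  rw [lift, norm_sph (le_of_lt h.1), polAng_sph h, axisDist_sph h]

/-- By compactness ρ sin φ has a positive lower bound on the support of ψ, so the lifted support
keeps away from the axis. -/
theorem lift_support {ψ : ℝ × ℝ → ℝ} (hc : HasCompactSupport ψ)
    (hs : tsupport ψ ⊆ merid) (a : ℕ) : HasCompactSupport (lift a ψ) ∧ tsupport (lift a ψ) ⊆ offAxis := by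
  obtain ⟨R, hR⟩ := hc.isCompact.isBounded.subset_closedBall (0 : ℝ × ℝ)
  obtain ⟨c, hc0, hcb⟩ : ∃ c : ℝ, 0 < c ∧ ∀ p ∈ tsupport ψ, c ≤ p.1 * Real.sin p.2 := by
    rcases (tsupport ψ).eq_empty_or_nonempty with h | h
    · exact ⟨1, one_pos, by simp [h]⟩
    · obtain ⟨p, hp, hmin⟩ := hc.isCompact.exists_isMinOn h
        (f := fun p : ℝ × ℝ => p.1 * Real.sin p.2) (by fun_prop)
      exact ⟨_, mul_pos (hs hp).1 (sin_pos_of_mem_merid (hs hp)), fun p' hp' => hmin hp'⟩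
  have hsub : tsupport (lift a ψ) ⊆ Metric.closedBall 0 R ∩ {ξ | c ≤ axisDist ξ} := by
    refine closure_minimal (fun ξ hξ => ?_)
      (Metric.isClosed_closedBall.inter (isClosed_le continuous_const continuous_axisDist))
    have h1 : ψ (‖ξ‖, polAng ξ) ≠ 0 := fun h => hξ (by simp [lift, h])
    have h2 : (‖ξ‖, polAng ξ) ∈ tsupport ψ := subset_tsupport _ h1
    refine ⟨?_, ?_⟩
    · have := hR h2
      rw [mem_closedBall_zero_iff] at this ⊢
      have h3 := norm_fst_le (‖ξ‖, polAng ξ)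
      simp only [norm_norm] at h3
      exact h3.trans this
    · have := hcb _ h2
      rw [mem_ofPred_eq, axisDist_eq_norm_mul_sin]
      exact this
  refine ⟨HasCompactSupport.of_support_subset_isCompact (isCompact_closedBall 0 R)
    ((subset_tsupport _).trans (hsub.trans inter_subset_left)), fun ξ hξ => ?_⟩
  exact mem_offAxis_iff.2 (hc0.trans_le (hsub hξ).2)

theorem contDiff_lift {ψ : ℝ × ℝ → ℝ} (hψ : ContDiff ℝ ∞ ψ) (hc : HasCompactSupport ψ)
    (hs : tsupport ψ ⊆ merid) (a : ℕ) : ContDiff ℝ ∞ (lift a ψ) := by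
  refine contDiff_of_tsupport_subset isOpen_offAxis ?_ (lift_support hc hs a).2
  have hn : ContDiffOn ℝ ∞ (fun ξ : E3 => ‖ξ‖) offAxis := fun ξ hξ =>
    (contDiffAt_norm ℝ (norm_pos_iff.1 (norm_pos_of_offAxis hξ))).contDiffWithinAt
  refine ContDiffOn.div ?_ ((hn.pow a).mul contDiffOn_axisDist) ?_
  · exact hψ.comp_contDiffOn (hn.prodMk contDiffOn_polAng)
  · intro ξ hξ
    exact mul_ne_zero (pow_ne_zero _ (norm_pos_of_offAxis hξ).ne') (mem_offAxis_iff.1 hξ).ne'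

theorem hasDerivAt_slice {ψ : ℝ × ℝ → ℝ} (hψ : ContDiff ℝ ∞ ψ) (p v : ℝ × ℝ) :
    HasDerivAt (fun s : ℝ => ψ (p + s • v)) (fderiv ℝ ψ p v) 0 := by
  have h := (hψ.differentiable (by simp) p).hasFDerivAt
  have h0 : HasFDerivAt ψ (fderiv ℝ ψ p) (p + (0 : ℝ) • v) := by simpa using h
  have h1 : HasDerivAt (fun s : ℝ => p + s • v) v 0 := by
    simpa using ((hasDerivAt_id (0 : ℝ)).smul_const v).const_add p
  exact h0.comp_hasDerivAt 0 h1

/-- The exponent 2 makes the Jacobian times the lift equal to ψ/ρ; the factor 1/(ρ² |ξ_h|) is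
homogeneous of degree -3, whence the zero-order term. -/
theorem fderiv_lift_radial {ψ : ℝ × ℝ → ℝ} (hψ : ContDiff ℝ ∞ ψ) (hc : HasCompactSupport ψ)
    (hs : tsupport ψ ⊆ merid) {q : (ℝ × ℝ) × ℝ} (hq : q.1 ∈ merid) :
    q.1.1 ^ 2 * Real.sin q.1.2 * fderiv ℝ (lift 2 ψ) (sph q) (sph q) =
      fderiv ℝ ψ q.1 (1, 0) - 3 * (ψ q.1 / q.1.1) := by
  obtain ⟨⟨ρ, φ⟩, θ⟩ := q
  have hρ : 0 < ρ := hq.1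
  have hs0 := sin_pos_of_mem_merid hq
  simp only at hs0 ⊢
  have h1 := ((contDiff_lift hψ hc hs 2).differentiable (by simp) (sph ((ρ, φ), θ))).hasFDerivAt
  have hlin : ∀ s : ℝ, sph ((ρ + s, φ), θ) = sph ((ρ, φ), θ) + (s / ρ) • sph ((ρ, φ), θ) := by
    intro s
    ext i
    fin_cases i <;> simp [sph] <;> field_simp
  have h2 : HasDerivAt (fun s : ℝ => sph ((ρ, φ), θ) + (s / ρ) • sph ((ρ, φ), θ))
      ((1 / ρ) • sph ((ρ, φ), θ)) 0 :=
    (((hasDerivAt_id (0 : ℝ)).div_const ρ).smul_const _).const_add _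
  have h3 : HasFDerivAt (lift 2 ψ) (fderiv ℝ (lift 2 ψ) (sph ((ρ, φ), θ)))
      (sph ((ρ, φ), θ) + ((0 : ℝ) / ρ) • sph ((ρ, φ), θ)) := by simpa using h1
  have h4 := h3.comp_hasDerivAt 0 h2
  have h5 : HasDerivAt (fun s : ℝ => ψ ((ρ, φ) + s • (1, 0)) * (((ρ + s) ^ 3 * Real.sin φ)⁻¹))
      (fderiv ℝ ψ (ρ, φ) (1, 0) * (ρ ^ 3 * Real.sin φ)⁻¹ + ψ (ρ, φ) *
        (-(3 * ρ ^ 2 * Real.sin φ) / (ρ ^ 3 * Real.sin φ) ^ 2)) 0 := by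
    have e1 := hasDerivAt_slice hψ (ρ, φ) (1, 0)
    have e2 : HasDerivAt (fun s : ℝ => (ρ + s) ^ 3 * Real.sin φ) (3 * ρ ^ 2 * Real.sin φ) 0 := by
      have := (((hasDerivAt_id (0 : ℝ)).const_add ρ).fun_pow 3).mul_const (Real.sin φ)
      simpa using this
    have e3 := e2.fun_inv (by simp; exact ⟨hρ.ne', hs0.ne'⟩)
    have := e1.fun_mul e3
    simpa using this
  have h6 : (fun s : ℝ => ψ ((ρ, φ) + s • (1, 0)) * (((ρ + s) ^ 3 * Real.sin φ)⁻¹)) =ᶠ[𝓝 0]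
      (lift 2 ψ ∘ fun s : ℝ => sph ((ρ, φ), θ) + (s / ρ) • sph ((ρ, φ), θ)) := by
    have : ∀ᶠ s in 𝓝 (0 : ℝ), -ρ < s := lt_mem_nhds (by linarith)
    filter_upwards [this] with s hs'
    have hm : ((ρ + s, φ), θ).1 ∈ merid := ⟨by simp only [mem_Ioi]; linarith, hq.2⟩
    rw [Function.comp_apply, ← hlin, lift_sph 2 ψ hm]
    simp only [Prod.smul_mk, smul_eq_mul, mul_one, mul_zero, Prod.mk_add_mk, add_zero]
    rw [div_eq_mul_inv]
    congr 2
    ring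
  have h7 := h4.unique (h5.congr_of_eventuallyEq h6.symm)
  rw [map_smul, smul_eq_mul] at h7
  field_simp at h7 ⊢
  linear_combination h7

/-- With exponent 1 the Jacobian times the lift is ψ itself. The derivative of 1/sin φ cancels the
divergence term ξ₃/|ξ_h| = cot φ, leaving a pure ∂_φ in the plane. -/
theorem fderiv_lift_polar {ψ : ℝ × ℝ → ℝ} (hψ : ContDiff ℝ ∞ ψ) (hc : HasCompactSupport ψ)
    (hs : tsupport ψ ⊆ merid) {q : (ℝ × ℝ) × ℝ} (hq : q.1 ∈ merid) :
    q.1.1 ^ 2 * Real.sin q.1.2 * (fderiv ℝ (lift 1 ψ) (sph q) (polarField (sph q)) +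
      sph q 2 / axisDist (sph q) * lift 1 ψ (sph q)) = fderiv ℝ ψ q.1 (0, 1) := by
  obtain ⟨⟨ρ, φ⟩, θ⟩ := q
  have hρ : 0 < ρ := hq.1
  have hs0 := sin_pos_of_mem_merid hq
  simp only at hs0 ⊢
  have h1 := ((contDiff_lift hψ hc hs 1).differentiable (by simp) (sph ((ρ, φ), θ))).hasFDerivAt
  let u : E3 := Real.cos θ • ebasis 0 + Real.sin θ • ebasis 1
  have hlin : ∀ s : ℝ, sph ((ρ, φ + s), θ) =
      Real.sin (φ + s) • (ρ • u) + Real.cos (φ + s) • (ρ • ebasis 2) := by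
    intro s
    ext i
    fin_cases i <;> simp [sph, u, ebasis] <;> ring
  have hpf : polarField (sph ((ρ, φ), θ)) =
      Real.cos φ • (ρ • u) + -Real.sin φ • (ρ • ebasis 2) := by
    have hd := axisDist_sph hq
    have hp : ∀ x : E3, polarField x =
      !₂[x 2 * x 0 / axisDist x, x 2 * x 1 / axisDist x, -axisDist x] := fun _ => rfl
    rw [hp, hd]
    ext i
    fin_cases i <;> simp [sph, u, ebasis] <;> field_simp
  have h2 : HasDerivAt (fun s : ℝ => sph ((ρ, φ + s), θ)) (polarField (sph ((ρ, φ), θ))) 0 := by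
    simp_rw [hlin]
    rw [hpf]
    have e0 := (hasDerivAt_id (0 : ℝ)).const_add φ
    have e1 := (e0.sin).smul_const (ρ • u)
    have e2 := (e0.cos).smul_const (ρ • ebasis 2)
    simpa using e1.fun_add e2
  have h3 : HasFDerivAt (lift 1 ψ) (fderiv ℝ (lift 1 ψ) (sph ((ρ, φ), θ)))
      (sph ((ρ, φ + 0), θ)) := by simpa using h1
  have h4 := h3.comp_hasDerivAt 0 h2
  have h5 : HasDerivAt (fun s : ℝ => ψ ((ρ, φ) + s • (0, 1)) * ((ρ ^ 2 * Real.sin (φ + s))⁻¹))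
      (fderiv ℝ ψ (ρ, φ) (0, 1) * (ρ ^ 2 * Real.sin φ)⁻¹ + ψ (ρ, φ) *
        (-(ρ ^ 2 * Real.cos φ) / (ρ ^ 2 * Real.sin φ) ^ 2)) 0 := by
    have e1 := hasDerivAt_slice hψ (ρ, φ) (0, 1)
    have e2 : HasDerivAt (fun s : ℝ => ρ ^ 2 * Real.sin (φ + s)) (ρ ^ 2 * Real.cos φ) 0 := by
      have := (((hasDerivAt_id (0 : ℝ)).const_add φ).sin).const_mul (ρ ^ 2)
      simpa using this
    have e3 := e2.fun_inv (by simp; exact ⟨hρ.ne', hs0.ne'⟩)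
    have := e1.fun_mul e3
    simpa using this
  have h6 : (fun s : ℝ => ψ ((ρ, φ) + s • (0, 1)) * ((ρ ^ 2 * Real.sin (φ + s))⁻¹)) =ᶠ[𝓝 0]
      (lift 1 ψ ∘ fun s : ℝ => sph ((ρ, φ + s), θ)) := by
    have a1 : ∀ᶠ s in 𝓝 (0 : ℝ), -φ < s := lt_mem_nhds (by linarith [hq.2.1])
    have a2 : ∀ᶠ s in 𝓝 (0 : ℝ), s < Real.pi - φ := gt_mem_nhds (by linarith [hq.2.2])
    filter_upwards [a1, a2] with s hs1 hs2
    have hm : ((ρ, φ + s), θ).1 ∈ merid := ⟨hρ, by simp only; linarith, by simp only; linarith⟩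
    rw [Function.comp_apply, lift_sph 1 ψ hm]
    simp only [Prod.smul_mk, smul_eq_mul, mul_one, mul_zero, Prod.mk_add_mk, add_zero]
    rw [div_eq_mul_inv]
    congr 2
    ring
  have h7 := h4.unique (h5.congr_of_eventuallyEq h6.symm)
  rw [h7, lift_sph 1 ψ hq, axisDist_sph hq, sph_two]
  field_simp
  ring

/-! ### Integration over the azimuth -/

/-- The integral of a function over the azimuth. -/
def azInt (h : E3 → ℂ) (p : ℝ × ℝ) : ℂ := ∫ θ in Ioo (-Real.pi) Real.pi, h (sph (p, θ))

theorem stronglyMeasurable_azInt {h : E3 → ℂ} (hh : StronglyMeasurable h) :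
    StronglyMeasurable (azInt h) :=
  StronglyMeasurable.integral_prod_right' (f := fun q : (ℝ × ℝ) × ℝ => h (sph q))
    (hh.comp_measurable continuous_sph.measurable)

/-- Reduces a pairing in space to one in the meridian half plane: whenever Jacobian times Φ depends
only on (ρ, φ), the azimuth is integrated onto h. -/
theorem integral_mul_eq_azInt {h : E3 → ℂ} {Φ : E3 → ℝ} {ψ : ℝ × ℝ → ℝ}
    (hi : Integrable fun ξ => h ξ * (Φ ξ : ℂ))
    (hΦ : ∀ q : (ℝ × ℝ) × ℝ, q.1 ∈ merid → q.1.1 ^ 2 * Real.sin q.1.2 * Φ (sph q) = ψ q.1)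
    (hψ : ∀ p ∉ merid, ψ p = 0) :
    Integrable (fun p => ψ p • azInt h p) ∧
      ∫ ξ, h ξ * (Φ ξ : ℂ) = ∫ p, ψ p • azInt h p := by
  have h1 := integrableOn_spherical hi
  have h2 : IntegrableOn (fun q : (ℝ × ℝ) × ℝ => ψ q.1 • h (sph q)) sphDom := by
    refine h1.congr_fun (fun q hq => ?_) measurableSet_sphDom
    simp only [← hΦ q hq.1, Complex.real_smul]
    push_cast
    ring
  have h3 : Integrable (fun q : (ℝ × ℝ) × ℝ => ψ q.1 • h (sph q))
      (((volume : Measure (ℝ × ℝ)).restrict merid).prod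
        ((volume : Measure ℝ).restrict (Ioo (-Real.pi) Real.pi))) := by
    rw [Measure.prod_restrict]
    exact h2
  have e : ∀ p, ∫ θ in Ioo (-Real.pi) Real.pi, ψ p • h (sph (p, θ)) = ψ p • azInt h p :=
    fun p => integral_smul _ _
  have hsupp : Function.support (fun p => ψ p • azInt h p) ⊆ merid := by
    intro p hp
    by_contra hn
    exact hp (by simp [hψ p hn])
  constructor
  · have := h3.integral_prod_left
    simp only [e] at this
    rwa [← IntegrableOn, integrableOn_iff_integrable_of_support_subset hsupp] at this
  · rw [integral_spherical hi.aestronglyMeasurable]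
    rw [← setIntegral_eq_integral_of_forall_compl_eq_zero (s := merid)
      (fun p hp => by simp [hψ p hp])]
    simp_rw [← e]
    have := integral_prod _ h3
    rw [← this, Measure.prod_restrict]
    refine setIntegral_congr_fun measurableSet_sphDom fun q hq => ?_
    simp only [← hΦ q hq.1, Complex.real_smul]
    push_cast
    ring

theorem integral_add_smul_mul (g g' : L2) (c : ℂ) {Φ : E3 → ℂ} (h1 : Continuous Φ)
    (h2 : HasCompactSupport Φ) :
    ∫ ξ, (g + c • g' : L2) ξ * Φ ξ = (∫ ξ, g ξ * Φ ξ) + c * ∫ ξ, g' ξ * Φ ξ := by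
  rw [← integral_const_mul, ← integral_add (integrable_L2_mul g h1 h2)
    ((integrable_L2_mul g' h1 h2).const_mul c)]
  refine integral_congr_ae ?_
  filter_upwards [Lp.coeFn_add g (c • g'), Lp.coeFn_smul c g'] with ξ a1 a2
  rw [a1, Pi.add_apply, a2, Pi.smul_apply, smul_eq_mul]
  ring

/-- This is ρ∂_ρ h = -(h₁ + 3h), the 3 being the dimension, integrated over the azimuth and divided
by ρ. -/
theorem WeakScale.weakDir {h h₁ : L2} (hw : WeakScale h h₁) :
    WeakDir merid (1, 0) (azInt h)
      (fun p => -((1 / p.1) • azInt (h₁ + (3 : ℂ) • h : L2) p)) := by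
  intro ψ hψ hc hs
  have hsm := contDiff_lift hψ hc hs 2
  have hcs := (lift_support hc hs 2).1
  have hcc : HasCompactSupport fun ξ => (lift 2 ψ ξ : ℂ) :=
    hcs.comp_left (g := fun r : ℝ => (r : ℂ)) Complex.ofReal_zero
  have hz : ∀ p ∉ merid, ψ p = 0 := fun p hp => image_eq_zero_of_notMem_tsupport fun h => hp (hs h)
  have hz' : ∀ p ∉ merid, fderiv ℝ ψ p (1, 0) = 0 := fun p hp => by
    have : fderiv ℝ ψ p = 0 := by
      by_contra h'
      exact hp (hs (support_fderiv_subset ℝ h'))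
    simp [this]
  have h1 := hw (fun ξ => (lift 2 ψ ξ : ℂ)) (Complex.ofRealCLM.contDiff.comp hsm) hcc
  simp_rw [fderiv_ofReal_comp (hsm.differentiable (by simp) _)] at h1
  have hdc := hsm.continuous_fderiv (by simp)
  have hds : HasCompactSupport fun ξ => ((fderiv ℝ (lift 2 ψ) ξ ξ : ℝ) : ℂ) := by
    refine HasCompactSupport.intro hcs.isCompact fun x hx => ?_
    have : fderiv ℝ (lift 2 ψ) x = 0 := by
      by_contra h
      exact hx (support_fderiv_subset ℝ h)
    simp [this]
  have hsc := hsm.continuous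
  have hmer : ∀ q : (ℝ × ℝ) × ℝ, q.1 ∈ merid →
      q.1.1 ^ 2 * Real.sin q.1.2 * lift 2 ψ (sph q) = ψ q.1 / q.1.1 := by
    intro q hq
    have hρ : 0 < q.1.1 := hq.1
    have := sin_pos_of_mem_merid hq
    rw [lift_sph 2 ψ hq]
    field_simp
  have i0 := integrable_L2_mul h (φ := fun ξ => (lift 2 ψ ξ : ℂ)) (by fun_prop) hcc
  have e1 := integral_mul_eq_azInt (h := (h₁ + (3 : ℂ) • h : L2)) (Φ := lift 2 ψ)
    (ψ := fun p => ψ p / p.1)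
    (integrable_L2_mul _ (by fun_prop) hcc) hmer (fun p hp => by simp [hz p hp])
  have e0 := integral_mul_eq_azInt (h := h) (Φ := lift 2 ψ) (ψ := fun p => ψ p / p.1)
    i0 hmer (fun p hp => by simp [hz p hp])
  have e2 := integral_mul_eq_azInt (h := h) (Φ := fun ξ => fderiv ℝ (lift 2 ψ) ξ ξ)
    (ψ := fun p => fderiv ℝ ψ p (1, 0) - 3 * (ψ p / p.1))
    (integrable_L2_mul h (by fun_prop) hds) (fun q hq => fderiv_lift_radial hψ hc hs hq)
    (fun p hp => by simp [hz p hp, hz' p hp])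
  have e4 : ∫ ξ, (h₁ + (3 : ℂ) • h : L2) ξ * (lift 2 ψ ξ : ℂ) =
      (∫ ξ, h₁ ξ * (lift 2 ψ ξ : ℂ)) + 3 * ∫ ξ, h ξ * (lift 2 ψ ξ : ℂ) :=
    integral_add_smul_mul h₁ h 3 (by fun_prop) hcc
  have e0' : Integrable fun p => (3 : ℝ) • ((ψ p / p.1) • azInt h p) := e0.1.smul (3 : ℝ)
  have e3 : ∫ p, (fderiv ℝ ψ p (1, 0)) • azInt h p =
      (∫ p, (fderiv ℝ ψ p (1, 0) - 3 * (ψ p / p.1)) • azInt h p) +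
        ∫ p, (3 : ℝ) • ((ψ p / p.1) • azInt h p) := by
    rw [← integral_add e2.1 e0']
    congr 1
    ext p
    simp only [Complex.real_smul]
    push_cast
    ring
  rw [e3, integral_smul, ← e2.2, ← e0.2, ← h1, Complex.real_smul, Complex.ofReal_ofNat, ← e4, e1.2,
    ← integral_neg]
  congr 1
  ext p
  simp only [Complex.real_smul]
  push_cast
  ring

/-- The test function of a weak polar derivative is admissible. -/
theorem polar_test {B : E3 → ℂ} (hB : ContDiff ℝ ∞ B) (hc : HasCompactSupport B)
    (hs : tsupport B ⊆ offAxis) :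
    Continuous (fun ξ => fderiv ℝ B ξ (polarField ξ) + ((ξ 2 / axisDist ξ : ℝ) : ℂ) * B ξ) ∧
    HasCompactSupport (fun ξ => fderiv ℝ B ξ (polarField ξ) +
      ((ξ 2 / axisDist ξ : ℝ) : ℂ) * B ξ) := by
  have hdc := hB.continuous_fderiv (by simp)
  have hoff : ∀ ξ ∉ tsupport B, fderiv ℝ B ξ (polarField ξ) +
      ((ξ 2 / axisDist ξ : ℝ) : ℂ) * B ξ = 0 := by
    intro x hx
    have : fderiv ℝ B x = 0 := by
      by_contra h
      exact hx (support_fderiv_subset ℝ h)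
    simp [this, image_eq_zero_of_notMem_tsupport hx]
  refine ⟨continuous_iff_continuousAt.2 fun x => ?_,
    HasCompactSupport.intro hc.isCompact fun x hx => hoff x hx⟩
  by_cases hx : x ∈ tsupport B
  · have hx' := hs hx
    have hr := (mem_offAxis_iff.1 hx').ne'
    have hpf : ContinuousAt polarField x := by
      have : polarField = (fun p : ℝ × ℝ × ℝ => (!₂[p.1, p.2.1, p.2.2] : E3)) ∘ fun x =>
        (x 2 * x 0 / axisDist x, x 2 * x 1 / axisDist x, -axisDist x) := rfl
      rw [this]
      refine continuous_mk3.continuousAt.comp ?_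
      have hd := continuous_axisDist.continuousAt (x := x)
      have hco : ∀ i, ContinuousAt (fun x : E3 => x i) x := fun i =>
        (contDiff_coord (n := 0) i).continuous.continuousAt
      exact (((hco 2).mul (hco 0)).div hd hr).prodMk
        ((((hco 2).mul (hco 1)).div hd hr).prodMk hd.neg)
    refine (hdc.continuousAt.clm_apply hpf).add
      ((Complex.continuous_ofReal.continuousAt.comp ?_).mul hB.continuous.continuousAt)
    exact (contDiff_coord (n := 0) 2).continuous.continuousAt.div
      continuous_axisDist.continuousAt hr
  · have : (fun ξ => fderiv ℝ B ξ (polarField ξ) + ((ξ 2 / axisDist ξ : ℝ) : ℂ) * B ξ)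
        =ᶠ[𝓝 x] fun _ => 0 := by
      filter_upwards [(isClosed_tsupport _).isOpen_compl.mem_nhds hx] with y hy
      exact hoff y hy
    exact continuousAt_const.congr this.symm

theorem WeakPolar.add_smul {h h' w w' : L2} (hw : WeakPolar h w) (hw' : WeakPolar h' w') (c : ℂ) :
    WeakPolar (h + c • h' : L2) (w + c • w' : L2) := by
  intro B hB hc hs
  obtain ⟨t1, t2⟩ := polar_test hB hc hs
  rw [integral_add_smul_mul w w' c hB.continuous hc, integral_add_smul_mul h h' c t1 t2, hw B hB hc hs, hw' B hB hc hs]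
  ring

theorem WeakPolar.weakDir {h w : L2} (hw : WeakPolar h w) :
    WeakDir merid (0, 1) (azInt h) (azInt w) := by
  intro ψ hψ hc hs
  have hsm := contDiff_lift hψ hc hs 1
  have hcs := lift_support hc hs 1
  have hcc : HasCompactSupport fun ξ => (lift 1 ψ ξ : ℂ) :=
    hcs.1.comp_left (g := fun r : ℝ => (r : ℂ)) Complex.ofReal_zero
  have hts : tsupport (fun ξ => (lift 1 ψ ξ : ℂ)) ⊆ offAxis :=
    (closure_mono (Function.support_comp_subset Complex.ofReal_zero _)).trans hcs.2
  have hz : ∀ p ∉ merid, ψ p = 0 := fun p hp => image_eq_zero_of_notMem_tsupport fun h => hp (hs h)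
  have hz' : ∀ p ∉ merid, fderiv ℝ ψ p (0, 1) = 0 := fun p hp => by
    have : fderiv ℝ ψ p = 0 := by
      by_contra h'
      exact hp (hs (support_fderiv_subset ℝ h'))
    simp [this]
  have h1 := hw (fun ξ => (lift 1 ψ ξ : ℂ)) (Complex.ofRealCLM.contDiff.comp hsm) hcc hts
  simp_rw [fderiv_ofReal_comp (hsm.differentiable (by simp) _)] at h1
  have hsc := hsm.continuous
  let Φ : E3 → ℝ := fun ξ => fderiv ℝ (lift 1 ψ) ξ (polarField ξ) + ξ 2 / axisDist ξ * lift 1 ψ ξ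
  have hΦe : (fun ξ => fderiv ℝ (fun ξ => (lift 1 ψ ξ : ℂ)) ξ (polarField ξ) +
      ((ξ 2 / axisDist ξ : ℝ) : ℂ) * (lift 1 ψ ξ : ℂ)) = fun ξ => (Φ ξ : ℂ) := by
    ext ξ
    rw [fderiv_ofReal_comp (hsm.differentiable (by simp) _)]
    simp only [Φ]
    push_cast
    rfl
  obtain ⟨hΦc, hΦs⟩ := polar_test (Complex.ofRealCLM.contDiff.comp hsm) hcc hts
  change Continuous (fun ξ => fderiv ℝ (fun ξ => (lift 1 ψ ξ : ℂ)) ξ (polarField ξ) +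
      ((ξ 2 / axisDist ξ : ℝ) : ℂ) * (lift 1 ψ ξ : ℂ)) at hΦc
  change HasCompactSupport (fun ξ => fderiv ℝ (fun ξ => (lift 1 ψ ξ : ℂ)) ξ (polarField ξ) +
      ((ξ 2 / axisDist ξ : ℝ) : ℂ) * (lift 1 ψ ξ : ℂ)) at hΦs
  rw [hΦe] at hΦc hΦs
  have e1 := integral_mul_eq_azInt (h := w) (Φ := lift 1 ψ) (ψ := ψ)
    (integrable_L2_mul w (by fun_prop) hcc) (fun q hq => by
      have hρ : 0 < q.1.1 := hq.1
      have := sin_pos_of_mem_merid hq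
      rw [lift_sph 1 ψ hq]
      field_simp) hz
  have e2 := integral_mul_eq_azInt (h := h) (Φ := Φ) (ψ := fun p => fderiv ℝ ψ p (0, 1))
    (integrable_L2_mul h hΦc hΦs) (fun q hq => fderiv_lift_polar hψ hc hs hq) hz'
  rw [← e1.2, ← e2.2, h1]
  congr 2
  ext ξ
  simp only [Φ]
  push_cast
  ring

/-! ### Axisymmetric functions and their azimuthal averages -/

theorem fourier_comp_rot (θ : ℝ) (ψ : E3 → ℂ) (x : E3) : 𝓕 (ψ ∘ rot θ) x = 𝓕 ψ (rot θ x) :=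
  Real.fourier_comp_linearIsometry (rotL θ) ψ x

theorem IsAxisymmetric.fourier {f : L2} (hf : IsAxisymmetric f) : IsAxisymmetric (𝓕 f : L2) := by
  intro θ
  let g : L2 := Lp.compMeasurePreserving (rot θ) (measurePreserving_rot θ) (𝓕 f : L2)
  have hg : g =ᵐ[volume] (𝓕 f : L2) ∘ rot θ :=
    Lp.coeFn_compMeasurePreserving _ (measurePreserving_rot θ)
  have key : ∀ᵐ x, g x = (𝓕 f : L2) x := by
    refine ae_eq_of_integral_contDiff_smul_eq (locallyIntegrable_L2 g) (locallyIntegrable_L2 _) ?_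
    intro ψ hψ hc
    rw [integral_ofReal_smul, integral_ofReal_smul]
    have hs : ContDiff ℝ ∞ fun x => (ψ x : ℂ) := Complex.ofRealCLM.contDiff.comp hψ
    have hcs : HasCompactSupport fun x => (ψ x : ℂ) :=
      hc.comp_left (g := fun r : ℝ => (r : ℂ)) Complex.ofReal_zero
    let Ψ := hcs.toSchwartzMap hs
    let Ψ' := SchwartzMap.compCLMOfContinuousLinearEquiv ℝ
      (rotL (-θ)).toContinuousLinearEquiv Ψ
    have e1 := integral_fourier_mul_schwartz f Ψ'
    have e2 := integral_fourier_mul_schwartz f Ψ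
    have e3 : ∀ x, (𝓕 Ψ') x = (𝓕 Ψ) (rot (-θ) x) := fun x => fourier_comp_rot (-θ) Ψ x
    calc ∫ x, g x * (ψ x : ℂ) = ∫ x, (𝓕 f : L2) (rot θ x) * Ψ' (rot θ x) := by
          refine integral_congr_ae ?_
          filter_upwards [hg] with x hx
          have : Ψ' (rot θ x) = (ψ (rot (-θ) (rot θ x)) : ℂ) := rfl
          rw [hx, this, rot_neg_rot]
          rfl
      _ = ∫ x, (𝓕 f : L2) x * Ψ' x := integral_comp_rot θ fun x => (𝓕 f : L2) x * Ψ' x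
      _ = ∫ x, f x * (𝓕 Ψ) (rot (-θ) x) := by rw [e1]; simp_rw [e3]
      _ = ∫ x, f (rot θ x) * (𝓕 Ψ) (rot (-θ) (rot θ x)) :=
          (integral_comp_rot θ fun x => f x * (𝓕 Ψ) (rot (-θ) x)).symm
      _ = ∫ x, f x * (𝓕 Ψ) x := by
          refine integral_congr_ae ?_
          filter_upwards [hf θ] with x hx
          rw [hx, rot_neg_rot]
      _ = ∫ x, (𝓕 f : L2) x * (ψ x : ℂ) := e2.symm
  filter_upwards [hg, key] with x h1 h2
  rw [← h2, h1]
  rfl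

theorem rot_sph (a : ℝ) (p : ℝ × ℝ) (θ : ℝ) : rot a (sph (p, θ)) = sph (p, θ + a) := by
  ext i
  fin_cases i <;> simp [rot, sph, Real.cos_add, Real.sin_add] <;> ring

theorem integral_sph_add (h : E3 → ℂ) (p : ℝ × ℝ) (θ : ℝ) :
    ∫ a in Ioo (-Real.pi) Real.pi, h (sph (p, θ + a)) = azInt h p := by
  have hper : Function.Periodic (fun a => h (sph (p, a))) (2 * Real.pi) := by
    intro a
    have : sph (p, a + 2 * Real.pi) = sph (p, a) := by
      ext i
      fin_cases i <;> simp [sph]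
    simp only [this]
  have h1 := hper.intervalIntegral_add_eq (-Real.pi) (θ + -Real.pi)
  rw [show -Real.pi + 2 * Real.pi = Real.pi by ring,
    show θ + -Real.pi + 2 * Real.pi = θ + Real.pi by ring] at h1
  have h2 := intervalIntegral.integral_comp_add_left (a := -Real.pi) (b := Real.pi)
    (fun a => h (sph (p, a))) θ
  rw [azInt, ← integral_Ioc_eq_integral_Ioo, ← integral_Ioc_eq_integral_Ioo,
    ← intervalIntegral.integral_of_le (by linarith [Real.pi_pos]),
    ← intervalIntegral.integral_of_le (by linarith [Real.pi_pos]), h1, ← h2]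

theorem ae_sph {P : E3 → Prop} (h : ∀ᵐ ξ, P ξ) :
    ∀ᵐ q ∂(volume.restrict sphDom), P (sph q) := by
  have h1 := measurePreserving_sph.quasiMeasurePreserving.ae h
  rw [sphMeasure, ae_withDensity_iff (by fun_prop)] at h1
  rw [ae_restrict_iff' measurableSet_sphDom] at h1 ⊢
  filter_upwards [h1] with q hq hm
  refine hq hm ?_
  have : 0 < q.1.1 ^ 2 * Real.sin q.1.2 := mul_pos (pow_pos hm.1.1 2) (sin_pos_of_mem_merid hm.1)
  simpa using this

/-- Invariance holds for each angle off a null set depending on that angle. Fubini exchanges the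
quantifiers: for almost every point the function agrees with almost all its rotations, hence with
its azimuthal average. -/
theorem IsAxisymmetric.ae_sph_eq {h : L2} (hh : IsAxisymmetric h) :
    ∀ᵐ q ∂(volume.restrict sphDom), (2 * Real.pi) • h (sph q) = azInt h q.1 := by
  have h1 : ∀ a : ℝ, ∀ᵐ q ∂(volume.restrict sphDom), h (sph (q.1, q.2 + a)) = h (sph q) := by
    intro a
    filter_upwards [ae_sph (hh a)] with q hq
    rw [← rot_sph]
    exact hq
  have hm : StronglyMeasurable h := Lp.stronglyMeasurable h
  have hmeas : MeasurableSet {z : ((ℝ × ℝ) × ℝ) × ℝ |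
      h (sph (z.1.1, z.1.2 + z.2)) = h (sph z.1)} := by
    refine measurableSet_eq_fun ?_ ?_
    · exact hm.measurable.comp (continuous_sph.measurable.comp (by fun_prop))
    · exact hm.measurable.comp (continuous_sph.measurable.comp (by fun_prop))
  have h2 : ∀ᵐ q ∂(volume.restrict sphDom), ∀ᵐ a ∂(volume.restrict (Ioo (-Real.pi) Real.pi)),
      h (sph (q.1, q.2 + a)) = h (sph q) := by
    have h3 := (Measure.ae_prod_mem_iff_ae_ae_mem
      (μ := (volume.restrict (Ioo (-Real.pi) Real.pi))) (ν := (volume.restrict sphDom))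
      (s := {z : ℝ × ((ℝ × ℝ) × ℝ) | h (sph (z.2.1, z.2.2 + z.1)) = h (sph z.2)})
      (measurable_swap hmeas)).2 (ae_of_all _ h1)
    have h4 := (Measure.measurePreserving_swap (μ := (volume.restrict sphDom))
      (ν := (volume.restrict (Ioo (-Real.pi) Real.pi)))).quasiMeasurePreserving.ae h3
    exact (Measure.ae_prod_mem_iff_ae_ae_mem hmeas).1 h4
  filter_upwards [h2] with q hq
  rw [← integral_sph_add h q.1 q.2, integral_congr_ae hq]
  simp only [integral_const, Complex.real_smul]
  have : (volume.restrict (Ioo (-Real.pi) Real.pi)).real univ = 2 * Real.pi := by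
    rw [measureReal_restrict_apply_univ, Real.volume_real_Ioo_of_le (by linarith [Real.pi_pos])]
    ring
  rw [this]

/-- The set of frequencies whose norm and polar angle lie in `Q`. -/
def polSet (Q : Set (ℝ × ℝ)) : Set E3 := (fun ξ => (‖ξ‖, polAng ξ)) ⁻¹' Q

theorem measurableSet_polSet {Q : Set (ℝ × ℝ)} (hQ : MeasurableSet Q) :
    MeasurableSet (polSet Q) := by
  refine (Measurable.prodMk (by fun_prop) ?_) hQ
  exact Real.continuous_arccos.measurable.comp (by fun_prop)

/-- Cauchy-Schwarz in the azimuth and again on Q; the lower bound m on the Jacobian converts dρ dφ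
dθ into Lebesgue measure on the space. -/
theorem sq_lintegral_azInt_le {h : E3 → ℂ} (hh : StronglyMeasurable h) {Q : Set (ℝ × ℝ)}
    (hQ : MeasurableSet Q) (hQm : Q ⊆ merid) {m : ℝ} (hm : 0 < m)
    (hlow : ∀ p ∈ Q, m ≤ p.1 ^ 2 * Real.sin p.2) :
    (∫⁻ p in Q, ‖azInt h p‖ₑ) ^ 2 ≤
      volume Q * ENNReal.ofReal (2 * Real.pi / m) * ∫⁻ ξ in polSet Q, ‖h ξ‖ₑ ^ 2 := by
  have hmeas : Measurable fun q : (ℝ × ℝ) × ℝ => ‖h (sph q)‖ₑ ^ 2 :=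
    ((hh.measurable.comp continuous_sph.measurable).enorm).pow_const 2
  have h1 : ∀ p, ‖azInt h p‖ₑ ^ 2 ≤
      ENNReal.ofReal (2 * Real.pi) * ∫⁻ θ in Ioo (-Real.pi) Real.pi, ‖h (sph (p, θ))‖ₑ ^ 2 := by
    intro p
    have e : Measurable fun θ : ℝ => ‖h (sph (p, θ))‖ₑ :=
      (hh.measurable.comp (continuous_sph.measurable.comp (by fun_prop))).enorm
    refine (pow_le_pow_left' (enorm_integral_le_lintegral_enorm _) 2).trans
      ((sq_lintegral_le _ e.aemeasurable).trans ?_)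
    rw [Measure.restrict_apply_univ, Real.volume_Ioo]
    gcongr
    linarith
  refine (sq_lintegral_le _ (stronglyMeasurable_azInt hh).measurable.enorm.aemeasurable).trans ?_
  rw [Measure.restrict_apply_univ, mul_assoc]
  gcongr
  calc ∫⁻ p in Q, ‖azInt h p‖ₑ ^ 2
      ≤ ∫⁻ p in Q, ENNReal.ofReal (2 * Real.pi) *
          ∫⁻ θ in Ioo (-Real.pi) Real.pi, ‖h (sph (p, θ))‖ₑ ^ 2 := lintegral_mono fun p => h1 p
    _ = ENNReal.ofReal (2 * Real.pi) *
          ∫⁻ q in Q ×ˢ Ioo (-Real.pi) Real.pi, ‖h (sph q)‖ₑ ^ 2 := by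
        rw [lintegral_const_mul' _ _ ENNReal.ofReal_ne_top, setLIntegral_volume_prod hmeas]
    _ ≤ ENNReal.ofReal (2 * Real.pi) * ∫⁻ q in sphDom, ENNReal.ofReal m⁻¹ *
          (ENNReal.ofReal (q.1.1 ^ 2 * Real.sin q.1.2) *
            (polSet Q).indicator (fun ξ => ‖h ξ‖ₑ ^ 2) (sph q)) := by
        gcongr ENNReal.ofReal _ * ?_
        have hsub : Q ×ˢ Ioo (-Real.pi) Real.pi ⊆ sphDom := prod_mono hQm subset_rfl
        rw [← lintegral_indicator (hQ.prod measurableSet_Ioo),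
          ← lintegral_indicator measurableSet_sphDom]
        refine lintegral_mono fun q => indicator_le (fun q hq => ?_) q
        have hq' := hsub hq
        have hin : sph q ∈ polSet Q := by
          change (‖sph q‖, polAng (sph q)) ∈ Q
          rw [norm_sph (le_of_lt hq'.1.1), polAng_sph hq'.1]
          exact hq.1
        rw [indicator_of_mem hq', indicator_of_mem hin, ← mul_assoc, ← ENNReal.ofReal_mul (by positivity)]
        refine le_mul_of_one_le_left (by positivity) ?_
        rw [ENNReal.one_le_ofReal, ← div_eq_inv_mul, one_le_div hm]
        exact hlow _ hq.1
    _ = _ := by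
        rw [lintegral_const_mul' _ _ ENNReal.ofReal_ne_top, ← lintegral_spherical,
          lintegral_indicator (measurableSet_polSet hQ), ← mul_assoc,
          ← ENNReal.ofReal_mul (by positivity), div_eq_mul_inv]
        exact (hh.measurable.enorm.pow_const 2).indicator (measurableSet_polSet hQ)

/-! ### Operations on weak derivatives -/

/-- Truncation gives globally integrable functions, as mollification requires, without changing weak
derivatives inside Q. -/
theorem WeakDir.indicator {U U' Q : Set (ℝ × ℝ)} {v : ℝ × ℝ} {G H : ℝ × ℝ → ℂ}
    (h : WeakDir U v G H) (hU : U' ⊆ U) (hQ : U' ⊆ Q) :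
    WeakDir U' v (Q.indicator G) (Q.indicator H) := by
  intro ψ hψ hc hs
  have h1 := h ψ hψ hc (hs.trans hU)
  have e1 : ∀ z, ψ z • Q.indicator H z = ψ z • H z := by
    intro z
    by_cases hz : z ∈ tsupport ψ
    · rw [indicator_of_mem (hQ (hs hz))]
    · rw [image_eq_zero_of_notMem_tsupport hz, zero_smul, zero_smul]
  have e2 : ∀ z, fderiv ℝ ψ z v • Q.indicator G z = fderiv ℝ ψ z v • G z := by
    intro z
    by_cases hz : z ∈ tsupport ψ
    · rw [indicator_of_mem (hQ (hs hz))]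
    · have : fderiv ℝ ψ z = 0 := by
        by_contra h
        exact hz (support_fderiv_subset ℝ h)
      simp [this]
  simp_rw [e1, e2]
  exact h1

theorem WeakDir.neg_inv_fst_smul {G H : ℝ × ℝ → ℂ} (h : WeakDir merid (0, 1) G H) :
    WeakDir merid (0, 1) (fun p => -((1 / p.1) • G p)) (fun p => -((1 / p.1) • H p)) := by
  intro ψ hψ hc hs
  have hsub : tsupport (fun p : ℝ × ℝ => ψ p / p.1) ⊆ tsupport ψ := by
    refine closure_mono fun p (hp : ψ p / p.1 ≠ 0) => ?_
    intro h0
    exact hp (by simp [h0])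
  have hss := hsub.trans hs
  have hsm : ContDiff ℝ ∞ fun p : ℝ × ℝ => ψ p / p.1 := by
    refine contDiff_of_tsupport_subset isOpen_merid ?_ hss
    exact hψ.contDiffOn.div contDiff_fst.contDiffOn fun p hp => (ne_of_gt hp.1)
  have hcs : HasCompactSupport fun p : ℝ × ℝ => ψ p / p.1 := by
    refine HasCompactSupport.intro hc.isCompact fun p hp => ?_
    simp [image_eq_zero_of_notMem_tsupport hp]
  have h1 := h _ hsm hcs hss
  have e : ∀ z, fderiv ℝ (fun p : ℝ × ℝ => ψ p / p.1) z (0, 1) = fderiv ℝ ψ z (0, 1) / z.1 := by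
    intro z
    by_cases hz : z ∈ tsupport ψ
    · have hz0 : z.1 ≠ 0 := ne_of_gt (hs hz).1
      have a1 := (hψ.differentiable (by simp) z).hasFDerivAt
      have a2 := (hasDerivAt_inv hz0).comp_hasFDerivAt z (hasFDerivAt_fst (𝕜 := ℝ) (p := z))
      have a3 : fderiv ℝ (fun p : ℝ × ℝ => ψ p / p.1) z = _ := (a1.mul a2).fderiv
      rw [a3]
      simp
      field_simp
    · have b1 : fderiv ℝ ψ z = 0 := by
        by_contra h
        exact hz (support_fderiv_subset ℝ h)
      have b2 : fderiv ℝ (fun p : ℝ × ℝ => ψ p / p.1) z = 0 := by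
        by_contra h
        exact hz (hsub (support_fderiv_subset ℝ h))
      simp [b1, b2]
  have e1 : ∀ z, ψ z • -((1 / z.1) • H z) = -((ψ z / z.1) • H z) := by
    intro z
    rw [smul_neg, smul_smul, mul_one_div]
  have e2 : ∀ z, fderiv ℝ ψ z (0, 1) • -((1 / z.1) • G z) =
      -(fderiv ℝ (fun p : ℝ × ℝ => ψ p / p.1) z (0, 1) • G z) := by
    intro z
    rw [e, smul_neg, smul_smul, mul_one_div]
  simp_rw [e1, e2, integral_neg, h1]

/-! ### Pointwise bounds on rectangles in the meridian plane -/

/-- One rectangle at radius ρ₀ and angular scale τ. Its area is ≲ ρ₀τ and the Jacobian is ≳ ρ₀²τ, so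
L¹ norms are bounded by ρ₀^{-1/2} times L² norms, uniformly in τ. The terms without ∂_φ are divided
by the window length d - c ≥ δτ, which the factor τ in `hAh` and `hAk` compensates; the terms with
∂_φ need no gain. -/
theorem azInt_rect_bound {h k w wk : L2} (w1 : WeakDir merid (1, 0) (azInt h)
      (fun p => -((1 / p.1) • azInt k p)))
    (w2 : WeakDir merid (0, 1) (azInt h) (azInt w)) (w12 : WeakDir merid (0, 1) (azInt k) (azInt wk))
    {ρ₀ τ η δ κ M α β a b c d ε : ℝ} {D : ℝ≥0∞} (hρ₀ : 0 < ρ₀) (hτ : 0 < τ) (hη : 0 < η)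
    (hδ : 0 < δ) (hκ : 0 < κ) (hM : 0 < M) (hα : 0 ≤ α) (hβ : 0 ≤ β) (hε : 0 < ε)
    (hac : a ≤ c) (hdb : d ≤ b) (hcd : δ * τ ≤ d - c) (ha : 0 < a - ε) (hb : b + ε < Real.pi)
    (hρ : ρ₀ / 2 ≤ ρ₀ * (1 - η) - ε)
    (hm : ∀ ρ ∈ Icc (ρ₀ * (1 - η) - ε) (ρ₀ * (1 + η) + ε), ∀ φ ∈ Icc (a - ε) (b + ε),
      κ * ρ₀ ^ 2 * τ ≤ ρ ^ 2 * Real.sin φ)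
    (harea : (2 * η * ρ₀ + 2 * ε) * (b - a + 2 * ε) ≤ M * ρ₀ * τ)
    (hAh : ∫⁻ ξ in polSet (Icc (ρ₀ * (1 - η) - ε) (ρ₀ * (1 + η) + ε) ×ˢ Icc (c - ε) (d + ε)),
      ‖h ξ‖ₑ ^ 2 ≤ (ENNReal.ofReal (α * τ) * D) ^ 2)
    (hAk : ∫⁻ ξ in polSet (Icc (ρ₀ * (1 - η) - ε) (ρ₀ * (1 + η) + ε) ×ˢ Icc (c - ε) (d + ε)),
      ‖k ξ‖ₑ ^ 2 ≤ (ENNReal.ofReal (α * τ) * D) ^ 2)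
    (hAw : ‖w‖ₑ ≤ ENNReal.ofReal β * D) (hAwk : ‖wk‖ₑ ≤ ENNReal.ofReal β * D) :
    ∀ᵐ z : ℝ × ℝ, z ∈ Icc (ρ₀ * (1 - η)) (ρ₀ * (1 + η)) ×ˢ Icc a b →
      ‖azInt h z‖ₑ ≤ ENNReal.ofReal (√(2 * Real.pi * M / κ) *
        (α / δ + β + 4 * η * α / δ + 4 * η * β) / (2 * η) / (ρ₀ * √ρ₀)) * D := by
  set s₁ := ρ₀ * (1 - η) with hs₁
  set s₂ := ρ₀ * (1 + η) with hs₂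
  set R : Set (ℝ × ℝ) := Icc (s₁ - ε) (s₂ + ε) ×ˢ Icc (a - ε) (b + ε) with hR
  set W : Set (ℝ × ℝ) := Icc (s₁ - ε) (s₂ + ε) ×ˢ Icc (c - ε) (d + ε) with hW
  have hWR : W ⊆ R := prod_mono subset_rfl (Icc_subset_Icc (by linarith) (by linarith))
  have hRm : R ⊆ merid := by
    rintro ⟨ρ, φ⟩ ⟨h1, h2⟩
    simp only [mem_Icc] at h1 h2
    refine ⟨?_, ?_, ?_⟩ <;> simp only [mem_Ioi] <;> linarith
  have hRmeas : MeasurableSet R := measurableSet_Icc.prod measurableSet_Icc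
  have hWmeas : MeasurableSet W := measurableSet_Icc.prod measurableSet_Icc
  have hRlow : ∀ p ∈ R, κ * ρ₀ ^ 2 * τ ≤ p.1 ^ 2 * Real.sin p.2 := fun p hp =>
    hm p.1 hp.1 p.2 hp.2
  have hmpos : 0 < κ * ρ₀ ^ 2 * τ := by positivity
  have hδτ : 0 < δ * τ := by positivity
  have hlen : s₂ + ε - (s₁ - ε) = 2 * η * ρ₀ + 2 * ε := by rw [hs₁, hs₂]; ring
  have hvR : volume R ≤ ENNReal.ofReal (M * ρ₀ * τ) := by
    rw [hR, Measure.volume_eq_prod, Measure.prod_prod, Real.volume_Icc, Real.volume_Icc,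
      ← ENNReal.ofReal_mul (by rw [hlen]; positivity), hlen]
    refine ENNReal.ofReal_le_ofReal (le_trans (le_of_eq ?_) harea)
    ring
  have hvW : volume W ≤ ENNReal.ofReal (M * ρ₀ * τ) := (measure_mono hWR).trans hvR
  -- The square root of area bound times 2π over the Jacobian bound; τ cancels.
  set e : ℝ := √(2 * Real.pi * M / κ) / √ρ₀ with he
  have he0 : 0 ≤ e := by positivity
  have hesq : e ^ 2 = M * ρ₀ * τ * (2 * Real.pi / (κ * ρ₀ ^ 2 * τ)) := by
    rw [he, div_pow, Real.sq_sqrt (by positivity), Real.sq_sqrt hρ₀.le]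
    field_simp
  have bound : ∀ (g : L2) {Q : Set (ℝ × ℝ)} {X : ℝ≥0∞}, MeasurableSet Q → Q ⊆ R →
      ∫⁻ ξ in polSet Q, ‖g ξ‖ₑ ^ 2 ≤ X ^ 2 →
      ∫⁻ p in Q, ‖azInt g p‖ₑ ≤ ENNReal.ofReal e * X := by
    intro g Q X hQ hQR hX
    refine (ENNReal.pow_le_pow_left_iff two_ne_zero).1 ((sq_lintegral_azInt_le (Lp.stronglyMeasurable g) hQ
      (hQR.trans hRm) hmpos fun p hp => hRlow p (hQR hp)).trans ?_)
    rw [mul_pow, ← ENNReal.ofReal_pow he0, hesq, ENNReal.ofReal_mul (by positivity)]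
    gcongr
    exact (measure_mono hQR).trans hvR
  have hnorm : ∀ (g : L2) (Q : Set (ℝ × ℝ)), ∫⁻ ξ in polSet Q, ‖g ξ‖ₑ ^ 2 ≤ ‖g‖ₑ ^ 2 := by
    intro g Q
    rw [← lintegral_enorm_sq_L2 g]
    exact setLIntegral_le_lintegral _ _
  have hint : ∀ g : L2, IntegrableOn (azInt g) R := by
    intro g
    refine ⟨(stronglyMeasurable_azInt (Lp.stronglyMeasurable g)).aestronglyMeasurable, ?_⟩
    exact (bound g hRmeas subset_rfl (hnorm g R)).trans_lt
      (ENNReal.mul_lt_top ENNReal.ofReal_lt_top enorm_lt_top)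
  have hdiv : ∀ g : L2, ∀ p ∈ R, ‖-((1 / p.1) • azInt g p)‖ₑ ≤
      ENNReal.ofReal (2 / ρ₀) * ‖azInt g p‖ₑ := by
    intro g p hp
    have h1 : ρ₀ / 2 ≤ p.1 := hρ.trans hp.1.1
    rw [enorm_neg, enorm_smul]
    gcongr
    rw [Real.enorm_eq_ofReal (by have : 0 < p.1 := hRm hp |>.1
                                 positivity)]
    refine ENNReal.ofReal_le_ofReal ?_
    rw [div_le_div_iff₀ (by linarith) hρ₀]
    linarith
  have hint' : ∀ g : L2, IntegrableOn (fun p => -((1 / p.1) • azInt g p)) R := by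
    intro g
    have hm' : StronglyMeasurable fun p : ℝ × ℝ => -((1 / p.1) • azInt g p) :=
      ((by fun_prop : Measurable fun p : ℝ × ℝ => 1 / p.1).stronglyMeasurable.smul
        (stronglyMeasurable_azInt (Lp.stronglyMeasurable g))).neg
    refine ⟨hm'.aestronglyMeasurable, ?_⟩
    refine (setLIntegral_mono' hRmeas (hdiv g)).trans_lt ?_
    rw [lintegral_const_mul' _ _ ENNReal.ofReal_ne_top]
    exact ENNReal.mul_lt_top ENNReal.ofReal_lt_top (hint g).2
  set U : Set (ℝ × ℝ) := Ioo (s₁ - ε) (s₂ + ε) ×ˢ Ioo (a - ε) (b + ε) with hU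
  have hUR : U ⊆ R := prod_mono Ioo_subset_Icc_self Ioo_subset_Icc_self
  have main := rectangle_sobolev (s₁ := s₁) (s₂ := s₂) (a := a) (b := b) (c := c) (d := d) hε
    (Icc_subset_Icc hac hdb)
    ((integrable_indicator_iff hRmeas).2 (hint h)) ((integrable_indicator_iff hRmeas).2 (hint' k))
    ((integrable_indicator_iff hRmeas).2 (hint w)) ((integrable_indicator_iff hRmeas).2 (hint' wk))
    (w1.indicator (hUR.trans hRm) hUR) (w2.indicator (hUR.trans hRm) hUR)
    (w12.neg_inv_fst_smul.indicator (hUR.trans hRm) hUR)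
  filter_upwards [main] with z hz hzm
  have hzR : z ∈ R := ⟨Icc_subset_Icc (by linarith) (by linarith) hzm.1,
    Icc_subset_Icc (by linarith) (by linarith) hzm.2⟩
  have hz' := hz hzm
  rw [indicator_of_mem hzR] at hz'
  have strip : ∀ {Q : Set (ℝ × ℝ)} (F : ℝ × ℝ → ℂ), MeasurableSet Q → Q ⊆ R →
      ∫⁻ p in Q, ‖R.indicator F p‖ₑ = ∫⁻ p in Q, ‖F p‖ₑ := by
    intro Q F hQ hQR
    refine setLIntegral_congr_fun hQ fun p hp => ?_
    simp only [indicator_of_mem (hQR hp)]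
  rw [← hW, ← hR, strip _ hWmeas hWR, strip _ hRmeas subset_rfl, strip _ hWmeas hWR,
    strip _ hRmeas subset_rfl, Real.volume_Icc, Real.volume_Icc] at hz'
  have t1 := bound h hWmeas hWR hAh
  have t2 := bound w hRmeas subset_rfl ((hnorm w R).trans (pow_le_pow_left' hAw 2))
  have t3 : ∫⁻ p in W, ‖-((1 / p.1) • azInt k p)‖ₑ ≤ ENNReal.ofReal (2 / ρ₀) *
      (ENNReal.ofReal e * (ENNReal.ofReal (α * τ) * D)) := by
    refine (setLIntegral_mono' hWmeas fun p hp => hdiv k p (hWR hp)).trans ?_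
    rw [lintegral_const_mul' _ _ ENNReal.ofReal_ne_top]
    gcongr
    exact bound k hWmeas hWR hAk
  have t4 : ∫⁻ p in R, ‖-((1 / p.1) • azInt wk p)‖ₑ ≤ ENNReal.ofReal (2 / ρ₀) *
      (ENNReal.ofReal e * (ENNReal.ofReal β * D)) := by
    refine (setLIntegral_mono' hRmeas fun p hp => hdiv wk p hp).trans ?_
    rw [lintegral_const_mul' _ _ ENNReal.ofReal_ne_top]
    gcongr
    exact bound wk hRmeas subset_rfl ((hnorm wk R).trans (pow_le_pow_left' hAwk 2))
  have hs : s₂ - s₁ = 2 * η * ρ₀ := by rw [hs₁, hs₂]; ring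
  rw [hs] at hz'
  have hdc : 0 < d - c := hδτ.trans_le hcd
  set l := d - c with hl
  have hfin : ENNReal.ofReal (2 * η * ρ₀ * l) * ‖azInt h z‖ₑ ≤
      ENNReal.ofReal (e * (α * τ) + l * (e * β) + 2 * η * ρ₀ * (2 / ρ₀ * (e * (α * τ))) +
        2 * η * ρ₀ * l * (2 / ρ₀ * (e * β))) * D := by
    rw [ENNReal.ofReal_mul (by positivity)]
    refine hz'.trans ?_
    refine (add_le_add (add_le_add (add_le_add t1 (mul_le_mul_right t2 _))
      (mul_le_mul_right t3 _)) (mul_le_mul_right t4 _)).trans (le_of_eq ?_)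
    rw [ENNReal.ofReal_add (by positivity) (by positivity),
      ENNReal.ofReal_add (by positivity) (by positivity),
      ENNReal.ofReal_add (by positivity) (by positivity)]
    simp only [add_mul]
    congr 1
    · congr 1
      · congr 1
        · rw [ENNReal.ofReal_mul (p := e) he0, mul_assoc]
        · rw [ENNReal.ofReal_mul (p := l) hdc.le, ENNReal.ofReal_mul (p := e) he0]
          ring
      · rw [ENNReal.ofReal_mul (p := 2 * η * ρ₀) (by positivity),
          ENNReal.ofReal_mul (p := 2 / ρ₀) (by positivity), ENNReal.ofReal_mul (p := e) he0]
        ring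
    · rw [ENNReal.ofReal_mul (p := 2 * η * ρ₀ * l) (by positivity),
        ENNReal.ofReal_mul (p := 2 / ρ₀) (by positivity), ENNReal.ofReal_mul (p := e) he0,
        ENNReal.ofReal_mul (p := 2 * η * ρ₀) (by positivity)]
      ring
  have hpos : 0 < 2 * η * ρ₀ * l := by positivity
  have hfin2 : ‖azInt h z‖ₑ ≤ ENNReal.ofReal ((2 * η * ρ₀ * l)⁻¹ *
      (e * (α * τ) + l * (e * β) + 2 * η * ρ₀ * (2 / ρ₀ * (e * (α * τ))) +
        2 * η * ρ₀ * l * (2 / ρ₀ * (e * β)))) * D := by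
    calc ‖azInt h z‖ₑ = ENNReal.ofReal ((2 * η * ρ₀ * l)⁻¹) *
          (ENNReal.ofReal (2 * η * ρ₀ * l) * ‖azInt h z‖ₑ) := by
          rw [← mul_assoc, ← ENNReal.ofReal_mul (by positivity), inv_mul_cancel₀ hpos.ne',
            ENNReal.ofReal_one, one_mul]
      _ ≤ _ := mul_le_mul_right hfin _
      _ = _ := by rw [← mul_assoc, ← ENNReal.ofReal_mul (by positivity)]
  refine hfin2.trans ?_
  gcongr
  -- The only place where the angular gain is spent.
  have hτl : τ / l ≤ 1 / δ := by
    rw [div_le_div_iff₀ hdc hδ]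
    linarith
  have e1 : (2 * η * ρ₀ * l)⁻¹ *
      (e * (α * τ) + l * (e * β) + 2 * η * ρ₀ * (2 / ρ₀ * (e * (α * τ))) +
        2 * η * ρ₀ * l * (2 / ρ₀ * (e * β))) =
      e / (2 * η * ρ₀) * (α * (τ / l) + β + 4 * η * α * (τ / l) + 4 * η * β) := by
    field_simp
    ring
  have e2 : √(2 * Real.pi * M / κ) *
        (α / δ + β + 4 * η * α / δ + 4 * η * β) / (2 * η) / (ρ₀ * √ρ₀) =
      e / (2 * η * ρ₀) * (α * (1 / δ) + β + 4 * η * α * (1 / δ) + 4 * η * β) := by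
    rw [he]
    field_simp
  rw [e1, e2]
  gcongr

/-! ### Frequency windows on which the symbols are bounded below -/

theorem RadialBump.phi_neg (χ : RadialBump) (x : ℝ) : χ.phi (-x) = χ.phi x := by
  rw [RadialBump.phi, RadialBump.phi, χ.even, neg_div, χ.even]

theorem RadialBump.phi_abs (χ : RadialBump) (x : ℝ) : χ.phi |x| = χ.phi x := by
  rcases abs_choice x with h | h <;> rw [h]
  exact χ.phi_neg x

theorem RadialBump.contDiff_phi (χ : RadialBump) : ContDiff ℝ ∞ χ.phi :=
  χ.smooth.sub (χ.smooth.comp (contDiff_id.div_const 2))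

theorem RadialBump.phi_eq_zero_of_le (χ : RadialBump) {x : ℝ} (h : |x| ≤ 1) : χ.phi x = 0 := by
  rw [RadialBump.phi, χ.eq_one x h, χ.eq_one (x / 2) (by rw [abs_div, abs_two]; linarith), sub_self]

theorem RadialBump.phi_eq_zero_of_ge (χ : RadialBump) {x : ℝ} (h : 4 ≤ |x|) : χ.phi x = 0 := by
  rw [RadialBump.phi, χ.eq_zero x (by linarith),
    χ.eq_zero (x / 2) (by rw [abs_div, abs_two]; linarith), sub_self]

theorem RadialBump.phi_two (χ : RadialBump) : χ.phi 2 = -1 := by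
  rw [RadialBump.phi, χ.eq_zero 2 (by norm_num), χ.eq_one (2 / 2) (by norm_num)]
  norm_num

/-- Normalize to u in [1, 2). There φ(u) = χ(u) - 1 and φ(2u) = -χ(u), so one of the two has modulus
at least 1/2. -/
theorem RadialBump.exists_phi_ge (χ : RadialBump) {y : ℝ} (hy : 0 < y) :
    ∃ k : ℤ, 1 ≤ (2 : ℝ) ^ (-k) * y ∧ (2 : ℝ) ^ (-k) * y ≤ 4 ∧ 1 / 2 ≤ |χ.phi ((2 : ℝ) ^ (-k) * y)| := by
  obtain ⟨n, h1, h2⟩ := exists_mem_Ico_zpow hy (one_lt_two (α := ℝ))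
  have hn : (0 : ℝ) < 2 ^ n := by positivity
  set u := (2 : ℝ) ^ (-n) * y with hu
  have hyu : y = 2 ^ n * u := by
    rw [hu, zpow_neg, mul_inv_cancel_left₀ hn.ne']
  rw [zpow_add₀ two_ne_zero, zpow_one] at h2
  have u1 : 1 ≤ u := by
    by_contra h
    nlinarith
  have u2 : u < 2 := by
    by_contra h
    nlinarith
  have e1 : χ.phi u = χ.toFun u - 1 := by
    rw [RadialBump.phi, χ.eq_one (u / 2) (by rw [abs_of_nonneg (by linarith)]; linarith)]
  have e2 : χ.phi (2 * u) = -χ.toFun u := by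
    rw [RadialBump.phi, χ.eq_zero (2 * u) (by rw [abs_of_nonneg (by linarith)]; linarith),
      mul_div_cancel_left₀ _ two_ne_zero, zero_sub]
  by_cases h : χ.toFun u ≤ 1 / 2
  · refine ⟨n, u1, by linarith, ?_⟩
    rw [← hu, e1, abs_of_nonpos (by linarith)]
    linarith
  · refine ⟨n - 1, ?_⟩
    have e3 : (2 : ℝ) ^ (-(n - 1)) * y = 2 * u := by
      rw [hu, neg_sub, sub_eq_add_neg, zpow_add₀ two_ne_zero, zpow_one]
      ring
    rw [e3, e2, abs_neg]
    exact ⟨by linarith, by linarith, by linarith [le_abs_self (χ.toFun u)]⟩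

theorem RadialBump.uniform_phi (χ : RadialBump) :
    ∃ σ : ℝ, 0 < σ ∧ σ ≤ 1 ∧ ∀ x y, |x - y| ≤ σ → |χ.phi x - χ.phi y| ≤ 1 / 4 := by
  have hc : HasCompactSupport χ.phi := by
    refine HasCompactSupport.intro (isCompact_Icc (a := (-4 : ℝ)) (b := 4)) fun x hx => ?_
    refine χ.phi_eq_zero_of_ge ?_
    by_contra h
    rw [not_le, abs_lt] at h
    exact hx ⟨h.1.le, h.2.le⟩
  have hu := χ.contDiff_phi.continuous.uniformContinuous_of_tendsto_cocompact hc.is_zero_at_infty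
  obtain ⟨δ, hδ, h⟩ := Metric.uniformContinuous_iff.1 hu (1 / 4) (by norm_num)
  refine ⟨min (δ / 2) 1, by positivity, min_le_right _ _, fun x y hxy => ?_⟩
  have := h (a := x) (b := y) (by
    rw [Real.dist_eq]
    exact hxy.trans_lt ((min_le_left _ _).trans_lt (by linarith)))
  rw [Real.dist_eq] at this
  exact this.le

theorem norm_projSymbol (χ : RadialBump) (k p q : ℤ) (ξ : E3) :
    ‖projSymbol χ k p q ((2 * Real.pi) • ξ)‖ =
      |χ.phi ((2 : ℝ) ^ (-k) * (2 * Real.pi * ‖ξ‖))| *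
      |χ.phi (((2 : ℝ) ^ (-k) * (2 * Real.pi * ‖ξ‖) * Real.sin (polAng ξ) * 2 ^ (-p)) ^ 2)| *
      |χ.phi ((2 : ℝ) ^ (-q) * ((2 : ℝ) ^ (-k) * (2 * Real.pi * ‖ξ‖) * Real.cos (polAng ξ)))| := by
  have hπ := Real.pi_pos
  rw [projSymbol, Complex.norm_real, norm_mul, norm_mul, Real.norm_eq_abs, Real.norm_eq_abs,
    Real.norm_eq_abs]
  have e1 : ‖(2 * Real.pi) • ξ‖ = 2 * Real.pi * ‖ξ‖ := by
    rw [norm_smul, Real.norm_of_nonneg (by positivity)]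
  have e2 : ((2 * Real.pi) • ξ) 0 ^ 2 + ((2 * Real.pi) • ξ) 1 ^ 2 =
      (2 * Real.pi * (‖ξ‖ * Real.sin (polAng ξ))) ^ 2 := by
    rw [← axisDist_eq_norm_mul_sin, mul_pow, axisDist_sq]
    simp
    ring
  have e3 : ((2 * Real.pi) • ξ) 2 = 2 * Real.pi * (‖ξ‖ * Real.cos (polAng ξ)) := by
    rcases eq_or_ne ξ 0 with rfl | h
    · simp
    have h0 := norm_pos_iff.2 h
    have h1 := abs_coord_le ξ 2
    rw [polAng, Real.cos_arccos, mul_div_cancel₀ _ h0.ne']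
    · simp
    · rw [le_div_iff₀ h0]; linarith [(abs_le.1 h1).1]
    · rw [div_le_one h0]; linarith [(abs_le.1 h1).2]
  rw [e1, e2, e3]
  congr 2
  · congr 2
    rw [show -2 * (p + k) = -p + -p + (-k + -k) by ring, zpow_add₀ two_ne_zero,
      zpow_add₀ two_ne_zero, zpow_add₀ two_ne_zero]
    ring
  · rw [show -q - k = -q + -k by ring, zpow_add₀ two_ne_zero]
    ring_nf

/-- Here X is the normalized radius and P the horizontal dyadic scale. The angle √2 P/x₀ makes the
argument of the horizontal cutoff close to 2, where `phi` equals -1. As that angle is small, cos is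
close to 1, so the vertical argument for q = 0 is close to x₀, like the radial one. -/
theorem window_arith {η x₀ P X φ : ℝ} (hη0 : 0 < η) (hη1 : η ≤ 1 / 1000) (hx1 : 1 ≤ x₀)
    (hx4 : x₀ ≤ 4) (hP0 : 0 < P) (hPη : P ≤ η) (hX1 : x₀ * (1 - 2 * η) ≤ X)
    (hX2 : X ≤ x₀ * (1 + 2 * η)) (hφ1 : √2 * P / x₀ * (1 - 2 * η) ≤ φ)
    (hφ2 : φ ≤ √2 * P / x₀ * (1 + 2 * η)) :
    0 < X ∧ |X - x₀| ≤ 1000 * η ∧ |(X * Real.sin φ * P⁻¹) ^ 2 - 2| ≤ 1000 * η ∧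
      |X * |Real.cos φ| - x₀| ≤ 1000 * η := by
  have hx₀ : 0 < x₀ := by linarith
  have hη2 : η ^ 2 ≤ η / 1000 := by nlinarith
  have hxη : x₀ * η ≤ 4 * η := by gcongr
  have hxη' : η ≤ x₀ * η := le_mul_of_one_le_left hη0.le hx1
  have hX0 : 0 < X := lt_of_lt_of_le (mul_pos hx₀ (by linarith)) hX1
  have hs2 : √2 ^ 2 = 2 := Real.sq_sqrt (by norm_num)
  have hs2' : 0 < √2 := by positivity
  have hs3 : √2 ≤ 3 / 2 := by nlinarith
  set φs := √2 * P / x₀ with hφs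
  have hφs0 : 0 < φs := by positivity
  have hφs1 : φs ≤ 3 / 2 * η := by
    rw [hφs, div_le_iff₀ hx₀]
    calc √2 * P ≤ 3 / 2 * η := by gcongr
      _ ≤ 3 / 2 * η * x₀ := le_mul_of_one_le_right (by positivity) hx1
  have hφ0 : 0 < φ := lt_of_lt_of_le (mul_pos hφs0 (by linarith)) hφ1
  have hφ3 : φ ≤ 3 * η := by
    calc φ ≤ φs * (1 + 2 * η) := hφ2
      _ ≤ 3 / 2 * η * 2 := by gcongr; linarith
      _ = 3 * η := by ring
  have hφsq : φ ^ 2 ≤ η / 100 := by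
    calc φ ^ 2 ≤ (3 * η) ^ 2 := by gcongr
      _ ≤ η / 100 := by rw [mul_pow]; linarith
  have hsl := Real.sin_lt hφ0
  have hsin : φ * (1 - η) ≤ Real.sin φ := by
    refine le_trans ?_ (Real.sin_gt_sub_cube hφ0).le
    have : 0 ≤ φ * (η - φ ^ 2 / 6) := mul_nonneg hφ0.le (by linarith)
    linarith
  have hcos : 1 - η ≤ Real.cos φ := by
    have := Real.one_sub_sq_div_two_le_cos (x := φ)
    linarith
  have hcos0 : |Real.cos φ| = Real.cos φ := abs_of_nonneg (by linarith)
  have hcos1 := Real.cos_le_one φ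
  set T := X * Real.sin φ * P⁻¹ with hT
  have hT1 : √2 * ((1 - 2 * η) * (1 - 2 * η) * (1 - η)) ≤ T := by
    have : x₀ * (1 - 2 * η) * (φs * (1 - 2 * η) * (1 - η)) ≤ X * Real.sin φ := by
      refine mul_le_mul hX1 (le_trans ?_ hsin) ?_ hX0.le
      · exact mul_le_mul_of_nonneg_right hφ1 (by linarith)
      · exact mul_nonneg (mul_nonneg hφs0.le (by linarith)) (by linarith)
    rw [hT, ← div_eq_mul_inv, le_div_iff₀ hP0]
    refine le_trans (le_of_eq ?_) this
    rw [hφs]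
    field_simp
  have hT2 : T ≤ √2 * ((1 + 2 * η) * (1 + 2 * η)) := by
    have : X * Real.sin φ ≤ x₀ * (1 + 2 * η) * (φs * (1 + 2 * η)) := by
      refine mul_le_mul hX2 (hsl.le.trans hφ2) ?_ (by positivity)
      exact le_trans (mul_nonneg hφ0.le (by linarith)) hsin
    rw [hT, ← div_eq_mul_inv, div_le_iff₀ hP0]
    refine this.trans (le_of_eq ?_)
    rw [hφs]
    field_simp
  have hη4 : 0 ≤ η ^ 2 := sq_nonneg η
  have hη3 : η ^ 3 ≤ η ^ 2 := by
    rw [pow_succ]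
    exact mul_le_of_le_one_right (by positivity) (by linarith)
  have hT1' : √2 * (1 - 6 * η) ≤ T := le_trans (by gcongr; ring_nf; linarith) hT1
  have hT2' : T ≤ √2 * (1 + 6 * η) := hT2.trans (by gcongr; ring_nf; linarith)
  have hT0 : 0 ≤ √2 * (1 - 6 * η) := mul_nonneg hs2'.le (by linarith)
  refine ⟨hX0, ?_, ?_, ?_⟩
  · rw [abs_le]
    constructor <;> linarith
  · have a1 : (√2 * (1 - 6 * η)) ^ 2 ≤ T ^ 2 := pow_le_pow_left₀ hT0 hT1' 2
    have a2 : T ^ 2 ≤ (√2 * (1 + 6 * η)) ^ 2 := pow_le_pow_left₀ (hT0.trans hT1') hT2' 2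
    rw [mul_pow √2, hs2] at a1 a2
    rw [abs_le]
    constructor <;> linarith
  · rw [hcos0]
    have h1 : X * (1 - η) ≤ X * Real.cos φ := mul_le_mul_of_nonneg_left hcos hX0.le
    have h2 : X * Real.cos φ ≤ X := mul_le_of_le_one_right hX0.le hcos1
    have h3 : X * η ≤ 8 * η := by
      gcongr
      nlinarith
    rw [abs_le]
    constructor <;> linarith

/-- The same value x₀, at which `phi` has modulus at least 1/2, serves the radial and the vertical
factor. By uniform continuity the three factors stay above 1/4, 1/2 and 1/4 in modulus, whence 1/32.
The shift by N forces small angles even for p = 0, so that q = 0 is always the right vertical index.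
-/
theorem RadialBump.window (χ : RadialBump) : ∃ (N : ℕ) (η : ℝ), 2 ≤ N ∧ 0 < η ∧ η ≤ 1 / 4 ∧
    ∀ ρ₀ : ℝ, 0 < ρ₀ → ∃ (k : ℤ) (x₀ : ℝ), 1 ≤ x₀ ∧ x₀ ≤ 4 ∧ ∀ p : ℤ, p ≤ 0 → ∀ ξ : E3,
      ‖ξ‖ ∈ Icc (ρ₀ * (1 - 2 * η)) (ρ₀ * (1 + 2 * η)) →
      (∃ φ ∈ Icc (√2 * 2 ^ (p - N) / x₀ * (1 - 2 * η)) (√2 * 2 ^ (p - N) / x₀ * (1 + 2 * η)),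
        polAng ξ = φ ∨ polAng ξ = Real.pi - φ) →
      1 / 32 ≤ ‖projSymbol χ k (p - N) 0 ((2 * Real.pi) • ξ)‖ := by
  obtain ⟨σ, hσ, hσ1, hu⟩ := χ.uniform_phi
  obtain ⟨N, hN⟩ := exists_pow_lt_of_lt_one (show 0 < σ / 1000 by positivity)
    (show (1 / 2 : ℝ) < 1 by norm_num)
  have hN2 : 2 ≤ N := by
    by_contra h
    have : (1 / 2 : ℝ) ^ 1 ≤ (1 / 2) ^ N :=
      pow_le_pow_of_le_one (by norm_num) (by norm_num) (by omega)
    linarith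
  -- The denominator matches the tolerance 1000η of `window_arith` with the modulus of continuity σ;
  -- N was chosen so that P ≤ η.
  refine ⟨N, σ / 1000, hN2, by positivity, by linarith, fun ρ₀ hρ₀ => ?_⟩
  have hπ := Real.pi_pos
  obtain ⟨k, hx1, hx4, hk⟩ := χ.exists_phi_ge (show 0 < 2 * Real.pi * ρ₀ by positivity)
  refine ⟨k, _, hx1, hx4, fun p hp ξ hξ hφ => ?_⟩
  obtain ⟨φ, hφ, hpol⟩ := hφ
  set x₀ := (2 : ℝ) ^ (-k) * (2 * Real.pi * ρ₀) with hx₀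
  set η := σ / 1000 with hη
  set P : ℝ := 2 ^ (p - N) with hP
  have hP0 : 0 < P := by positivity
  have hPη : P ≤ η := by
    refine le_trans ?_ hN.le
    rw [hP, zpow_sub₀ two_ne_zero, zpow_natCast, one_div, inv_pow, ← one_div]
    gcongr
    exact zpow_le_one_of_nonpos₀ (by norm_num) hp
  have hP' : (2 : ℝ) ^ (-(p - N)) = P⁻¹ := by rw [hP, zpow_neg]
  have hcs : Real.sin (polAng ξ) = Real.sin φ ∧ |Real.cos (polAng ξ)| = |Real.cos φ| := by
    rcases hpol with h | h <;> rw [h]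
    · exact ⟨rfl, rfl⟩
    · rw [Real.sin_pi_sub, Real.cos_pi_sub, abs_neg]; exact ⟨rfl, rfl⟩
  set X := (2 : ℝ) ^ (-k) * (2 * Real.pi * ‖ξ‖) with hX
  rw [norm_projSymbol, ← hX, hcs.1, hP', neg_zero, zpow_zero, one_mul,
    ← χ.phi_abs (X * Real.cos (polAng ξ)), abs_mul, hcs.2]
  have hη1 : η ≤ 1 / 1000 := by rw [hη]; linarith
  have hη0 : 0 < η := by positivity
  -- the normalized radius
  have hXr : x₀ * (1 - 2 * η) ≤ X ∧ X ≤ x₀ * (1 + 2 * η) := by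
    have hc : 0 < (2 : ℝ) ^ (-k) * (2 * Real.pi) := by positivity
    have e0 : x₀ = (2 : ℝ) ^ (-k) * (2 * Real.pi) * ρ₀ := by rw [hx₀]; ring
    have e1 : X = (2 : ℝ) ^ (-k) * (2 * Real.pi) * ‖ξ‖ := by rw [hX]; ring
    rw [e0, e1, mul_assoc _ ρ₀, mul_assoc _ ρ₀]
    exact ⟨mul_le_mul_of_nonneg_left hξ.1 hc.le, mul_le_mul_of_nonneg_left hξ.2 hc.le⟩
  obtain ⟨hX0, b1, hTsq, b3⟩ := window_arith hη0 hη1 hx1 hx4 hP0 hPη hXr.1 hXr.2 hφ.1 hφ.2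
  have hση : 1000 * η = σ := by rw [hη]; ring
  rw [hση] at b1 hTsq b3
  set T := X * Real.sin φ * P⁻¹ with hT
  have c1 := hu _ _ b1
  have c2 := hu _ _ hTsq
  have c3 := hu _ _ b3
  rw [χ.phi_two] at c2
  have hX' : |X| = X := abs_of_pos hX0
  have d1 : 1 / 4 ≤ |χ.phi X| := by
    have := abs_sub_abs_le_abs_sub (χ.phi x₀) (χ.phi X)
    rw [abs_sub_comm] at this
    linarith
  have d2 : 1 / 2 ≤ |χ.phi (T ^ 2)| := by
    have := (abs_le.1 c2).2
    have h3 := neg_le_abs (χ.phi (T ^ 2))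
    linarith
  have d3 : 1 / 4 ≤ |χ.phi (X * |Real.cos φ|)| := by
    have := abs_sub_abs_le_abs_sub (χ.phi x₀) (χ.phi (X * |Real.cos φ|))
    rw [abs_sub_comm] at this
    linarith
  rw [hX']
  calc (1 / 32 : ℝ) = 1 / 4 * (1 / 2) * (1 / 4) := by norm_num
    _ ≤ _ := by gcongr

/-! ### Plancherel for the multipliers -/

theorem enorm_fourierMul_sq (m : E3 → ℂ)
    (hm : MemLp (fun ξ : E3 => m ((2 * Real.pi) • ξ)) ⊤ (volume : Measure E3)) (f : L2) :
    ‖fourierMul m hm f‖ₑ ^ 2 = ∫⁻ ξ, ‖m ((2 * Real.pi) • ξ) * (𝓕 f : L2) ξ‖ₑ ^ 2 := by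
  rw [fourierMul]
  set g := (MemLp.mul' (r := 2) (Lp.memLp (𝓕 f)) hm).toLp
    (fun ξ : E3 => m ((2 * Real.pi) • ξ) * (𝓕 f : L2) ξ) with hg
  have h1 : ‖(𝓕⁻ g : L2)‖ = ‖g‖ := by
    rw [← Lp.norm_fourier_eq (𝓕⁻ g), FourierTransform.fourier_fourierInv_eq]
  have h2 : ‖(𝓕⁻ g : L2)‖ₑ = ‖g‖ₑ := by
    rw [← ofReal_norm, h1, ofReal_norm]
  rw [h2, ← lintegral_enorm_sq_L2]
  refine lintegral_congr_ae ?_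
  filter_upwards [MemLp.coeFn_toLp (MemLp.mul' (r := 2) (Lp.memLp (𝓕 f)) hm)] with ξ hξ
  rw [hg, hξ]

/-- By Plancherel, the B norm with q = 0 controls the mass of ĝ wherever the symbol is bounded
below, with the gain 2^p. -/
theorem lintegral_window_le {χ : RadialBump} {k p : ℤ} (hp : p ≤ 0) {S : Set E3}
    (hS : MeasurableSet S) (hlow : ∀ ξ ∈ S, 1 / 32 ≤ ‖projSymbol χ k p 0 ((2 * Real.pi) • ξ)‖)
    (g : L2) :
    ∫⁻ ξ in S, ‖(𝓕 g : L2) ξ‖ₑ ^ 2 ≤ (ENNReal.ofReal (32 * 2 ^ p) * normB χ g) ^ 2 := by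
  have h1 : ENNReal.ofReal ((2 : ℝ) ^ (-p)) * ‖proj χ k p 0 g‖ₑ ≤ normB χ g := by
    have : ENNReal.ofReal ((2 : ℝ) ^ (-(p : ℝ) - ((0 : ℤ) : ℝ) / 2)) * ‖proj χ k p 0 g‖ₑ
        ≤ normB χ g := by
      unfold normB
      exact le_iSup_of_le k (le_iSup_of_le p (le_iSup_of_le 0
        (le_iSup_of_le hp (le_iSup_of_le le_rfl le_rfl))))
    have e : (2 : ℝ) ^ (-(p : ℝ) - ((0 : ℤ) : ℝ) / 2) = (2 : ℝ) ^ (-p) := by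
      rw [← Real.rpow_intCast]
      push_cast
      congr 1
      ring
    rwa [e] at this
  have h2 : ‖proj χ k p 0 g‖ₑ ≤ ENNReal.ofReal (2 ^ p) * normB χ g := by
    calc ‖proj χ k p 0 g‖ₑ = ENNReal.ofReal (2 ^ p) *
          (ENNReal.ofReal ((2 : ℝ) ^ (-p)) * ‖proj χ k p 0 g‖ₑ) := by
          rw [← mul_assoc, ← ENNReal.ofReal_mul (by positivity), ← zpow_add₀ two_ne_zero]
          simp
      _ ≤ _ := mul_le_mul_right h1 _
  calc ∫⁻ ξ in S, ‖(𝓕 g : L2) ξ‖ₑ ^ 2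
      ≤ ∫⁻ ξ in S, ENNReal.ofReal 32 ^ 2 *
          ‖projSymbol χ k p 0 ((2 * Real.pi) • ξ) * (𝓕 g : L2) ξ‖ₑ ^ 2 := by
        refine setLIntegral_mono' hS fun ξ hξ => ?_
        rw [enorm_mul, ← mul_pow, ← mul_assoc]
        gcongr
        refine le_mul_of_one_le_left (by positivity) ?_
        rw [← ofReal_norm, ← ENNReal.ofReal_mul (by norm_num), ENNReal.one_le_ofReal]
        linarith [hlow ξ hξ]
    _ ≤ ENNReal.ofReal 32 ^ 2 * ‖proj χ k p 0 g‖ₑ ^ 2 := by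
        rw [lintegral_const_mul' _ _ (by simp), proj, enorm_fourierMul_sq]
        gcongr
        exact Measure.restrict_le_self
    _ ≤ _ := by
        rw [← mul_pow, ENNReal.ofReal_mul (by norm_num), mul_assoc]
        gcongr

/-! ### The pointwise bound in frequency space -/

theorem rect_arith {ρ₀ τ η ε φs ν : ℝ} (hρ₀ : 0 < ρ₀) (hτ : 0 < τ) (hτ1 : τ ≤ 1)
    (hη1 : η ≤ 1 / 4) (hν : 0 < ν) (hν1 : ν ≤ 1) (hφ1 : τ * ν / 4 ≤ φs) (hφ2 : φs ≤ 3 / 8 * τ)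
    (hε : 0 < ε) (hερ : ε ≤ η * ρ₀) (hεφ : ε ≤ η * φs) :
    φs * (1 + η) ≤ Real.pi / 2 * τ ∧ 0 < φs * (1 - η) - ε ∧ Real.pi / 2 * τ + ε < Real.pi ∧
    ρ₀ / 2 ≤ ρ₀ * (1 - η) - ε ∧
    (∀ ρ ∈ Icc (ρ₀ * (1 - η) - ε) (ρ₀ * (1 + η) + ε),
      ∀ φ ∈ Icc (φs * (1 - η) - ε) (Real.pi / 2 * τ + ε),
      ν / 64 * ρ₀ ^ 2 * τ ≤ ρ ^ 2 * Real.sin φ) ∧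
    (2 * η * ρ₀ + 2 * ε) * (Real.pi / 2 * τ - φs * (1 - η) + 2 * ε) ≤ 4 * ρ₀ * τ := by
  have hπ := Real.pi_gt_three
  have hπ' := Real.pi_lt_d2
  have hφs : 0 < φs := lt_of_lt_of_le (by positivity) hφ1
  have hηφ : η * φs ≤ 1 / 4 * φs := by gcongr
  have hηρ : η * ρ₀ ≤ 1 / 4 * ρ₀ := by gcongr
  have hπτ : 3 * τ ≤ Real.pi * τ := by gcongr
  have hπτ' : Real.pi * τ ≤ 3.15 * τ := by gcongr
  have hρlow : ρ₀ / 2 ≤ ρ₀ * (1 - η) - ε := by linarith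
  have hφlow : φs / 2 ≤ φs * (1 - η) - ε := by linarith
  refine ⟨by linarith, by linarith, by linarith, hρlow, fun ρ hρ φ hφ => ?_, ?_⟩
  · have h1 : ρ₀ / 2 ≤ ρ := hρlow.trans hρ.1
    have h2 : (ρ₀ / 2) ^ 2 ≤ ρ ^ 2 := by gcongr
    have hφ3 : φs / 2 ≤ φ := hφlow.trans hφ.1
    have htv : τ * ν ≤ 1 := mul_le_one₀ hτ1 hν.le hν1
    have h3 : τ * ν / 16 ≤ Real.sin φ := by
      have h2π : 1 / 2 ≤ 2 / Real.pi := by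
        rw [div_le_div_iff₀ two_pos Real.pi_pos]
        linarith
      -- For τ = 1 the enlarged rectangle can cross the equator, so Jordan's inequality is used from
      -- either pole.
      by_cases hc : φ ≤ Real.pi / 2
      · have h4 := Real.mul_le_sin (by linarith) hc
        have h5 : 1 / 2 * φ ≤ 2 / Real.pi * φ := mul_le_mul_of_nonneg_right h2π (by linarith)
        linarith
      · rw [not_le] at hc
        have h4 := Real.mul_le_sin (x := Real.pi - φ) (by linarith [hφ.2]) (by linarith)
        have h5 : 1 / 2 * (Real.pi - φ) ≤ 2 / Real.pi * (Real.pi - φ) :=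
          mul_le_mul_of_nonneg_right h2π (by linarith [hφ.2])
        rw [Real.sin_pi_sub] at h4
        linarith [hφ.2]
    calc ν / 64 * ρ₀ ^ 2 * τ = (ρ₀ / 2) ^ 2 * (τ * ν / 16) := by ring
      _ ≤ ρ ^ 2 * Real.sin φ := by gcongr
  · calc (2 * η * ρ₀ + 2 * ε) * (Real.pi / 2 * τ - φs * (1 - η) + 2 * ε)
        ≤ ρ₀ * (4 * τ) := by
          refine mul_le_mul (by linarith) (by linarith) ?_ hρ₀.le
          linarith
      _ = 4 * ρ₀ * τ := by ring

theorem enorm_add_smul_sq_le {S : Set E3} {h h₁ : L2} {X : ℝ≥0∞}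
    (h0 : ∫⁻ ξ in S, ‖h ξ‖ₑ ^ 2 ≤ X ^ 2) (h1 : ∫⁻ ξ in S, ‖h₁ ξ‖ₑ ^ 2 ≤ X ^ 2) :
    ∫⁻ ξ in S, ‖(h₁ + (3 : ℂ) • h : L2) ξ‖ₑ ^ 2 ≤ (5 * X) ^ 2 := by
  have key : ∀ᵐ ξ ∂(volume.restrict S), ‖(h₁ + (3 : ℂ) • h : L2) ξ‖ₑ ^ 2 ≤
      4 * ‖h₁ ξ‖ₑ ^ 2 + 20 * ‖h ξ‖ₑ ^ 2 := by
    refine ae_restrict_of_ae ?_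
    filter_upwards [Lp.coeFn_add h₁ ((3 : ℂ) • h), Lp.coeFn_smul (3 : ℂ) h] with ξ a1 a2
    rw [a1, Pi.add_apply, a2, Pi.smul_apply, ← ofReal_norm, ← ofReal_norm, ← ofReal_norm,
      ← ENNReal.ofReal_pow (norm_nonneg _), ← ENNReal.ofReal_pow (norm_nonneg _),
      ← ENNReal.ofReal_pow (norm_nonneg _), ← ENNReal.ofReal_ofNat 4, ← ENNReal.ofReal_ofNat 20,
      ← ENNReal.ofReal_mul (by norm_num), ← ENNReal.ofReal_mul (by norm_num),
      ← ENNReal.ofReal_add (by positivity) (by positivity)]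
    refine ENNReal.ofReal_le_ofReal ?_
    have h1 := norm_add_le (h₁ ξ) ((3 : ℂ) • h ξ)
    rw [norm_smul] at h1
    have h3 : ‖(3 : ℂ)‖ = 3 := by simp
    rw [h3] at h1
    calc ‖h₁ ξ + (3 : ℂ) • h ξ‖ ^ 2 ≤ (‖h₁ ξ‖ + 3 * ‖h ξ‖) ^ 2 := by gcongr
      _ ≤ _ := by nlinarith [sq_nonneg (‖h₁ ξ‖ - ‖h ξ‖), sq_nonneg (‖h ξ‖), sq_nonneg ‖h₁ ξ‖]
  refine (lintegral_mono_ae key).trans ?_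
  rw [lintegral_add_left' (((Lp.stronglyMeasurable h₁).measurable.enorm.pow_const 2).const_mul
    4).aemeasurable, lintegral_const_mul' _ _ (by simp), lintegral_const_mul' _ _ (by simp)]
  calc 4 * (∫⁻ ξ in S, ‖h₁ ξ‖ₑ ^ 2) + 20 * ∫⁻ ξ in S, ‖h ξ‖ₑ ^ 2 ≤ 4 * X ^ 2 + 20 * X ^ 2 := by
        gcongr
    _ = 24 * X ^ 2 := by ring
    _ ≤ 25 * X ^ 2 := by gcongr; norm_num
    _ = _ := by ring

theorem exists_dyadic_angle {φ : ℝ} (h0 : 0 < φ) (h1 : φ ≤ Real.pi / 2) :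
    ∃ n : ℕ, Real.pi / 4 * 2 ^ (-(n : ℤ)) ≤ φ ∧ φ ≤ Real.pi / 2 * 2 ^ (-(n : ℤ)) := by
  have hπ := Real.pi_pos
  obtain ⟨n, h2, h3⟩ := exists_nat_pow_near_of_lt_one (x := φ / (Real.pi / 2)) (y := 1 / 2)
    (by positivity) (by rwa [div_le_one (by positivity)]) (by norm_num) (by norm_num)
  have e : (2 : ℝ) ^ (-(n : ℤ)) = (1 / 2) ^ n := by
    rw [zpow_neg, zpow_natCast, one_div, inv_pow]
  refine ⟨n, ?_, ?_⟩
  · rw [lt_div_iff₀ (by positivity), pow_succ] at h2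
    rw [e]
    linarith
  · rw [div_le_iff₀ (by positivity)] at h3
    rw [e]
    linarith

/-- Each angle in (0, π/2] lies in a dyadic interval of scale τ = 2^{-n}; the rectangle reaches from
the window near √2 τν/x₀ up to πτ/2, both ends comparable to τ. The southern hemisphere is the
reflection φ ↦ π - φ. The azimuthal average then gives back ĝ itself. -/
theorem pointwise_bound (χ : RadialBump) : ∃ C : ℝ, 0 < C ∧ ∀ (D : ℝ≥0∞) (g g₁ u u₁ : L2),
    IsAxisymmetric g → IsAxisymmetric g₁ → IsS g g₁ → IsUpsilon g u → IsUpsilon g₁ u₁ →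
    normB χ g + ‖u‖ₑ ≤ D → normB χ g₁ + ‖u₁‖ₑ ≤ D →
    ∀ᵐ ξ, ‖(𝓕 g : L2) ξ‖ₑ ≤ ENNReal.ofReal (C / (‖ξ‖ * √‖ξ‖)) * D := by
  obtain ⟨N, η, hN, hη, hη1, hwin⟩ := χ.window
  set ν : ℝ := (1 / 2) ^ N with hν
  have hν0 : 0 < ν := by positivity
  have hν4 : ν ≤ 1 / 4 := by
    calc ν ≤ (1 / 2) ^ 2 := pow_le_pow_of_le_one (by norm_num) (by norm_num) hN
      _ = 1 / 4 := by norm_num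
  -- The bound of `azInt_rect_bound` with M = 4, κ = ν/64, δ = ην/2, α = 160ν and β = 8. Here 160 =
  -- 5 · 32 comes from the symbol bound 1/32 and the combination h₁ + 3h, and 8 = 2 + 3 · 2 from w₁
  -- + 3w.
  set C₀ : ℝ := √(2 * Real.pi * 4 / (ν / 64)) * (160 * ν / (η * ν / 2) + 8 +
    4 * η * (160 * ν) / (η * ν / 2) + 4 * η * 8) / (2 * η) with hC₀
  have hπ := Real.pi_gt_three
  have hπ0 := Real.pi_pos
  have hC₀pos : 0 < C₀ := by positivity
  refine ⟨4 * C₀, by positivity, ?_⟩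
  intro D g g₁ u u₁ hg hg₁ hS hu hu₁ hD hD₁
  obtain ⟨w, hw, hwp⟩ := hu.weakPolar_fourier hg
  obtain ⟨w₁, hw₁, hwp₁⟩ := hu₁.weakPolar_fourier hg₁
  set h : L2 := 𝓕 g with hh
  set h₁ : L2 := 𝓕 g₁ with hh₁
  have d1 := hS.weakScale_fourier.weakDir
  have d2 := hwp.weakDir
  have d12 := (hwp₁.add_smul hwp 3).weakDir
  have hwD : ‖w‖ₑ ≤ ENNReal.ofReal 2 * D := by
    rw [← ofReal_norm]
    refine (ENNReal.ofReal_le_ofReal hw).trans ?_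
    rw [ENNReal.ofReal_mul (by norm_num), ofReal_norm]
    gcongr
    exact le_add_self.trans hD
  have hwD₁ : ‖w₁‖ₑ ≤ ENNReal.ofReal 2 * D := by
    rw [← ofReal_norm]
    refine (ENNReal.ofReal_le_ofReal hw₁).trans ?_
    rw [ENNReal.ofReal_mul (by norm_num), ofReal_norm]
    gcongr
    exact le_add_self.trans hD₁
  have hwD' : ‖w‖ₑ ≤ ENNReal.ofReal 8 * D := hwD.trans (by gcongr; norm_num)
  have hwkD : ‖(w₁ + (3 : ℂ) • w : L2)‖ₑ ≤ ENNReal.ofReal 8 * D := by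
    refine (enorm_add_le _ _).trans ?_
    rw [enorm_smul]
    have h3 : ‖(3 : ℂ)‖ₑ = ENNReal.ofReal 3 := by rw [← ofReal_norm]; simp
    rw [h3]
    calc ‖w₁‖ₑ + ENNReal.ofReal 3 * ‖w‖ₑ ≤
        ENNReal.ofReal 2 * D + ENNReal.ofReal 3 * (ENNReal.ofReal 2 * D) := by gcongr
      _ = ENNReal.ofReal 8 * D := by
        rw [← mul_assoc, ← add_mul, ← ENNReal.ofReal_mul (by norm_num),
          ← ENNReal.ofReal_add (by norm_num) (by norm_num)]
        norm_num
  -- the bound on one rectangle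
  have rect : ∀ (ρ₀ : ℝ) (n : ℕ), 0 < ρ₀ → ∀ᵐ z : ℝ × ℝ, z.1 ∈ Icc (ρ₀ * (1 - η)) (ρ₀ * (1 + η)) →
      (z.2 ∈ Icc (Real.pi / 4 * 2 ^ (-(n : ℤ))) (Real.pi / 2 * 2 ^ (-(n : ℤ))) ∨
        Real.pi - z.2 ∈ Icc (Real.pi / 4 * 2 ^ (-(n : ℤ))) (Real.pi / 2 * 2 ^ (-(n : ℤ)))) →
      ‖azInt h z‖ₑ ≤ ENNReal.ofReal (C₀ / (ρ₀ * √ρ₀)) * D := by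
    intro ρ₀ n hρ₀
    obtain ⟨k, x₀, hx1, hx4, hk⟩ := hwin ρ₀ hρ₀
    set p : ℤ := -(n : ℤ) with hp
    have hp0 : p ≤ 0 := by omega
    set τ : ℝ := 2 ^ p with hτ
    have hτ0 : 0 < τ := by positivity
    have hτ1 : τ ≤ 1 := zpow_le_one_of_nonpos₀ (by norm_num) hp0
    have hpN : (2 : ℝ) ^ (p - N) = τ * ν := by
      rw [zpow_sub₀ two_ne_zero, zpow_natCast, hν, one_div, inv_pow, div_eq_mul_inv]
    set φs := √2 * 2 ^ (p - N) / x₀ with hφs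
    have hs1 : 1 ≤ √2 := Real.one_le_sqrt.2 (by norm_num)
    have hs2 : √2 ≤ 3 / 2 := by rw [Real.sqrt_le_left (by norm_num)]; norm_num
    have hφ1 : τ * ν / 4 ≤ φs := by
      rw [hφs, hpN]
      calc τ * ν / 4 ≤ τ * ν / x₀ := by gcongr
        _ ≤ √2 * (τ * ν) / x₀ := by
          gcongr ?_ / _
          exact le_mul_of_one_le_left (by positivity) hs1
    have hφ2 : φs ≤ 3 / 8 * τ := by
      rw [hφs, hpN]
      calc √2 * (τ * ν) / x₀ ≤ √2 * (τ * ν) := div_le_self (by positivity) hx1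
        _ ≤ 3 / 2 * (τ * (1 / 4)) := by gcongr
        _ = 3 / 8 * τ := by ring
    have hφs0 : 0 < φs := by positivity
    -- Enlarging the window of relative half-width η by ε keeps it within the relative half-width 2η
    -- on which the symbol is bounded below.
    set ε := η * min ρ₀ φs with hε
    have hε0 : 0 < ε := by positivity
    have hερ : ε ≤ η * ρ₀ := by rw [hε]; gcongr; exact min_le_left _ _
    have hεφ : ε ≤ η * φs := by rw [hε]; gcongr; exact min_le_right _ _
    obtain ⟨r1, r2, r3, r4, r5, r6⟩ := rect_arith hρ₀ hτ0 hτ1 hη1 hν0 (by linarith) hφ1 hφ2 hε0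
      hερ hεφ
    have hδ : η * ν / 2 * τ ≤ φs * (1 + η) - φs * (1 - η) := by
      have : η * (τ * ν / 4) ≤ η * φs := by gcongr
      linarith
    have hηφ : η * φs ≤ 1 / 4 * φs := by gcongr
    have window : ∀ c d : ℝ, (∀ φ ∈ Icc (c - ε) (d + ε),
        ∃ φ' ∈ Icc (φs * (1 - 2 * η)) (φs * (1 + 2 * η)), φ = φ' ∨ φ = Real.pi - φ') →
        ∀ g' : L2, normB χ g' ≤ D →
        ∫⁻ ξ in polSet (Icc (ρ₀ * (1 - η) - ε) (ρ₀ * (1 + η) + ε) ×ˢ Icc (c - ε) (d + ε)),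
          ‖(𝓕 g' : L2) ξ‖ₑ ^ 2 ≤ (ENNReal.ofReal (32 * (τ * ν)) * D) ^ 2 := by
      intro c d hcd g' hg'
      refine (lintegral_window_le (χ := χ) (k := k) (p := p - N) (by omega)
        (measurableSet_polSet (measurableSet_Icc.prod measurableSet_Icc)) ?_ g').trans ?_
      · intro ξ hξ
        have hξ1 : ‖ξ‖ ∈ Icc (ρ₀ * (1 - η) - ε) (ρ₀ * (1 + η) + ε) := hξ.1
        have hξ2 : polAng ξ ∈ Icc (c - ε) (d + ε) := hξ.2
        exact hk p hp0 ξ ⟨by linarith [hξ1.1], by linarith [hξ1.2]⟩ (hcd _ hξ2)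
      · rw [hpN]
        gcongr
    have five : ENNReal.ofReal (160 * ν * τ) * D = 5 * (ENNReal.ofReal (32 * (τ * ν)) * D) := by
      rw [← mul_assoc, ← ENNReal.ofReal_ofNat 5, ← ENNReal.ofReal_mul (by norm_num)]
      congr 2
      ring
    have le5 : ENNReal.ofReal (32 * (τ * ν)) * D ≤ ENNReal.ofReal (160 * ν * τ) * D := by
      gcongr ENNReal.ofReal ?_ * _
      nlinarith [mul_pos hτ0 hν0]
    have side : ∀ a b c d : ℝ, a ≤ c → d ≤ b → η * ν / 2 * τ ≤ d - c → 0 < a - ε →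
        b + ε < Real.pi → (∀ ρ ∈ Icc (ρ₀ * (1 - η) - ε) (ρ₀ * (1 + η) + ε),
          ∀ φ ∈ Icc (a - ε) (b + ε), ν / 64 * ρ₀ ^ 2 * τ ≤ ρ ^ 2 * Real.sin φ) →
        (2 * η * ρ₀ + 2 * ε) * (b - a + 2 * ε) ≤ 4 * ρ₀ * τ →
        (∀ φ ∈ Icc (c - ε) (d + ε),
          ∃ φ' ∈ Icc (φs * (1 - 2 * η)) (φs * (1 + 2 * η)), φ = φ' ∨ φ = Real.pi - φ') →
        ∀ᵐ z : ℝ × ℝ, z ∈ Icc (ρ₀ * (1 - η)) (ρ₀ * (1 + η)) ×ˢ Icc a b →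
          ‖azInt h z‖ₑ ≤ ENNReal.ofReal (C₀ / (ρ₀ * √ρ₀)) * D := by
      intro a b c d q1 q2 q3 q4 q5 q6 q7 q8
      have w0 := window c d q8 g (le_self_add.trans hD)
      have w1 := window c d q8 g₁ (le_self_add.trans hD₁)
      exact azInt_rect_bound d1 d2 d12 hρ₀ hτ0 hη (by positivity) (by positivity) (by norm_num)
        (by positivity) (by norm_num) hε0 q1 q2 q3 q4 q5 r4 q6 q7
        (w0.trans (pow_le_pow_left' le5 2))
        ((enorm_add_smul_sq_le w0 w1).trans (le_of_eq (by rw [five]))) hwD' hwkD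
    have north := side (φs * (1 - η)) (Real.pi / 2 * τ) (φs * (1 - η)) (φs * (1 + η)) le_rfl r1 hδ
      r2 r3 r5 r6 (fun φ hφ => ⟨φ, ⟨by linarith [hφ.1], by linarith [hφ.2]⟩, Or.inl rfl⟩)
    have south := side (Real.pi - Real.pi / 2 * τ) (Real.pi - φs * (1 - η))
      (Real.pi - φs * (1 + η)) (Real.pi - φs * (1 - η)) (by linarith) le_rfl (by linarith)
      (by linarith) (by linarith)
      (fun ρ hρ φ hφ => by
        rw [← Real.sin_pi_sub]
        exact r5 ρ hρ (Real.pi - φ) ⟨by linarith [hφ.2], by linarith [hφ.1]⟩)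
      (by linarith) (fun φ hφ => ⟨Real.pi - φ, ⟨by linarith [hφ.2], by linarith [hφ.1]⟩,
        Or.inr (by ring)⟩)
    filter_upwards [north, south] with z z1 z2 hz1 hz2
    have hlow : φs * (1 - η) ≤ Real.pi / 4 * τ := by
      have : 3 * τ ≤ Real.pi * τ := by gcongr
      have : 0 < φs * η := by positivity
      linarith
    rcases hz2 with hz2 | hz2
    · exact z1 ⟨hz1, hlow.trans hz2.1, hz2.2⟩
    · exact z2 ⟨hz1, by linarith [hz2.2], by linarith [hz2.1]⟩
  -- the bound on the meridian half plane
  have half : ∀ᵐ z : ℝ × ℝ, z ∈ merid →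
      ‖azInt h z‖ₑ ≤ ENNReal.ofReal (4 * C₀ / (z.1 * √z.1)) * D := by
    -- Rational radii and dyadic angles form a countable family, so the exceptional null sets can be
    -- united.
    have all : ∀ᵐ z : ℝ × ℝ, ∀ (r : ℚ) (n : ℕ), 0 < (r : ℝ) →
        z.1 ∈ Icc (r * (1 - η)) (r * (1 + η)) →
        (z.2 ∈ Icc (Real.pi / 4 * 2 ^ (-(n : ℤ))) (Real.pi / 2 * 2 ^ (-(n : ℤ))) ∨
        Real.pi - z.2 ∈ Icc (Real.pi / 4 * 2 ^ (-(n : ℤ))) (Real.pi / 2 * 2 ^ (-(n : ℤ)))) →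
        ‖azInt h z‖ₑ ≤ ENNReal.ofReal (C₀ / (r * √(r : ℝ))) * D := by
      rw [ae_all_iff]
      intro r
      rw [ae_all_iff]
      intro n
      by_cases hr : 0 < (r : ℝ)
      · filter_upwards [rect r n hr] with z hz _
        exact hz
      · filter_upwards with z hz
        exact absurd hz hr
    filter_upwards [all] with z hz hzm
    have hz1 : 0 < z.1 := hzm.1
    obtain ⟨r, hr1, hr2⟩ := exists_rat_btwn (show z.1 / (1 + η) < z.1 from
      div_lt_self hz1 (by linarith))
    have hr0 : 0 < (r : ℝ) := lt_trans (by positivity) hr1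
    rw [div_lt_iff₀ (by positivity)] at hr1
    have hr4 : (4 : ℝ) * (1 - η) ≤ 4 := by linarith
    by_cases hrz : (r : ℝ) * (1 - η) ≤ z.1
    · have hang : ∃ n : ℕ, z.2 ∈ Icc (Real.pi / 4 * 2 ^ (-(n : ℤ))) (Real.pi / 2 * 2 ^ (-(n : ℤ))) ∨
        Real.pi - z.2 ∈ Icc (Real.pi / 4 * 2 ^ (-(n : ℤ))) (Real.pi / 2 * 2 ^ (-(n : ℤ))) := by
        by_cases hc : z.2 ≤ Real.pi / 2
        · obtain ⟨n, hn⟩ := exists_dyadic_angle hzm.2.1 hc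
          exact ⟨n, Or.inl hn⟩
        · obtain ⟨n, hn⟩ := exists_dyadic_angle (φ := Real.pi - z.2) (by linarith [hzm.2.2])
            (by linarith)
          exact ⟨n, Or.inr hn⟩
      obtain ⟨n, hn⟩ := hang
      refine (hz r n hr0 ⟨hrz, hr1.le⟩ hn).trans ?_
      gcongr ENNReal.ofReal ?_ * _
      -- Replacing r by z.1 in r^{3/2} costs a factor 2 · 2 = 4, the one in the final constant.
      have hz2 : z.1 ≤ 2 * r := by nlinarith
      have hsq : √z.1 ≤ 2 * √(r : ℝ) := by
        rw [show (2 : ℝ) * √(r : ℝ) = √(4 * r) by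
          rw [Real.sqrt_mul (by norm_num), show (4 : ℝ) = 2 ^ 2 by norm_num,
            Real.sqrt_sq (by norm_num)]]
        exact Real.sqrt_le_sqrt (by linarith)
      have hsr : 0 < √(r : ℝ) := Real.sqrt_pos.2 hr0
      have hsz : 0 < √z.1 := Real.sqrt_pos.2 hz1
      rw [div_le_div_iff₀ (by positivity) (by positivity)]
      calc C₀ * (z.1 * √z.1) ≤ C₀ * ((2 * r) * (2 * √(r : ℝ))) := by gcongr
        _ = _ := by ring
    · exact absurd (le_trans (mul_le_of_le_one_right hr0.le (by linarith)) hr2.le) hrz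
  have hfst : ∀ᵐ q ∂(volume.restrict sphDom),
      ‖h (sph q)‖ₑ ≤ ENNReal.ofReal (4 * C₀ / (‖sph q‖ * √‖sph q‖)) * D := by
    have e1 : ∀ᵐ q : (ℝ × ℝ) × ℝ, q.1 ∈ merid →
        ‖azInt h q.1‖ₑ ≤ ENNReal.ofReal (4 * C₀ / (q.1.1 * √q.1.1)) * D :=
      Measure.quasiMeasurePreserving_fst.ae half
    filter_upwards [hg.fourier.ae_sph_eq, ae_restrict_of_ae e1,
      ae_restrict_mem measurableSet_sphDom] with q a1 a2 a3
    rw [norm_sph (le_of_lt a3.1.1)]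
    refine le_trans ?_ (a2 a3.1)
    rw [← a1, enorm_smul]
    -- The factor 2π ≥ 1 relating the azimuthal integral to the value is discarded.
    refine le_mul_of_one_le_left (by positivity) ?_
    rw [← ofReal_norm, ENNReal.one_le_ofReal, Real.norm_of_nonneg (by positivity)]
    linarith
  have hmeas : MeasurableSet {ξ : E3 | ‖h ξ‖ₑ ≤ ENNReal.ofReal (4 * C₀ / (‖ξ‖ * √‖ξ‖)) * D} := by
    refine measurableSet_le (Lp.stronglyMeasurable h).measurable.enorm ?_
    fun_prop
  have hq : ∀ᵐ q ∂sphMeasure, sph q ∈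
      {ξ : E3 | ‖h ξ‖ₑ ≤ ENNReal.ofReal (4 * C₀ / (‖ξ‖ * √‖ξ‖)) * D} := by
    rw [sphMeasure, ae_withDensity_iff (by fun_prop)]
    filter_upwards [hfst] with q hq _
    exact hq
  have hae := (ae_map_iff continuous_sph.measurable.aemeasurable hmeas).2 hq
  rw [measurePreserving_sph.map_eq] at hae
  exact hae

/-! ### The kernel representation -/

/-- The inverse transform on L² is abstract; for integrable F it is identified with the classical
integral by duality against test functions. -/
theorem fourierInv_ae_eq {F : L2} (hF : Integrable F) :
    ∀ᵐ x, (𝓕⁻ F : L2) x = 𝓕⁻ (F : E3 → ℂ) x := by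
  have hFn : Integrable fun ξ : E3 => F (-ξ) := hF.comp_neg
  have hcont : Continuous (𝓕⁻ (F : E3 → ℂ)) := by
    rw [Real.fourierInv_eq_fourier_comp_neg]
    exact VectorFourier.fourierIntegral_continuous Real.continuous_fourierChar
      (by exact continuous_inner) hFn
  refine ae_eq_of_integral_contDiff_smul_eq (locallyIntegrable_L2 _) hcont.locallyIntegrable ?_
  intro ψ hψ hc
  rw [integral_ofReal_smul, integral_ofReal_smul]
  have hs : ContDiff ℝ ∞ fun x => (ψ x : ℂ) := Complex.ofRealCLM.contDiff.comp hψ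
  have hcs : HasCompactSupport fun x => (ψ x : ℂ) :=
    hc.comp_left (g := fun r : ℝ => (r : ℂ)) Complex.ofReal_zero
  let Ψ := hcs.toSchwartzMap hs
  have e1 := integral_fourier_mul_schwartz (𝓕⁻ F : L2) (𝓕⁻ Ψ)
  rw [FourierTransform.fourier_fourierInv_eq, FourierTransform.fourier_fourierInv_eq] at e1
  have e2 : ∀ ξ, (𝓕⁻ Ψ) ξ = 𝓕 (Ψ : E3 → ℂ) (-ξ) := fun ξ => by
    rw [SchwartzMap.fourierInv_coe]
    exact Real.fourierInv_eq_fourier_neg (Ψ : E3 → ℂ) ξ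
  have e3 : ∫ ξ, F ξ * 𝓕 (Ψ : E3 → ℂ) (-ξ) = ∫ ξ, F (-ξ) * 𝓕 (Ψ : E3 → ℂ) ξ := by
    rw [← integral_neg_eq_self]
    simp
  have e4 := VectorFourier.integral_fourierIntegral_smul_eq_flip (L := innerₗ E3) (μ := volume)
    (ν := volume) Real.continuous_fourierChar continuous_inner hFn Ψ.integrable
  rw [flip_innerₗ] at e4
  simp only [smul_eq_mul] at e4
  have e5 : ∀ x, (Ψ x : ℂ) = ψ x := fun _ => rfl
  simp only [e2, e5] at e1
  rw [← e1, e3]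
  rw [Real.fourierInv_eq_fourier_comp_neg]
  exact e4.symm

/-- The oscillatory integral representing `P_{k,p,q} e^{itΛ} f`. -/
def oscIntegral (m : E3 → ℝ) (t : ℝ) (x : E3) (h : E3 → ℂ) : ℂ :=
  ∫ ξ, h ξ * (Complex.exp (((2 * Real.pi * inner ℝ ξ x + t * Lam ξ : ℝ) : ℂ) * Complex.I) *
    (m ξ : ℂ))

theorem Lam_smul {c : ℝ} (hc : 0 < c) (ξ : E3) : Lam (c • ξ) = Lam ξ := by
  rw [Lam, Lam, norm_smul, Real.norm_of_nonneg hc.le]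
  simp only [PiLp.smul_apply, smul_eq_mul]
  exact mul_div_mul_left _ _ hc.ne'

theorem proj_flow_ae_eq (χ : RadialBump) (k p q : ℤ) (t : ℝ) (f : L2) {m : E3 → ℝ}
    (hm : ∀ ξ, projSymbol χ k p q ((2 * Real.pi) • ξ) = (m ξ : ℂ)) (hmc : Continuous m)
    (hms : HasCompactSupport m) :
    ∀ᵐ x, proj χ k p q (flow t f) x = oscIntegral m t x (𝓕 f : L2) := by
  have hπ : (0 : ℝ) < 2 * Real.pi := by positivity
  have hms' : HasCompactSupport fun ξ => (m ξ : ℂ) :=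
    hms.comp_left (g := fun r : ℝ => (r : ℂ)) Complex.ofReal_zero
  have hfl : ∀ᵐ ξ, (𝓕 (flow t f) : L2) ξ = flowSymbol t ((2 * Real.pi) • ξ) * (𝓕 f : L2) ξ := by
    rw [flow, fourierMul, FourierTransform.fourier_fourierInv_eq]
    exact MemLp.coeFn_toLp _
  let F : L2 := (MemLp.mul' (r := 2) (Lp.memLp (𝓕 (flow t f))) (memLp_projSymbol χ k p q)).toLp
    (fun ξ : E3 => projSymbol χ k p q ((2 * Real.pi) • ξ) * (𝓕 (flow t f) : L2) ξ)
  have hF : ∀ᵐ ξ, F ξ = projSymbol χ k p q ((2 * Real.pi) • ξ) * (𝓕 (flow t f) : L2) ξ :=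
    MemLp.coeFn_toLp _
  have hFi : Integrable F := by
    refine (integrable_L2_mul (𝓕 (flow t f)) (φ := fun ξ => (m ξ : ℂ)) (by fun_prop) hms').congr ?_
    filter_upwards [hF] with ξ hξ
    rw [hξ, hm, mul_comm]
  filter_upwards [fourierInv_ae_eq hFi] with x hx
  have : proj χ k p q (flow t f) = 𝓕⁻ F := rfl
  rw [this, hx, Real.fourierInv_eq', oscIntegral]
  refine integral_congr_ae ?_
  filter_upwards [hF, hfl] with ξ h1 h2
  rw [h1, h2, hm, flowSymbol, Lam_smul hπ, smul_eq_mul]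
  push_cast
  rw [add_mul, Complex.exp_add, mul_comm Complex.I]
  ring

/-! ### Amplitudes adapted to the anisotropic localization -/

/-- Smooth functions supported in `1 ≤ |x| ≤ 4`. -/
def Annular (F : ℝ → ℝ) : Prop := ContDiff ℝ ∞ F ∧ ∀ x, F x ≠ 0 → 1 ≤ |x| ∧ |x| ≤ 4

/-- The Euler operator `x d/dx`. -/
def euler (F : ℝ → ℝ) (x : ℝ) : ℝ := x * deriv F x

theorem Annular.contDiff_deriv {F : ℝ → ℝ} (hF : Annular F) : ContDiff ℝ ∞ (deriv F) :=
  ((contDiff_infty_iff_deriv).1 hF.1).2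

theorem Annular.deriv {F : ℝ → ℝ} (hF : Annular F) : Annular (deriv F) := by
  refine ⟨hF.contDiff_deriv, fun x hx => ?_⟩
  have hcl : IsClosed {x : ℝ | 1 ≤ |x| ∧ |x| ≤ 4} :=
    (isClosed_le continuous_const continuous_abs).inter (isClosed_le continuous_abs continuous_const)
  exact closure_minimal (s := Function.support F) (fun y hy => hF.2 y hy) hcl
    (support_deriv_subset hx)

theorem Annular.euler {F : ℝ → ℝ} (hF : Annular F) : Annular (euler F) :=
  ⟨contDiff_id.mul hF.contDiff_deriv, fun x hx => hF.deriv.2 x (right_ne_zero_of_mul hx)⟩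

theorem Annular.bounded {F : ℝ → ℝ} (hF : Annular F) : ∃ K, ∀ x, |F x| ≤ K := by
  have hc : HasCompactSupport F := by
    refine HasCompactSupport.intro (isCompact_Icc (a := (-4 : ℝ)) (b := 4)) fun x hx => ?_
    by_contra h
    exact hx (abs_le.1 (hF.2 x h).2)
  exact hc.exists_bound_of_continuous hF.1.continuous

theorem RadialBump.annular_phi (χ : RadialBump) : Annular χ.phi := by
  refine ⟨χ.contDiff_phi, fun x hx => ⟨?_, ?_⟩⟩ <;> by_contra h
  · exact hx (χ.phi_eq_zero_of_le (not_le.1 h).le)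
  · exact hx (χ.phi_eq_zero_of_ge (not_le.1 h).le)

/-- The amplitude with factors depending on the radius, the horizontal radius and the height. -/
def amp (a b c : ℝ) (F₁ F₂ F₃ : ℝ → ℝ) (ξ : E3) : ℝ :=
  F₁ (a * ‖ξ‖) * F₂ (b ^ 2 * (ξ 0 ^ 2 + ξ 1 ^ 2)) * F₃ (c * ξ 2)

/-- The region in which the amplitudes are supported. -/
def shell (a b c : ℝ) : Set E3 :=
  {ξ | (1 ≤ a * ‖ξ‖ ∧ a * ‖ξ‖ ≤ 4) ∧ (1 ≤ b * axisDist ξ ∧ b * axisDist ξ ≤ 2) ∧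
    (1 ≤ c * |ξ 2| ∧ c * |ξ 2| ≤ 4)}

theorem isClosed_shell (a b c : ℝ) : IsClosed (shell a b c) := by
  have h2 : Continuous fun ξ : E3 => ξ 2 := (contDiff_coord (n := 0) 2).continuous
  have key : ∀ f : E3 → ℝ, Continuous f → ∀ u v : ℝ, IsClosed {ξ | u ≤ f ξ ∧ f ξ ≤ v} :=
    fun f hf u v => (isClosed_le continuous_const hf).inter (isClosed_le hf continuous_const)
  exact (key _ (continuous_const.mul continuous_norm) _ _).inter
    ((key _ (continuous_const.mul continuous_axisDist) _ _).inter
      (key _ (continuous_const.mul h2.abs) _ _))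

theorem shell_subset_offAxis {a b c : ℝ} (hb : 0 < b) : shell a b c ⊆ offAxis := by
  intro ξ hξ
  rw [mem_offAxis_iff]
  by_contra h
  have := mul_nonpos_of_nonneg_of_nonpos hb.le (not_lt.1 h)
  linarith [hξ.2.1.1]

theorem isCompact_shell {a b c : ℝ} (ha : 0 < a) : IsCompact (shell a b c) := by
  refine (isCompact_closedBall (0 : E3) (4 / a)).of_isClosed_subset (isClosed_shell a b c) ?_
  intro ξ hξ
  rw [mem_closedBall_zero_iff, le_div_iff₀ ha, mul_comm]
  exact hξ.1.2

theorem shell_subset_box {a b c : ℝ} (hb : 0 < b) (hc : 0 < c) :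
    shell a b c ⊆ box (2 / b) (2 / b) (4 / c) := by
  intro ξ hξ
  have h1 : axisDist ξ ≤ 2 / b := by
    rw [le_div_iff₀ hb, mul_comm]; exact hξ.2.1.2
  have hsq := axisDist_sq ξ
  refine ⟨?_, ?_, ?_⟩
  · exact (abs_le_of_sq_le_sq (by nlinarith [sq_nonneg (ξ 1)]) (axisDist_nonneg ξ)).trans h1
  · exact (abs_le_of_sq_le_sq (by nlinarith [sq_nonneg (ξ 0)]) (axisDist_nonneg ξ)).trans h1
  · rw [le_div_iff₀ hc, mul_comm]; exact hξ.2.2.2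

section

variable {a b c : ℝ} {F₁ F₂ F₃ : ℝ → ℝ}

theorem tsupport_amp_subset (ha : 0 < a) (hb : 0 < b) (hc : 0 < c) (h₁ : Annular F₁)
    (h₂ : Annular F₂) (h₃ : Annular F₃) : tsupport (amp a b c F₁ F₂ F₃) ⊆ shell a b c := by
  refine closure_minimal (fun ξ hξ => ?_) (isClosed_shell a b c)
  have n1 : F₁ (a * ‖ξ‖) ≠ 0 := fun h => hξ (by simp [amp, h])
  have n2 : F₂ (b ^ 2 * (ξ 0 ^ 2 + ξ 1 ^ 2)) ≠ 0 := fun h => hξ (by simp [amp, h])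
  have n3 : F₃ (c * ξ 2) ≠ 0 := fun h => hξ (by simp [amp, h])
  have r1 := h₁.2 _ n1
  have r2 := h₂.2 _ n2
  have r3 := h₃.2 _ n3
  rw [abs_of_nonneg (by positivity)] at r1
  rw [← axisDist_sq, ← mul_pow, abs_of_nonneg (by positivity)] at r2
  rw [abs_mul, abs_of_pos hc] at r3
  have h0 : 0 ≤ b * axisDist ξ := mul_nonneg hb.le (axisDist_nonneg ξ)
  exact ⟨r1, ⟨by nlinarith, by nlinarith⟩, r3⟩

theorem contDiff_amp (ha : 0 < a) (hb : 0 < b) (hc : 0 < c) (h₁ : Annular F₁)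
    (h₂ : Annular F₂) (h₃ : Annular F₃) : ContDiff ℝ ∞ (amp a b c F₁ F₂ F₃) := by
  refine contDiff_of_tsupport_subset isOpen_offAxis ?_
    ((tsupport_amp_subset ha hb hc h₁ h₂ h₃).trans (shell_subset_offAxis hb))
  have hn : ContDiffOn ℝ ∞ (fun ξ : E3 => ‖ξ‖) offAxis := fun ξ hξ =>
    (contDiffAt_norm ℝ (norm_pos_iff.1 (norm_pos_of_offAxis hξ))).contDiffWithinAt
  have h0 : ContDiff ℝ ∞ (fun ξ : E3 => b ^ 2 * (ξ 0 ^ 2 + ξ 1 ^ 2)) :=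
    contDiff_const.mul (((contDiff_coord 0).pow 2).add ((contDiff_coord 1).pow 2))
  have h2 : ContDiff ℝ ∞ (fun ξ : E3 => c * ξ 2) := contDiff_const.mul (contDiff_coord 2)
  exact ((h₁.1.comp_contDiffOn (contDiffOn_const.mul hn)).mul
    (h₂.1.comp h0).contDiffOn).mul (h₃.1.comp h2).contDiffOn

theorem hasFDerivAt_norm {ξ : E3} (h : ξ ≠ 0) :
    HasFDerivAt (fun ξ : E3 => ‖ξ‖) (‖ξ‖⁻¹ • innerSL ℝ ξ) ξ := by
  have h0 := norm_pos_iff.2 h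
  have h1 := (hasStrictFDerivAt_norm_sq ξ).hasFDerivAt.sqrt (by positivity)
  simp only [Real.sqrt_sq (norm_nonneg _)] at h1
  convert! h1 using 1
  ext v
  simp
  field_simp

theorem fderiv_amp (h₁ : Annular F₁) (h₂ : Annular F₂) (h₃ : Annular F₃) {ξ : E3} (hξ : ξ ≠ 0)
    (v : E3) : fderiv ℝ (amp a b c F₁ F₂ F₃) ξ v =
      deriv F₁ (a * ‖ξ‖) * (a * (inner ℝ ξ v / ‖ξ‖)) * F₂ (b ^ 2 * (ξ 0 ^ 2 + ξ 1 ^ 2)) *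
        F₃ (c * ξ 2) +
      F₁ (a * ‖ξ‖) * (deriv F₂ (b ^ 2 * (ξ 0 ^ 2 + ξ 1 ^ 2)) *
        (b ^ 2 * (2 * (ξ 0 * v 0 + ξ 1 * v 1)))) * F₃ (c * ξ 2) +
      F₁ (a * ‖ξ‖) * F₂ (b ^ 2 * (ξ 0 ^ 2 + ξ 1 ^ 2)) * (deriv F₃ (c * ξ 2) * (c * v 2)) := by
  have d1 := ((h₁.1.differentiable (by simp) (a * ‖ξ‖)).hasDerivAt).comp_hasFDerivAt ξ
    ((hasFDerivAt_norm hξ).const_mul a)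
  have hq : HasFDerivAt (fun ξ : E3 => b ^ 2 * (ξ 0 ^ 2 + ξ 1 ^ 2))
      (b ^ 2 • ((2 * ξ 0) • (EuclideanSpace.proj 0 : E3 →L[ℝ] ℝ) +
        (2 * ξ 1) • (EuclideanSpace.proj 1 : E3 →L[ℝ] ℝ))) ξ := by
    convert! (((hasFDerivAt_coord 0 ξ).pow 2).add ((hasFDerivAt_coord 1 ξ).pow 2)).const_mul
      (b ^ 2) using 1
    ext v
    simp
  have d2 := ((h₂.1.differentiable (by simp) (b ^ 2 * (ξ 0 ^ 2 + ξ 1 ^ 2))).hasDerivAt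
    ).comp_hasFDerivAt ξ hq
  have d3 := ((h₃.1.differentiable (by simp) (c * ξ 2)).hasDerivAt).comp_hasFDerivAt ξ
    ((hasFDerivAt_coord 2 ξ).const_mul c)
  have d : fderiv ℝ (amp a b c F₁ F₂ F₃) ξ = _ := ((d1.fun_mul d2).fun_mul d3).fderiv
  rw [d]
  simp
  field_simp
  ring

/-- The derivative along the scaling field. -/
def radial (m : E3 → ℝ) (ξ : E3) : ℝ := fderiv ℝ m ξ ξ

/-- The scaling field acts on each factor by the Euler operator, the factor 2 coming from the
quadratic argument of F₂. Hence iterated scaling derivatives stay in the same class, with bounds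
independent of a, b, c. -/
theorem radial_amp (h₁ : Annular F₁) (h₂ : Annular F₂) (h₃ : Annular F₃) (ξ : E3) :
    radial (amp a b c F₁ F₂ F₃) ξ = amp a b c (euler F₁) F₂ F₃ ξ +
      2 * amp a b c F₁ (euler F₂) F₃ ξ + amp a b c F₁ F₂ (euler F₃) ξ := by
  rcases eq_or_ne ξ 0 with rfl | hξ
  · simp [radial, amp, euler]
  have h0 := norm_pos_iff.2 hξ
  rw [radial, fderiv_amp h₁ h₂ h₃ hξ, real_inner_self_eq_norm_sq]
  simp only [amp, euler]
  field_simp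

/-- The polar field is tangent to spheres, so the radial factor F₁ is not differentiated. -/
theorem polar_amp (h₁ : Annular F₁) (h₂ : Annular F₂) (h₃ : Annular F₃) {ξ : E3}
    (hξ : ξ ∈ offAxis) : fderiv ℝ (amp a b c F₁ F₂ F₃) ξ (polarField ξ) =
      F₁ (a * ‖ξ‖) * (deriv F₂ (b ^ 2 * (ξ 0 ^ 2 + ξ 1 ^ 2)) *
        (b ^ 2 * (2 * (ξ 2 * axisDist ξ)))) * F₃ (c * ξ 2) -
      F₁ (a * ‖ξ‖) * F₂ (b ^ 2 * (ξ 0 ^ 2 + ξ 1 ^ 2)) * (deriv F₃ (c * ξ 2) *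
        (c * axisDist ξ)) := by
  have hr := mem_offAxis_iff.1 hξ
  have hp : polarField ξ = !₂[ξ 2 * ξ 0 / axisDist ξ, ξ 2 * ξ 1 / axisDist ξ, -axisDist ξ] := rfl
  have e1 : ξ 0 * polarField ξ 0 + ξ 1 * polarField ξ 1 = ξ 2 * axisDist ξ := by
    rw [hp]
    simp
    field_simp
    rw [axisDist_sq]
  have e2 : polarField ξ 2 = -axisDist ξ := rfl
  have e3 : inner ℝ ξ (polarField ξ) = 0 := by
    rw [PiLp.inner_apply, Fin.sum_univ_three]
    simp only [RCLike.inner_apply, conj_trivial]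
    rw [e2]
    linear_combination e1
  rw [fderiv_amp h₁ h₂ h₃ (norm_pos_iff.1 (norm_pos_of_offAxis hξ)), e1, e2, e3]
  ring

theorem abs_amp_le {K : ℝ} (h₁ : ∀ x, |F₁ x| ≤ K) (h₂ : ∀ x, |F₂ x| ≤ K) (h₃ : ∀ x, |F₃ x| ≤ K)
    (ξ : E3) : |amp a b c F₁ F₂ F₃ ξ| ≤ K ^ 3 := by
  have hK : 0 ≤ K := (abs_nonneg _).trans (h₁ 0)
  rw [amp, abs_mul, abs_mul]
  calc _ ≤ K * K * K := by gcongr <;> apply_assumption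
    _ = K ^ 3 := by ring

end

theorem contDiff_radial {m : E3 → ℝ} (hm : ContDiff ℝ ∞ m) : ContDiff ℝ ∞ (radial m) :=
  (hm.fderiv_right (m := ∞) (by simp)).clm_apply contDiff_id

theorem tsupport_radial_subset (m : E3 → ℝ) : tsupport (radial m) ⊆ tsupport m := by
  refine closure_minimal (fun ξ hξ => ?_) (isClosed_tsupport m)
  refine support_fderiv_subset ℝ (f := m) fun h => hξ ?_
  simp [radial, h]

/-- The symbol of `P_{k,p,q}` as an amplitude. -/
def RadialBump.symbol (χ : RadialBump) (a b c : ℝ) : E3 → ℝ := amp a b c χ.phi χ.phi χ.phi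

/-- Scaling derivatives cost nothing. The polar derivative turns height into horizontal radius and
conversely, which costs the ratio of the two scales in either direction. -/
theorem RadialBump.symbol_bounds (χ : RadialBump) : ∃ K : ℝ, 0 < K ∧ ∀ a b c : ℝ, 0 < a → 0 < b →
    0 < c → (∀ ξ, |χ.symbol a b c ξ| ≤ K) ∧ (∀ ξ, |radial (χ.symbol a b c) ξ| ≤ K) ∧
    (∀ ξ, |radial (radial (χ.symbol a b c)) ξ| ≤ K) ∧
    ∀ ξ ∈ shell a b c, |fderiv ℝ (χ.symbol a b c) ξ (polarField ξ)| ≤ K * (b / c + c / b) := by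
  have A0 := χ.annular_phi
  have A1 := A0.euler
  have A2 := A1.euler
  obtain ⟨K0, hK0⟩ := A0.bounded
  obtain ⟨K1, hK1⟩ := A1.bounded
  obtain ⟨K2, hK2⟩ := A2.bounded
  obtain ⟨K3, hK3⟩ := A0.deriv.bounded
  set K := max (max K0 K1) (max K2 K3) with hK
  have b0 : ∀ x, |χ.phi x| ≤ K := fun x => (hK0 x).trans (by simp [hK])
  have b1 : ∀ x, |euler χ.phi x| ≤ K := fun x => (hK1 x).trans (by simp [hK])
  have b2 : ∀ x, |euler (euler χ.phi) x| ≤ K := fun x => (hK2 x).trans (by simp [hK])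
  have b3 : ∀ x, |deriv χ.phi x| ≤ K := fun x => (hK3 x).trans (by simp [hK])
  have hKpos : 0 < K := by
    have := b0 2
    rw [χ.phi_two, abs_neg, abs_one] at this
    linarith
  have hK3pos : 0 < K ^ 3 := by positivity
  refine ⟨16 * K ^ 3, by positivity, fun a b c ha hb hc => ⟨fun ξ => ?_, fun ξ => ?_, fun ξ => ?_,
    fun ξ hξ => ?_⟩⟩
  · exact (abs_amp_le b0 b0 b0 ξ).trans (by linarith)
  · rw [RadialBump.symbol, radial_amp A0 A0 A0]
    have e1 := abs_le.1 (abs_amp_le (a := a) (b := b) (c := c) b1 b0 b0 ξ)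
    have e2 := abs_le.1 (abs_amp_le (a := a) (b := b) (c := c) b0 b1 b0 ξ)
    have e3 := abs_le.1 (abs_amp_le (a := a) (b := b) (c := c) b0 b0 b1 ξ)
    rw [abs_le]
    constructor <;> linarith
  · have hfun : radial (χ.symbol a b c) = fun ξ => amp a b c (euler χ.phi) χ.phi χ.phi ξ +
      2 * amp a b c χ.phi (euler χ.phi) χ.phi ξ + amp a b c χ.phi χ.phi (euler χ.phi) ξ :=
      funext fun ξ => radial_amp A0 A0 A0 ξ
    have s1 := (contDiff_amp ha hb hc A1 A0 A0).differentiable (by simp) ξ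
    have s2 := (contDiff_amp ha hb hc A0 A1 A0).differentiable (by simp) ξ
    have s3 := (contDiff_amp ha hb hc A0 A0 A1).differentiable (by simp) ξ
    have hsum : radial (radial (χ.symbol a b c)) ξ = radial (amp a b c (euler χ.phi) χ.phi χ.phi) ξ +
        2 * radial (amp a b c χ.phi (euler χ.phi) χ.phi) ξ +
        radial (amp a b c χ.phi χ.phi (euler χ.phi)) ξ := by
      rw [hfun, radial]
      have d := ((s1.hasFDerivAt.fun_add (s2.hasFDerivAt.const_mul 2)).fun_add s3.hasFDerivAt).fderiv
      rw [d]
      simp [radial]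
    rw [hsum, radial_amp A1 A0 A0, radial_amp A0 A1 A0, radial_amp A0 A0 A1]
    have t := fun {F₁ F₂ F₃ : ℝ → ℝ} (h₁ : ∀ x, |F₁ x| ≤ K) (h₂ : ∀ x, |F₂ x| ≤ K)
      (h₃ : ∀ x, |F₃ x| ≤ K) => abs_le.1 (abs_amp_le (a := a) (b := b) (c := c) h₁ h₂ h₃ ξ)
    have e1 := t b2 b0 b0
    have e2 := t b1 b1 b0
    have e3 := t b1 b0 b1
    have e4 := t b0 b2 b0
    have e5 := t b0 b1 b1
    have e6 := t b0 b0 b2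
    rw [abs_le]
    constructor <;> linarith
  · rw [RadialBump.symbol, polar_amp A0 A0 A0 (shell_subset_offAxis hb hξ)]
    have hr : axisDist ξ ≤ 2 / b := by
      rw [le_div_iff₀ hb, mul_comm]; exact hξ.2.1.2
    have hz : |ξ 2| ≤ 4 / c := by
      rw [le_div_iff₀ hc, mul_comm]; exact hξ.2.2.2
    have hr0 := axisDist_nonneg ξ
    refine (abs_sub _ _).trans ?_
    have u1 : |χ.phi (a * ‖ξ‖) * (deriv χ.phi (b ^ 2 * (ξ 0 ^ 2 + ξ 1 ^ 2)) *
        (b ^ 2 * (2 * (ξ 2 * axisDist ξ)))) * χ.phi (c * ξ 2)| ≤ K * (K * (b ^ 2 * (2 * (4 / c * (2 / b))))) * K := by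
      simp only [abs_mul, abs_pow, abs_of_pos hb, abs_of_nonneg hr0, abs_two]
      gcongr
      · exact b0 _
      · exact b3 _
      · exact b0 _
    have u2 : |χ.phi (a * ‖ξ‖) * χ.phi (b ^ 2 * (ξ 0 ^ 2 + ξ 1 ^ 2)) * (deriv χ.phi (c * ξ 2) *
        (c * axisDist ξ))| ≤ K * K * (K * (c * (2 / b))) := by
      simp only [abs_mul, abs_of_pos hc, abs_of_nonneg hr0]
      gcongr
      · exact b0 _
      · exact b0 _
      · exact b3 _
    have v1 : K * (K * (b ^ 2 * (2 * (4 / c * (2 / b))))) * K = 16 * K ^ 3 * (b / c) := by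
      field_simp
      norm_num
    have v2 : K * K * (K * (c * (2 / b))) = 2 * K ^ 3 * (c / b) := by
      field_simp
    have v3 : 0 < K ^ 3 * (c / b) := by positivity
    rw [v1] at u1
    rw [v2] at u2
    linarith

/-! ### Oscillatory test functions -/

/-- The test function `e^{itΛ} ρ(2π x·ξ) m(ξ)`. -/
def oscTest (t : ℝ) (x : E3) (m : E3 → ℝ) (ρ : ℝ → ℂ) (ξ : E3) : ℂ :=
  Complex.exp (((t * Lam ξ : ℝ) : ℂ) * Complex.I) * ρ (2 * Real.pi * inner ℝ ξ x) * (m ξ : ℂ)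

theorem contDiffOn_Lam : ContDiffOn ℝ ∞ Lam offAxis := by
  intro ξ hξ
  have h0 := norm_pos_of_offAxis hξ
  exact ((contDiff_coord 2).contDiffAt.div (contDiffAt_norm ℝ (norm_pos_iff.1 h0))
    h0.ne').contDiffWithinAt

theorem contDiff_inner_left (x : E3) : ContDiff ℝ ∞ fun ξ : E3 => 2 * Real.pi * inner ℝ ξ x :=
  contDiff_const.mul (contDiff_id.inner ℝ contDiff_const)

theorem tsupport_oscTest_subset (t : ℝ) (x : E3) (m : E3 → ℝ) (ρ : ℝ → ℂ) :
    tsupport (oscTest t x m ρ) ⊆ tsupport m := by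
  refine closure_mono fun ξ hξ => ?_
  intro h
  exact hξ (by simp [oscTest, h])

theorem contDiff_oscTest (t : ℝ) (x : E3) {m : E3 → ℝ} {ρ : ℝ → ℂ} (hm : ContDiff ℝ ∞ m)
    (hs : tsupport m ⊆ offAxis) (hρ : ContDiff ℝ ∞ ρ) : ContDiff ℝ ∞ (oscTest t x m ρ) := by
  refine contDiff_of_tsupport_subset isOpen_offAxis ?_
    ((tsupport_oscTest_subset t x m ρ).trans hs)
  have h1 : ContDiffOn ℝ ∞ (fun ξ => Complex.exp (((t * Lam ξ : ℝ) : ℂ) * Complex.I)) offAxis :=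
    ((Complex.ofRealCLM.contDiff.comp_contDiffOn (contDiffOn_const.mul contDiffOn_Lam)).mul
      contDiffOn_const).cexp
  exact (h1.mul (hρ.comp (contDiff_inner_left x)).contDiffOn).mul
    (Complex.ofRealCLM.contDiff.comp hm).contDiffOn

/-- The Euler operator on complex valued functions. -/
def eulerC (ρ : ℝ → ℂ) (y : ℝ) : ℂ := y * deriv ρ y

/-- Λ is constant along rays, so the factor e^{itΛ} is not differentiated and t does not appear. -/
theorem fderiv_oscTest_radial (t : ℝ) (x : E3) {m : E3 → ℝ} {ρ : ℝ → ℂ} (hm : ContDiff ℝ ∞ m)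
    (hs : tsupport m ⊆ offAxis) (hρ : ContDiff ℝ ∞ ρ) (ξ : E3) :
    fderiv ℝ (oscTest t x m ρ) ξ ξ =
      oscTest t x (radial m) ρ ξ + oscTest t x m (eulerC ρ) ξ := by
  have d0 : HasDerivAt (fun s : ℝ => ξ + s • ξ) ξ 0 := by
    simpa using ((hasDerivAt_id (0 : ℝ)).smul_const ξ).const_add ξ
  have line : ∀ {F : Type} [NormedAddCommGroup F] [NormedSpace ℝ F] {f : E3 → F},
      ContDiff ℝ ∞ f → HasDerivAt (fun s : ℝ => f (ξ + s • ξ)) (fderiv ℝ f ξ ξ) 0 := by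
    intro F _ _ f hf
    have h := (hf.differentiable (by simp) ξ).hasFDerivAt
    have h0 : HasFDerivAt f (fderiv ℝ f ξ) (ξ + (0 : ℝ) • ξ) := by simpa using h
    exact h0.comp_hasDerivAt 0 d0
  have h1 := line (contDiff_oscTest t x hm hs hρ)
  have h2 := (line hm).ofReal_comp
  set y := 2 * Real.pi * inner ℝ ξ x with hy
  have hyd : HasDerivAt (fun s : ℝ => y + s * y) y 0 := by
    simpa using ((hasDerivAt_id (0 : ℝ)).mul_const y).const_add y
  have h3 : HasDerivAt (fun s : ℝ => ρ (y + s * y)) (y • deriv ρ y) 0 := by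
    have h := (hρ.differentiable (by simp) y).hasDerivAt
    have h0 : HasDerivAt ρ (deriv ρ y) (y + 0 * y) := by simpa using h
    exact h0.scomp 0 hyd
  have h4 := ((h3.fun_mul h2).const_mul (Complex.exp (((t * Lam ξ : ℝ) : ℂ) * Complex.I)))
  have h5 : (fun s : ℝ => oscTest t x m ρ (ξ + s • ξ)) =ᶠ[𝓝 0] fun s : ℝ =>
      Complex.exp (((t * Lam ξ : ℝ) : ℂ) * Complex.I) * (ρ (y + s * y) * (m (ξ + s • ξ) : ℂ)) := by
    have : ∀ᶠ s in 𝓝 (0 : ℝ), -1 < s := lt_mem_nhds (by norm_num)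
    filter_upwards [this] with s hs'
    have e1 : ξ + s • ξ = (1 + s) • ξ := by rw [add_smul, one_smul]
    have e2 : Lam (ξ + s • ξ) = Lam ξ := by rw [e1, Lam_smul (by linarith)]
    have e3 : 2 * Real.pi * inner ℝ (ξ + s • ξ) x = y + s * y := by
      rw [inner_add_left, real_inner_smul_left, hy]
      ring
    rw [oscTest, e2, e3, mul_assoc]
  have h6 := h1.unique (h4.congr_of_eventuallyEq h5)
  rw [h6]
  simp only [oscTest, radial, eulerC, ← hy, zero_mul, add_zero, zero_smul, Complex.real_smul]
  ring

theorem WeakScale.oscTest {h h₁ : L2} (hw : WeakScale h h₁) (t : ℝ) (x : E3) {m : E3 → ℝ}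
    {ρ : ℝ → ℂ} (hm : ContDiff ℝ ∞ m) (hc : HasCompactSupport m) (hs : tsupport m ⊆ offAxis)
    (hρ : ContDiff ℝ ∞ ρ) (hρ' : ContDiff ℝ ∞ (eulerC ρ)) :
    ∫ ξ, h₁ ξ * oscTest t x m ρ ξ =
      (∫ ξ, h ξ * oscTest t x (radial m) ρ ξ) + ∫ ξ, h ξ * oscTest t x m (eulerC ρ) ξ := by
  have cs : ∀ {n : E3 → ℝ} (ρ : ℝ → ℂ), tsupport n ⊆ tsupport m →
      HasCompactSupport (RotatingEuler.oscTest t x n ρ) := fun ρ hn =>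
    hc.of_isClosed_subset (isClosed_tsupport _) ((tsupport_oscTest_subset t x _ ρ).trans hn)
  have ts := tsupport_radial_subset m
  rw [hw _ (contDiff_oscTest t x hm hs hρ) (cs ρ subset_rfl), ← integral_add]
  · congr 1
    ext ξ
    rw [fderiv_oscTest_radial t x hm hs hρ]
    ring
  · exact integrable_L2_mul h
      (contDiff_oscTest t x (contDiff_radial hm) (ts.trans hs) hρ).continuous (cs ρ ts)
  · exact integrable_L2_mul h (contDiff_oscTest t x hm hs hρ').continuous (cs _ subset_rfl)

/-! ### Integration over boxes -/

theorem lintegral_inv_one_add_sq {a : ℝ} (ha : a ≠ 0) (c : ℝ) :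
    ∫⁻ s : ℝ, ENNReal.ofReal (1 + (a * s + c) ^ 2)⁻¹ = ENNReal.ofReal (Real.pi / |a|) := by
  have h0 : Integrable fun y : ℝ => (1 + y ^ 2)⁻¹ := integrable_inv_one_add_sq
  have h1 : Integrable fun s : ℝ => (1 + (a * s + c) ^ 2)⁻¹ :=
    (h0.comp_add_right c).comp_mul_left' ha
  rw [← ofReal_integral_eq_lintegral_ofReal h1 (ae_of_all _ fun s => by positivity)]
  congr 1
  have h2 := Measure.integral_comp_mul_left (fun y : ℝ => (1 + (y + c) ^ 2)⁻¹) a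
  have h3 := integral_add_right_eq_self (μ := (volume : Measure ℝ)) (fun y : ℝ => (1 + y ^ 2)⁻¹) c
  rw [h2, h3, integral_univ_inv_one_add_sq, smul_eq_mul, abs_inv]
  field_simp

/-- Integrate first in the j-th variable over the whole line, which gives π/(2π|x_j|) whatever the
other coordinates are; what remains is the area of the cross-section. -/
theorem lintegral_box_le {w : Fin 3 → ℝ} (hw : ∀ i, 0 ≤ w i) {x : E3} {j : Fin 3} (hj : x j ≠ 0) :
    ∫⁻ ξ in {ξ : E3 | ∀ i, |ξ i| ≤ w i}, ENNReal.ofReal (1 + (2 * Real.pi * inner ℝ ξ x) ^ 2)⁻¹ ≤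
      ENNReal.ofReal ((∏ i : Fin 2, 2 * w (j.succAbove i)) * (1 / (2 * |x j|))) := by
  let e := MeasurableEquiv.piFinSuccAbove (fun _ : Fin 3 => ℝ) j
  have he : MeasurePreserving e := volume_preserving_piFinSuccAbove (fun _ : Fin 3 => ℝ) j
  have h2 := EuclideanSpace.volume_preserving_symm_measurableEquiv_toLp (Fin 3)
  set S : Set E3 := {ξ : E3 | ∀ i, |ξ i| ≤ w i} with hS
  have hSm : MeasurableSet S := by
    rw [hS, ofPred_forall]
    exact MeasurableSet.iInter fun i => measurableSet_le (by fun_prop) measurable_const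
  let Z : Set (Fin 2 → ℝ) := Set.pi univ fun i => Icc (-w (j.succAbove i)) (w (j.succAbove i))
  have hZ : volume Z = ENNReal.ofReal (∏ i : Fin 2, 2 * w (j.succAbove i)) := by
    rw [volume_pi_pi, ENNReal.ofReal_prod_of_nonneg fun i _ => by have := hw (j.succAbove i); positivity]
    refine Finset.prod_congr rfl fun i _ => ?_
    rw [Real.volume_Icc]
    ring_nf
  have hZm : MeasurableSet Z := MeasurableSet.univ_pi fun i => measurableSet_Icc
  let L : (Fin 2 → ℝ) → ℝ := fun z => ∑ i, 2 * Real.pi * (x (j.succAbove i) * z i)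
  let G : ℝ × (Fin 2 → ℝ) → ℝ≥0∞ := fun p => Z.indicator (fun _ => 1) p.2 *
    ENNReal.ofReal (1 + (2 * Real.pi * x j * p.1 + L p.2) ^ 2)⁻¹
  have hG : Measurable G := by
    refine Measurable.mul ((measurable_one.indicator hZm).comp measurable_snd) ?_
    fun_prop
  have hle : ∀ ξ : E3, S.indicator (fun ξ =>
      ENNReal.ofReal (1 + (2 * Real.pi * inner ℝ ξ x) ^ 2)⁻¹) ξ ≤ G (e (ξ.ofLp)) := by
    intro ξ
    refine indicator_le' (f := fun ξ => ENNReal.ofReal (1 + (2 * Real.pi * inner ℝ ξ x) ^ 2)⁻¹)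
      (g := fun ξ : E3 => G (e (ξ.ofLp))) (fun ξ hξ => ?_) (fun _ _ => zero_le) ξ
    have e1 : (e ξ.ofLp).2 ∈ Z := by
      intro i _
      exact abs_le.1 (hξ (j.succAbove i))
    have e2 : 2 * Real.pi * inner ℝ ξ x = 2 * Real.pi * x j * (e ξ.ofLp).1 + L (e ξ.ofLp).2 := by
      have a1 : (e ξ.ofLp).1 = ξ j := rfl
      have a2 : ∀ i, (e ξ.ofLp).2 i = ξ (j.succAbove i) := fun i => rfl
      rw [PiLp.inner_apply, Fin.sum_univ_succAbove _ j]
      simp only [RCLike.inner_apply, conj_trivial, L, a1, a2, mul_add, Finset.mul_sum]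
      ring
    simp only [G]
    rw [indicator_of_mem e1, one_mul, ← e2]
  calc ∫⁻ ξ in S, ENNReal.ofReal (1 + (2 * Real.pi * inner ℝ ξ x) ^ 2)⁻¹
      = ∫⁻ ξ, S.indicator (fun ξ => ENNReal.ofReal (1 + (2 * Real.pi * inner ℝ ξ x) ^ 2)⁻¹) ξ :=
        (lintegral_indicator hSm _).symm
    _ ≤ ∫⁻ ξ : E3, G (e (ξ.ofLp)) := lintegral_mono hle
    _ = ∫⁻ p, G p := (he.comp h2).lintegral_comp hG
    _ = ∫⁻ z, ∫⁻ s, G (s, z) := by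
        rw [Measure.volume_eq_prod, lintegral_prod_symm _ hG.aemeasurable]
    _ = ∫⁻ z, Z.indicator (fun _ => ENNReal.ofReal (Real.pi / |2 * Real.pi * x j|)) z := by
        refine lintegral_congr fun z => ?_
        simp only [G]
        rw [lintegral_const_mul _ (by fun_prop),
          lintegral_inv_one_add_sq (mul_ne_zero (by positivity) hj)]
        by_cases hz : z ∈ Z <;> simp [hz]
    _ ≤ _ := by
        rw [lintegral_indicator hZm, setLIntegral_const, hZ, mul_comm, ← ENNReal.ofReal_mul
          (Finset.prod_nonneg fun i _ => by have := hw (j.succAbove i); positivity)]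
        refine ENNReal.ofReal_le_ofReal (le_of_eq ?_)
        rw [abs_mul, abs_of_pos (by positivity : 0 < 2 * Real.pi)]
        have := Real.pi_pos
        field_simp

theorem exists_large_coord {x : E3} : ∃ j : Fin 3, ‖x‖ / 2 ≤ |x j| := by
  by_contra! h
  have hn := norm_sq_eq x
  have h' : ∀ j : Fin 3, x j ^ 2 ≤ (‖x‖ / 2) ^ 2 := fun j => by
    rw [← sq_abs]
    exact pow_le_pow_left₀ (abs_nonneg _) (h j).le 2
  have hx : 0 < ‖x‖ := by
    have := (abs_nonneg _).trans_lt (h 0)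
    linarith
  nlinarith [h' 0, h' 1, h' 2]

/-- A coordinate with |x_j| ≥ ‖x‖/2 is singled out. The shell lies in a box of sides 4/b, 4/b, 8/c,
and any two of them retain at least one factor 1/b; this factor matches the threshold ‖x‖ b ~ t a²
between the two regimes. -/
theorem lintegral_shell_le {a b c : ℝ} (ha : 0 < a) (hab : a ≤ b) (hac : a ≤ c) {x : E3}
    (hx : 0 < ‖x‖) :
    ∫⁻ ξ in shell a b c, ENNReal.ofReal (1 + (2 * Real.pi * inner ℝ ξ x) ^ 2)⁻¹ ≤
      ENNReal.ofReal (32 / (a * b * ‖x‖)) := by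
  have hb : 0 < b := ha.trans_le hab
  have hc : 0 < c := ha.trans_le hac
  obtain ⟨j, hj⟩ := exists_large_coord (x := x)
  have hj0 : 0 < |x j| := lt_of_lt_of_le (by positivity) hj
  let w : Fin 3 → ℝ := ![2 / b, 2 / b, 4 / c]
  have hw : ∀ i, 0 ≤ w i := by
    intro i
    fin_cases i <;> simp [w] <;> positivity
  have hsub : shell a b c ⊆ {ξ : E3 | ∀ i, |ξ i| ≤ w i} := by
    intro ξ hξ i
    obtain ⟨h0, h1, h2⟩ := shell_subset_box hb hc hξ
    fin_cases i
    · exact h0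
    · exact h1
    · exact h2
  refine (lintegral_mono_set hsub).trans ((lintegral_box_le hw (abs_pos.1 hj0)).trans ?_)
  refine ENNReal.ofReal_le_ofReal ?_
  have h1 : (1 : ℝ) / (2 * |x j|) ≤ 1 / ‖x‖ := by
    gcongr
    linarith
  have h2 : ∏ i : Fin 2, 2 * w (j.succAbove i) ≤ 32 / (a * b) := by
    have c1 : 2 * (2 / b) * (2 * (2 / b)) ≤ 32 / (a * b) := by
      rw [show 2 * (2 / b) * (2 * (2 / b)) = 16 / (b * b) by field_simp; norm_num]
      gcongr
      norm_num
    have c2 : 2 * (2 / b) * (2 * (4 / c)) ≤ 32 / (a * b) := by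
      rw [show 2 * (2 / b) * (2 * (4 / c)) = 32 / (c * b) by field_simp; norm_num]
      gcongr
    rw [Fin.prod_univ_two]
    fin_cases j
    · exact c2
    · exact c2
    · exact c1
  calc (∏ i : Fin 2, 2 * w (j.succAbove i)) * (1 / (2 * |x j|)) ≤ 32 / (a * b) * (1 / ‖x‖) := by
        gcongr
    _ = _ := by field_simp

/-! ### Two integrations by parts along the scaling field -/

/-- The profile `s(y) e^{iy}`. -/
def wave (s : ℝ → ℝ) (y : ℝ) : ℂ := (s y : ℂ) * Complex.exp ((y : ℂ) * Complex.I)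

theorem contDiff_wave {s : ℝ → ℝ} (hs : ContDiff ℝ ∞ s) : ContDiff ℝ ∞ (wave s) :=
  (Complex.ofRealCLM.contDiff.comp hs).mul
    (Complex.ofRealCLM.contDiff.mul contDiff_const).cexp

theorem hasDerivAt_wave {s : ℝ → ℝ} (hs : ContDiff ℝ ∞ s) (y : ℝ) :
    HasDerivAt (wave s) (((deriv s y : ℝ) : ℂ) * Complex.exp ((y : ℂ) * Complex.I) +
      (s y : ℂ) * (Complex.exp ((y : ℂ) * Complex.I) * Complex.I)) y := by
  have h1 := (hs.differentiable (by simp) y).hasDerivAt.ofReal_comp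
  have h2 : HasDerivAt (fun y : ℝ => Complex.exp ((y : ℂ) * Complex.I))
      (Complex.exp ((y : ℂ) * Complex.I) * Complex.I) y := by
    have := ((Complex.ofRealCLM.hasDerivAt (x := y)).mul_const Complex.I).cexp
    simpa using this
  exact h1.fun_mul h2

/-- The profile `i y s(y) e^{iy}`. -/
def waveY (s : ℝ → ℝ) (y : ℝ) : ℂ := (y : ℂ) * Complex.I * wave s y

theorem contDiff_waveY {s : ℝ → ℝ} (hs : ContDiff ℝ ∞ s) : ContDiff ℝ ∞ (waveY s) :=
  (Complex.ofRealCLM.contDiff.mul contDiff_const).mul (contDiff_wave hs)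

theorem eulerC_wave {s : ℝ → ℝ} (hs : ContDiff ℝ ∞ s) (y : ℝ) :
    eulerC (wave s) y = wave (euler s) y + waveY s y := by
  rw [eulerC, (hasDerivAt_wave hs y).deriv]
  simp only [wave, waveY, euler]
  push_cast
  ring

theorem eulerC_waveY {s : ℝ → ℝ} (hs : ContDiff ℝ ∞ s) (y : ℝ) :
    eulerC (waveY s) y = waveY (euler s) y + waveY s y - (y : ℂ) ^ 2 * wave s y := by
  have h1 := ((Complex.ofRealCLM.hasDerivAt (x := y)).mul_const Complex.I).fun_mul
    (hasDerivAt_wave hs y)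
  have h2 : deriv (waveY s) y = _ := h1.deriv
  rw [eulerC, h2]
  simp only [wave, waveY, euler, Complex.ofRealCLM_apply]
  push_cast
  linear_combination (y : ℂ) ^ 2 * (s y : ℂ) * Complex.exp ((y : ℂ) * Complex.I) * Complex.I_mul_I

/-- The weight `1 / (1 + y²)`. -/
def weight (y : ℝ) : ℝ := (1 + y ^ 2)⁻¹

theorem contDiff_weight : ContDiff ℝ ∞ weight :=
  ContDiff.inv (contDiff_const.add (contDiff_id.pow 2)) fun y => by
    have : 0 < 1 + y ^ 2 := by positivity
    exact this.ne'

theorem contDiff_euler {s : ℝ → ℝ} (hs : ContDiff ℝ ∞ s) : ContDiff ℝ ∞ (euler s) :=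
  contDiff_id.mul ((contDiff_infty_iff_deriv).1 hs).2

theorem euler_weight : euler weight = fun y => -2 * y ^ 2 / (1 + y ^ 2) ^ 2 := by
  ext y
  have h0 : 0 < 1 + y ^ 2 := by positivity
  have h1 : HasDerivAt (fun y : ℝ => 1 + y ^ 2) (2 * y) y := by
    simpa using (hasDerivAt_pow 2 y).const_add 1
  have h2 : deriv weight y = _ := (h1.fun_inv h0.ne').deriv
  rw [euler, h2]
  field_simp

theorem euler_euler_weight :
    euler (euler weight) = fun y => (4 * y ^ 4 - 4 * y ^ 2) / (1 + y ^ 2) ^ 3 := by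
  ext y
  have h0 : 0 < 1 + y ^ 2 := by positivity
  have h1 : HasDerivAt (fun y : ℝ => (1 + y ^ 2) ^ 2) (2 * (1 + y ^ 2) * (2 * y)) y := by
    have := ((hasDerivAt_pow 2 y).const_add 1).fun_pow 2
    simpa using this
  have h2 : HasDerivAt (fun y : ℝ => -2 * y ^ 2) (-2 * (2 * y)) y := by
    simpa using (hasDerivAt_pow 2 y).const_mul (-2)
  rw [euler, euler_weight, (h2.fun_div h1 (by positivity)).deriv]
  field_simp
  ring

theorem abs_weight_le (y : ℝ) : |weight y| ≤ 4 * weight y ∧ |euler weight y| ≤ 4 * weight y ∧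
    |euler (euler weight) y| ≤ 4 * weight y := by
  have h0 : 0 < 1 + y ^ 2 := by positivity
  have hw : weight y = 1 / (1 + y ^ 2) := by rw [weight, one_div]
  have h4 : y ^ 4 = (y ^ 2) ^ 2 := by ring
  refine ⟨?_, ?_, ?_⟩
  · rw [abs_of_nonneg (by rw [hw]; positivity)]
    have : 0 < weight y := by rw [hw]; positivity
    linarith
  · rw [euler_weight, hw, abs_div, abs_of_pos (by positivity : 0 < (1 + y ^ 2) ^ 2),
      show |-2 * y ^ 2| = 2 * y ^ 2 by rw [abs_mul, abs_of_nonneg (sq_nonneg y)]; norm_num,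
      mul_one_div, div_le_div_iff₀ (by positivity) h0]
    nlinarith [sq_nonneg y]
  · rw [euler_euler_weight, hw, abs_div, abs_of_pos (by positivity : 0 < (1 + y ^ 2) ^ 3),
      mul_one_div, div_le_div_iff₀ (by positivity) h0]
    have : |4 * y ^ 4 - 4 * y ^ 2| ≤ 4 * (1 + y ^ 2) ^ 2 := by
      rw [abs_le]
      constructor <;> nlinarith [sq_nonneg y, sq_nonneg (y ^ 2)]
    calc |4 * y ^ 4 - 4 * y ^ 2| * (1 + y ^ 2) ≤ 4 * (1 + y ^ 2) ^ 2 * (1 + y ^ 2) := by gcongr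
      _ = 4 * (1 + y ^ 2) ^ 3 := by ring

theorem oscTest_add (t : ℝ) (x : E3) (m : E3 → ℝ) (ρ₁ ρ₂ : ℝ → ℂ) (ξ : E3) :
    oscTest t x m (fun y => ρ₁ y + ρ₂ y) ξ = oscTest t x m ρ₁ ξ + oscTest t x m ρ₂ ξ := by
  simp only [oscTest]
  ring

/-- Split 1 = weight + y² weight and express y² e^{iy} weight through the Euler operator, by
`eulerC_waveY`; that operator is what integration by parts along the scaling field removes. -/
theorem wave_one_eq (y : ℝ) : wave (fun _ => 1) y = wave weight y +
    (waveY (euler weight) y + waveY weight y - eulerC (waveY weight) y) := by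
  have h0 : (1 + (y : ℂ) ^ 2) ≠ 0 := by
    have : (0 : ℝ) < 1 + y ^ 2 := by positivity
    exact_mod_cast this.ne'
  rw [eulerC_waveY contDiff_weight]
  simp only [wave, weight]
  push_cast
  field_simp
  ring

section Pairing

variable {t : ℝ} {x : E3} {m : E3 → ℝ}

theorem integrable_mul_oscTest (h : L2) (hm : ContDiff ℝ ∞ m) (hc : HasCompactSupport m)
    (hs : tsupport m ⊆ offAxis) {ρ : ℝ → ℂ} (hρ : ContDiff ℝ ∞ ρ) :
    Integrable fun ξ => h ξ * oscTest t x m ρ ξ :=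
  integrable_L2_mul h (contDiff_oscTest t x hm hs hρ).continuous
    (hc.of_isClosed_subset (isClosed_tsupport _) (tsupport_oscTest_subset t x m ρ))

theorem integral_waveY_of_weakScale {h h₁ : L2} (hw : WeakScale h h₁) (hm : ContDiff ℝ ∞ m)
    (hc : HasCompactSupport m) (hs : tsupport m ⊆ offAxis) {s : ℝ → ℝ} (hρ : ContDiff ℝ ∞ s) :
    ∫ ξ, h ξ * oscTest t x m (waveY s) ξ = (∫ ξ, h₁ ξ * oscTest t x m (wave s) ξ) -
      (∫ ξ, h ξ * oscTest t x (radial m) (wave s) ξ) -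
      ∫ ξ, h ξ * oscTest t x m (wave (euler s)) ξ := by
  have he := funext (eulerC_wave hρ)
  have h1 := contDiff_wave (contDiff_euler hρ)
  have h2 := contDiff_waveY hρ
  rw [hw.oscTest t x hm hc hs (contDiff_wave hρ) (by rw [he]; exact h1.add h2), he]
  simp_rw [oscTest_add, mul_add]
  rw [integral_add (integrable_mul_oscTest h hm hc hs h1) (integrable_mul_oscTest h hm hc hs h2)]
  ring

/-- Two integrations by parts leave thirteen integrals, all with a profile of size 1/(1+y²). No
pairing uses more than two scaling derivatives, shared between h and the amplitude. -/
theorem integral_wave_one {h h₁ h₂ : L2} (hw : WeakScale h h₁) (hw₁ : WeakScale h₁ h₂)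
    (hm : ContDiff ℝ ∞ m) (hc : HasCompactSupport m) (hs : tsupport m ⊆ offAxis) :
    let I := fun (g : L2) (n : E3 → ℝ) (s : ℝ → ℝ) => ∫ ξ, g ξ * oscTest t x n (wave s) ξ
    let w₁ := euler weight
    let w₂ := euler (euler weight)
    let m₁ := radial m
    let m₂ := radial (radial m)
    I h m (fun _ => 1) = I h m weight + (I h₁ m w₁ - I h m₁ w₁ - I h m w₂) +
      (I h₁ m weight - I h m₁ weight - I h m w₁) -
      (I h₂ m weight - I h₁ m₁ weight - I h₁ m w₁) +
      (I h₁ m₁ weight - I h m₂ weight - I h m₁ w₁) := by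
  intro I w₁ w₂ m₁ m₂
  have c0 := contDiff_weight
  have c1 := contDiff_euler c0
  have hm₁ := contDiff_radial hm
  have ts := tsupport_radial_subset m
  have hc₁ : HasCompactSupport m₁ := hc.of_isClosed_subset (isClosed_tsupport _) ts
  have hs₁ := ts.trans hs
  have y0 := contDiff_waveY c0
  have y1 := contDiff_waveY c1
  have he := funext (eulerC_waveY c0)
  have ce : ContDiff ℝ ∞ (eulerC (waveY weight)) := by
    rw [he]
    exact (y1.add y0).sub ((Complex.ofRealCLM.contDiff.pow 2).mul (contDiff_wave c0))
  have split : I h m (fun _ => 1) = I h m weight +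
      ((∫ ξ, h ξ * oscTest t x m (waveY w₁) ξ) + (∫ ξ, h ξ * oscTest t x m (waveY weight) ξ) -
        ∫ ξ, h ξ * oscTest t x m (eulerC (waveY weight)) ξ) := by
    have i0 := integrable_mul_oscTest (t := t) (x := x) h hm hc hs (contDiff_wave c0)
    have i1 := integrable_mul_oscTest (t := t) (x := x) h hm hc hs y1
    have i2 := integrable_mul_oscTest (t := t) (x := x) h hm hc hs y0
    have i3 := integrable_mul_oscTest (t := t) (x := x) h hm hc hs ce
    simp only [I]
    have i12 : Integrable fun ξ => h ξ * oscTest t x m (waveY w₁) ξ +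
        h ξ * oscTest t x m (waveY weight) ξ := i1.add i2
    have i123 : Integrable fun ξ => h ξ * oscTest t x m (waveY w₁) ξ +
        h ξ * oscTest t x m (waveY weight) ξ -
        h ξ * oscTest t x m (eulerC (waveY weight)) ξ := i12.sub i3
    rw [← integral_add i1 i2, ← integral_sub i12 i3, ← integral_add i0 i123]
    congr 1
    ext ξ
    simp only [oscTest, wave_one_eq, w₁]
    ring
  have t1 := hw.oscTest t x hm hc hs y0 ce
  have t2 := integral_waveY_of_weakScale (t := t) (x := x) hw hm hc hs c1
  have t3 := integral_waveY_of_weakScale (t := t) (x := x) hw hm hc hs c0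
  have t4 := integral_waveY_of_weakScale (t := t) (x := x) hw₁ hm hc hs c0
  have t5 := integral_waveY_of_weakScale (t := t) (x := x) hw hm₁ hc₁ hs₁ c0
  have t1' : ∫ ξ, h ξ * oscTest t x m (eulerC (waveY weight)) ξ =
      (∫ ξ, h₁ ξ * oscTest t x m (waveY weight) ξ) -
        ∫ ξ, h ξ * oscTest t x (radial m) (waveY weight) ξ := by
    rw [t1]
    ring
  rw [split, t1', t2, t3, t4, t5]
  simp only [I, m₁, m₂, w₁, w₂]
  ring

end Pairing

theorem oscIntegral_eq (m : E3 → ℝ) (t : ℝ) (x : E3) (h : E3 → ℂ) :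
    oscIntegral m t x h = ∫ ξ, h ξ * oscTest t x m (wave fun _ => 1) ξ := by
  rw [oscIntegral]
  congr 1
  ext ξ
  rw [oscTest, wave]
  push_cast
  rw [add_mul, Complex.exp_add]
  ring

/-- The pointwise bound at frequencies of size at least `1 / a`. -/
theorem enorm_le_of_pointwise {a b c Cp : ℝ} {D : ℝ≥0∞} (ha : 0 < a) (hCp : 0 ≤ Cp) {h : E3 → ℂ}
    {ξ : E3} (hξ : ξ ∈ shell a b c) (hp : ‖h ξ‖ₑ ≤ ENNReal.ofReal (Cp / (‖ξ‖ * √‖ξ‖)) * D) :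
    ‖h ξ‖ₑ ≤ ENNReal.ofReal (Cp * (a * √a)) * D := by
  refine hp.trans ?_
  gcongr ENNReal.ofReal ?_ * _
  have h1 : 1 / a ≤ ‖ξ‖ := by
    rw [div_le_iff₀ ha, mul_comm]; exact hξ.1.1
  have h2 : √(1 / a) ≤ √‖ξ‖ := Real.sqrt_le_sqrt h1
  have h0 : 0 < 1 / a := by positivity
  have h3 : 0 < √(1 / a) := Real.sqrt_pos.2 h0
  calc Cp / (‖ξ‖ * √‖ξ‖) ≤ Cp / (1 / a * √(1 / a)) := by gcongr
    _ = Cp * (a * √a) := by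
      rw [Real.sqrt_div zero_le_one, Real.sqrt_one]
      field_simp

theorem enorm_integral_oscTest_le {a b c Cp K t : ℝ} {D : ℝ≥0∞} (ha : 0 < a) (hab : a ≤ b)
    (hac : a ≤ c) (hCp : 0 ≤ Cp) (hK : 0 ≤ K) {x : E3} (hx : 0 < ‖x‖) {h : L2}
    (hp : ∀ᵐ ξ, ‖h ξ‖ₑ ≤ ENNReal.ofReal (Cp / (‖ξ‖ * √‖ξ‖)) * D) {m : E3 → ℝ}
    (hm : tsupport m ⊆ shell a b c) (hmK : ∀ ξ, |m ξ| ≤ K) {s : ℝ → ℝ}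
    (hs : ∀ y, |s y| ≤ 4 * weight y) :
    ‖∫ ξ, h ξ * oscTest t x m (wave s) ξ‖ₑ ≤
      ENNReal.ofReal (128 * (K * Cp) * (√a / (b * ‖x‖))) * D := by
  have hb : 0 < b := ha.trans_le hab
  have pt : ∀ᵐ ξ, ‖h ξ * oscTest t x m (wave s) ξ‖ₑ ≤ (shell a b c).indicator
      (fun ξ => ENNReal.ofReal (Cp * (a * √a) * (K * 4)) * D *
        ENNReal.ofReal (1 + (2 * Real.pi * inner ℝ ξ x) ^ 2)⁻¹) ξ := by
    filter_upwards [hp] with ξ hξ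
    by_cases hin : ξ ∈ shell a b c
    · rw [indicator_of_mem hin, enorm_mul]
      have h1 := enorm_le_of_pointwise ha hCp hin hξ
      have h2 : ‖oscTest t x m (wave s) ξ‖ₑ ≤ ENNReal.ofReal (K * 4) *
          ENNReal.ofReal (1 + (2 * Real.pi * inner ℝ ξ x) ^ 2)⁻¹ := by
        rw [← ofReal_norm, ← ENNReal.ofReal_mul (by positivity)]
        refine ENNReal.ofReal_le_ofReal ?_
        rw [oscTest, wave, norm_mul, norm_mul, norm_mul, Complex.norm_exp_ofReal_mul_I,
          Complex.norm_exp_ofReal_mul_I, Complex.norm_real, Complex.norm_real, one_mul, mul_one,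
          Real.norm_eq_abs, Real.norm_eq_abs]
        have := hs (2 * Real.pi * inner ℝ ξ x)
        calc |s (2 * Real.pi * inner ℝ ξ x)| * |m ξ| ≤
            4 * weight (2 * Real.pi * inner ℝ ξ x) * K :=
              mul_le_mul this (hmK ξ) (abs_nonneg _) ((abs_nonneg _).trans this)
          _ = _ := by rw [weight]; ring
      calc ‖h ξ‖ₑ * ‖oscTest t x m (wave s) ξ‖ₑ ≤ ENNReal.ofReal (Cp * (a * √a)) * D *
            (ENNReal.ofReal (K * 4) *
              ENNReal.ofReal (1 + (2 * Real.pi * inner ℝ ξ x) ^ 2)⁻¹) := mul_le_mul' h1 h2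
        _ = _ := by
          rw [ENNReal.ofReal_mul (p := Cp * (a * √a)) (by positivity)]
          ring
    · have : m ξ = 0 := image_eq_zero_of_notMem_tsupport fun h => hin (hm h)
      simp [oscTest, this]
  refine (enorm_integral_le_lintegral_enorm _).trans ((lintegral_mono_ae pt).trans ?_)
  rw [lintegral_indicator (isClosed_shell a b c).measurableSet,
    lintegral_const_mul _ (by fun_prop)]
  refine (mul_le_mul_right (lintegral_shell_le ha hab hac hx) _).trans (le_of_eq ?_)
  rw [mul_right_comm, ← ENNReal.ofReal_mul (by positivity)]
  congr 2
  have hsa : √a * √a = a := Real.mul_self_sqrt ha.le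
  field_simp
  ring

theorem oscIntegral_far {χ : RadialBump} {K a b c Cp t : ℝ} {D : ℝ≥0∞} (ha : 0 < a) (hab : a ≤ b)
    (hac : a ≤ c) (hCp : 0 ≤ Cp) (hK : 0 ≤ K) (k0 : ∀ ξ, |χ.symbol a b c ξ| ≤ K)
    (k1 : ∀ ξ, |radial (χ.symbol a b c) ξ| ≤ K)
    (k2 : ∀ ξ, |radial (radial (χ.symbol a b c)) ξ| ≤ K) {x : E3} (hx : 0 < ‖x‖)
    {h h₁ h₂ : L2} (hw : WeakScale h h₁) (hw₁ : WeakScale h₁ h₂)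
    (hp : ∀ᵐ ξ, ‖h ξ‖ₑ ≤ ENNReal.ofReal (Cp / (‖ξ‖ * √‖ξ‖)) * D)
    (hp₁ : ∀ᵐ ξ, ‖h₁ ξ‖ₑ ≤ ENNReal.ofReal (Cp / (‖ξ‖ * √‖ξ‖)) * D)
    (hp₂ : ∀ᵐ ξ, ‖h₂ ξ‖ₑ ≤ ENNReal.ofReal (Cp / (‖ξ‖ * √‖ξ‖)) * D) :
    ‖oscIntegral (χ.symbol a b c) t x h‖ₑ ≤
      ENNReal.ofReal (1664 * (K * Cp) * (√a / (b * ‖x‖))) * D := by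
  have hb : 0 < b := ha.trans_le hab
  have hc : 0 < c := ha.trans_le hac
  have A := χ.annular_phi
  have hm : ContDiff ℝ ∞ (χ.symbol a b c) := contDiff_amp ha hb hc A A A
  have ts : tsupport (χ.symbol a b c) ⊆ shell a b c := tsupport_amp_subset ha hb hc A A A
  have hcs : HasCompactSupport (χ.symbol a b c) :=
    (isCompact_shell ha).of_isClosed_subset (isClosed_tsupport _) ts
  have ts₁ := (tsupport_radial_subset (χ.symbol a b c)).trans ts
  have ts₂ := (tsupport_radial_subset (radial (χ.symbol a b c))).trans ts₁
  have s0 : ∀ y, |weight y| ≤ 4 * weight y := fun y => (abs_weight_le y).1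
  have s1 : ∀ y, |euler weight y| ≤ 4 * weight y := fun y => (abs_weight_le y).2.1
  have s2 : ∀ y, |euler (euler weight) y| ≤ 4 * weight y := fun y => (abs_weight_le y).2.2
  have B := fun {g : L2} (hg : ∀ᵐ ξ, ‖g ξ‖ₑ ≤ ENNReal.ofReal (Cp / (‖ξ‖ * √‖ξ‖)) * D)
    {m : E3 → ℝ} (hm : tsupport m ⊆ shell a b c) (hmK : ∀ ξ, |m ξ| ≤ K) {s : ℝ → ℝ}
    (hs : ∀ y, |s y| ≤ 4 * weight y) =>
    enorm_integral_oscTest_le (t := t) ha hab hac hCp hK hx hg hm hmK hs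
  have key := integral_wave_one (t := t) (x := x) hw hw₁ hm hcs (ts.trans (shell_subset_offAxis hb))
  simp only at key
  rw [oscIntegral_eq, key]
  set X := ENNReal.ofReal (128 * (K * Cp) * (√a / (b * ‖x‖))) * D with hX
  -- Thirteen terms, each bounded by X; 13 · 128 = 1664.
  have e13 : ENNReal.ofReal (1664 * (K * Cp) * (√a / (b * ‖x‖))) * D =
      X + (X + X + X) + (X + X + X) + (X + X + X) + (X + X + X) := by
    have : X + (X + X + X) + (X + X + X) + (X + X + X) + (X + X + X) = ENNReal.ofReal 13 * X := by
      rw [ENNReal.ofReal_ofNat]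
      ring
    rw [this, hX, ← mul_assoc (ENNReal.ofReal 13), ← ENNReal.ofReal_mul (by norm_num)]
    congr 2
    ring
  rw [e13]
  have tri : ∀ {u v w : ℂ}, ‖u‖ₑ ≤ X → ‖v‖ₑ ≤ X → ‖w‖ₑ ≤ X → ‖u - v - w‖ₑ ≤ X + X + X :=
    fun hu hv hw => (enorm_sub_le).trans (add_le_add ((enorm_sub_le).trans (add_le_add hu hv)) hw)
  refine (enorm_add_le _ _).trans (add_le_add ((enorm_sub_le).trans (add_le_add
    ((enorm_add_le _ _).trans (add_le_add ((enorm_add_le _ _).trans (add_le_add ?_ ?_)) ?_)) ?_)) ?_)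
  · exact B hp ts k0 s0
  · exact tri (B hp₁ ts k0 s1) (B hp ts₁ k1 s1) (B hp ts k0 s2)
  · exact tri (B hp₁ ts k0 s0) (B hp ts₁ k1 s0) (B hp ts k0 s1)
  · exact tri (B hp₂ ts k0 s0) (B hp₁ ts₁ k1 s0) (B hp₁ ts k0 s1)
  · exact tri (B hp₁ ts₁ k1 s0) (B hp ts₂ k2 s0) (B hp ts₁ k1 s1)

/-! ### Integration by parts along the polar field -/

theorem polarField_zero (ξ : E3) : polarField ξ 0 = ξ 2 * ξ 0 / axisDist ξ := rfl

theorem polarField_one (ξ : E3) : polarField ξ 1 = ξ 2 * ξ 1 / axisDist ξ := rfl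

theorem polarField_two (ξ : E3) : polarField ξ 2 = -axisDist ξ := rfl

theorem real_inner_eq (ξ x : E3) : inner ℝ ξ x = ξ 0 * x 0 + ξ 1 * x 1 + ξ 2 * x 2 := by
  rw [PiLp.inner_apply, Fin.sum_univ_three]
  simp only [RCLike.inner_apply, conj_trivial]
  ring

theorem norm_polarField_le {ξ : E3} (hξ : ξ ∈ offAxis) : ‖polarField ξ‖ ≤ ‖ξ‖ := by
  have hr := mem_offAxis_iff.1 hξ
  refine abs_le_of_sq_le_sq' ?_ (norm_nonneg _) |>.2
  rw [norm_sq_eq, norm_sq_eq, polarField_zero, polarField_one, polarField_two, ← axisDist_sq]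
  have : (ξ 2 * ξ 0 / axisDist ξ) ^ 2 + (ξ 2 * ξ 1 / axisDist ξ) ^ 2 = ξ 2 ^ 2 := by
    rw [div_pow, div_pow, ← add_div, div_eq_iff (by positivity), axisDist_sq]
    ring
  rw [this, neg_sq, add_comm]

/-- The phase `2π x·ξ + tΛ(ξ)`. -/
def phase (t : ℝ) (x ξ : E3) : ℝ := 2 * Real.pi * inner ℝ ξ x + t * Lam ξ

/-- The polar derivative of the phase. -/
def polarPhase (t : ℝ) (x ξ : E3) : ℝ :=
  2 * Real.pi * inner ℝ (polarField ξ) x - t * (axisDist ξ / ‖ξ‖)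

section LineDerivatives

variable {ξ : E3}

theorem hasDerivAt_line_coord (ξ v : E3) (i : Fin 3) :
    HasDerivAt (fun s : ℝ => (ξ + s • v) i) (v i) 0 := by
  have := ((hasDerivAt_id (0 : ℝ)).mul_const (v i)).const_add (ξ i)
  simpa using this

theorem hasDerivAt_line_axisDist (hξ : ξ ∈ offAxis) :
    HasDerivAt (fun s : ℝ => axisDist (ξ + s • polarField ξ)) (ξ 2) 0 := by
  have hr := mem_offAxis_iff.1 hξ
  have h : HasDerivAt (fun s : ℝ => axisDist (ξ + s • polarField ξ)) _ 0 :=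
    (hasFDerivAt_axisDist hξ).hasLineDerivAt (polarField ξ)
  refine h.congr_deriv ?_
  simp [polarField_zero, polarField_one]
  field_simp
  rw [axisDist_sq]
  ring

theorem hasDerivAt_line_norm (hξ : ξ ∈ offAxis) :
    HasDerivAt (fun s : ℝ => ‖ξ + s • polarField ξ‖) 0 0 := by
  have hr := mem_offAxis_iff.1 hξ
  have h : HasDerivAt (fun s : ℝ => ‖ξ + s • polarField ξ‖) _ 0 :=
    (hasFDerivAt_norm (norm_pos_iff.1 (norm_pos_of_offAxis hξ))).hasLineDerivAt (polarField ξ)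
  refine h.congr_deriv ?_
  have e : inner ℝ ξ (polarField ξ) = 0 := by
    rw [real_inner_eq, polarField_zero, polarField_one, polarField_two]
    field_simp
    rw [axisDist_sq]
    ring
  simp [e]

theorem hasLineDerivAt_phase (hξ : ξ ∈ offAxis) (t : ℝ) (x : E3) :
    HasLineDerivAt ℝ (phase t x) (polarPhase t x ξ) ξ (polarField ξ) := by
  have hN := norm_pos_of_offAxis hξ
  have c := hasDerivAt_line_coord ξ (polarField ξ)
  have h1 := (((c 0).mul_const (x 0)).fun_add ((c 1).mul_const (x 1))).fun_add
    ((c 2).mul_const (x 2))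
  have h2 := (c 2).fun_div (hasDerivAt_line_norm hξ) (by simpa using hN.ne')
  have h := (h1.const_mul (2 * Real.pi)).fun_add (h2.const_mul t)
  simp_rw [← real_inner_eq] at h
  refine h.congr_deriv ?_
  rw [polarPhase]
  simp [polarField_two]
  field_simp
  ring

/-- On a meridian circle the phase is a linear combination of cos φ and sin φ, so its second
derivative is minus itself. The remainder of the integration by parts is thus controlled by the
phase. -/
theorem hasLineDerivAt_polarPhase (hξ : ξ ∈ offAxis) (t : ℝ) (x : E3) :
    HasLineDerivAt ℝ (polarPhase t x) (-phase t x ξ) ξ (polarField ξ) := by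
  have hN := norm_pos_of_offAxis hξ
  have hr := mem_offAxis_iff.1 hξ
  have hr' : axisDist (ξ + (0 : ℝ) • polarField ξ) ≠ 0 := by simpa using hr.ne'
  have c := hasDerivAt_line_coord ξ (polarField ξ)
  have r := hasDerivAt_line_axisDist hξ
  have h1 := (((((c 2).fun_mul (c 0)).fun_div r hr').mul_const (x 0)).fun_add
    ((((c 2).fun_mul (c 1)).fun_div r hr').mul_const (x 1))).fun_add (r.fun_neg.mul_const (x 2))
  have h2 := r.fun_div (hasDerivAt_line_norm hξ) (by simpa using hN.ne')
  have h := (h1.const_mul (2 * Real.pi)).fun_sub (h2.const_mul t)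
  simp_rw [← polarField_zero, ← polarField_one, ← polarField_two, ← real_inner_eq] at h
  refine h.congr_deriv ?_
  rw [phase, real_inner_eq, Lam]
  simp [polarField_zero, polarField_one, polarField_two]
  field_simp
  ring

end LineDerivatives

theorem contDiffOn_phase (t : ℝ) (x : E3) : ContDiffOn ℝ ∞ (phase t x) offAxis :=
  (contDiff_inner_left x).contDiffOn.add (contDiffOn_const.mul contDiffOn_Lam)

theorem contDiffOn_polarPhase (t : ℝ) (x : E3) : ContDiffOn ℝ ∞ (polarPhase t x) offAxis := by
  have hr : ContDiffOn ℝ ∞ axisDist offAxis := contDiffOn_axisDist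
  have r0 : ∀ ξ ∈ offAxis, axisDist ξ ≠ 0 := fun ξ hξ => (mem_offAxis_iff.1 hξ).ne'
  have hn : ContDiffOn ℝ ∞ (fun ξ : E3 => ‖ξ‖) offAxis := fun ξ hξ =>
    (contDiffAt_norm ℝ (norm_pos_iff.1 (norm_pos_of_offAxis hξ))).contDiffWithinAt
  have hc : ∀ i, ContDiffOn ℝ ∞ (fun ξ : E3 => ξ i) offAxis := fun i => (contDiff_coord i).contDiffOn
  have h : ContDiffOn ℝ ∞ (fun ξ => 2 * Real.pi * (ξ 2 * ξ 0 / axisDist ξ * x 0 +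
      ξ 2 * ξ 1 / axisDist ξ * x 1 + -axisDist ξ * x 2) - t * (axisDist ξ / ‖ξ‖)) offAxis :=
    (contDiffOn_const.mul ((((((hc 2).mul (hc 0)).div hr r0).mul contDiffOn_const).add
      ((((hc 2).mul (hc 1)).div hr r0).mul contDiffOn_const)).add
      (hr.neg.mul contDiffOn_const))).sub
      (contDiffOn_const.mul (hr.div hn fun ξ hξ => (norm_pos_of_offAxis hξ).ne'))
  refine h.congr fun ξ _ => ?_
  rw [polarPhase, real_inner_eq, polarField_zero, polarField_one, polarField_two]

/-- The primitive `e^{iΨ} m / (i VΨ)` of `e^{iΨ} m` to leading order. -/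
def polarTest (t : ℝ) (x : E3) (m : E3 → ℝ) (ξ : E3) : ℂ :=
  Complex.exp ((phase t x ξ : ℂ) * Complex.I) * (-Complex.I * ((m ξ / polarPhase t x ξ : ℝ) : ℂ))

theorem tsupport_polarTest_subset (t : ℝ) (x : E3) (m : E3 → ℝ) :
    tsupport (polarTest t x m) ⊆ tsupport m := by
  refine closure_mono fun ξ hξ => ?_
  intro h
  exact hξ (by simp [polarTest, h])

theorem contDiff_polarTest {t : ℝ} {x : E3} {m : E3 → ℝ} (hm : ContDiff ℝ ∞ m)
    (hs : tsupport m ⊆ offAxis) (hP : ∀ ξ ∈ tsupport m, polarPhase t x ξ ≠ 0) :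
    ContDiff ℝ ∞ (polarTest t x m) := by
  have hcP := contDiffOn_polarPhase t x
  have hU : IsOpen (offAxis ∩ polarPhase t x ⁻¹' {0}ᶜ) :=
    hcP.continuousOn.isOpen_inter_preimage isOpen_offAxis isOpen_compl_singleton
  refine contDiff_of_tsupport_subset hU ?_ ((tsupport_polarTest_subset t x m).trans
    fun ξ hξ => ⟨hs hξ, hP ξ hξ⟩)
  have h1 : ContDiffOn ℝ ∞ (fun ξ => Complex.exp ((phase t x ξ : ℂ) * Complex.I)) offAxis :=
    ((Complex.ofRealCLM.contDiff.comp_contDiffOn (contDiffOn_phase t x)).mul contDiffOn_const).cexp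
  exact (h1.mono inter_subset_left).mul (contDiffOn_const.mul
    (Complex.ofRealCLM.contDiff.comp_contDiffOn
      (hm.contDiffOn.div (hcP.mono inter_subset_left) fun ξ hξ => hξ.2)))

theorem fderiv_polarTest {t : ℝ} {x : E3} {m : E3 → ℝ} (hm : ContDiff ℝ ∞ m)
    (hs : tsupport m ⊆ offAxis) (hP : ∀ ξ ∈ tsupport m, polarPhase t x ξ ≠ 0) {ξ : E3}
    (hξ : ξ ∈ offAxis) (hPξ : polarPhase t x ξ ≠ 0) :
    fderiv ℝ (polarTest t x m) ξ (polarField ξ) =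
      Complex.exp ((phase t x ξ : ℂ) * Complex.I) * (m ξ : ℂ) +
      Complex.exp ((phase t x ξ : ℂ) * Complex.I) * (-Complex.I *
        ((fderiv ℝ m ξ (polarField ξ) / polarPhase t x ξ +
          m ξ * phase t x ξ / polarPhase t x ξ ^ 2 : ℝ) : ℂ)) := by
  have h0 : HasLineDerivAt ℝ (polarTest t x m) _ ξ (polarField ξ) :=
    (((contDiff_polarTest hm hs hP).differentiable (by simp) ξ).hasFDerivAt).hasLineDerivAt _
  have h1 : HasDerivAt _ _ _ := hasLineDerivAt_phase hξ t x
  have h2 : HasDerivAt _ _ _ := hasLineDerivAt_polarPhase hξ t x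
  have h3 : HasLineDerivAt ℝ m _ ξ (polarField ξ) :=
    ((hm.differentiable (by simp) ξ).hasFDerivAt).hasLineDerivAt _
  have h3' : HasDerivAt _ _ _ := h3
  have h4 := (h1.ofReal_comp.mul_const Complex.I).cexp.fun_mul
    ((h3'.fun_div h2 (by simpa using hPξ)).ofReal_comp.const_mul (-Complex.I))
  have h5 : HasLineDerivAt ℝ (polarTest t x m) _ ξ (polarField ξ) := h4
  rw [h0.unique h5]
  have hPC : (polarPhase t x ξ : ℂ) ≠ 0 := by exact_mod_cast hPξ
  simp only [zero_smul, add_zero]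
  push_cast
  field_simp
  linear_combination (-(m ξ : ℂ) * polarPhase t x ξ ^ 2) * Complex.I_sq

/-! ### The regime of small `|x|` -/

/-- The threshold on ‖x‖ makes the contribution of x·ξ at most half of t|ξ_h|/|ξ|, which is at least
t a/(4b) on the shell. -/
theorem le_abs_polarPhase {a b c t : ℝ} (ha : 0 < a) (hb : 0 < b) (ht : 0 < t) {x : E3}
    (hx : 64 * Real.pi * ‖x‖ * b ≤ t * a ^ 2) {ξ : E3} (hξ : ξ ∈ shell a b c) :
    t * a / (8 * b) ≤ |polarPhase t x ξ| := by
  have hoff := shell_subset_offAxis hb hξ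
  have hN := norm_pos_of_offAxis hoff
  have h1 : ‖ξ‖ ≤ 4 / a := by
    rw [le_div_iff₀ ha, mul_comm]; exact hξ.1.2
  have h2 : 1 / b ≤ axisDist ξ := by
    rw [div_le_iff₀ hb, mul_comm]; exact hξ.2.1.1
  have h3 : a / (4 * b) ≤ axisDist ξ / ‖ξ‖ := by
    calc a / (4 * b) = (1 / b) / (4 / a) := by field_simp
      _ ≤ axisDist ξ / ‖ξ‖ := by
        have := axisDist_nonneg ξ
        gcongr
  have h4 : |2 * Real.pi * inner ℝ (polarField ξ) x| ≤ t * a / (8 * b) := by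
    rw [abs_mul, abs_of_pos Real.two_pi_pos]
    have e1 : |inner ℝ (polarField ξ) x| ≤ 4 / a * ‖x‖ :=
      (abs_real_inner_le_norm _ _).trans (by
        gcongr
        exact (norm_polarField_le hoff).trans h1)
    calc 2 * Real.pi * |inner ℝ (polarField ξ) x| ≤ 2 * Real.pi * (4 / a * ‖x‖) := by gcongr
      _ = (64 * Real.pi * ‖x‖ * b) / (8 * a * b) := by field_simp; ring
      _ ≤ t * a ^ 2 / (8 * a * b) := by gcongr
      _ = t * a / (8 * b) := by field_simp
  have h5 : t * (a / (4 * b)) ≤ t * (axisDist ξ / ‖ξ‖) := by gcongr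
  have h6 : t * (a / (4 * b)) = 2 * (t * a / (8 * b)) := by field_simp; norm_num
  rw [polarPhase, abs_sub_comm]
  have := neg_abs_le (t * (axisDist ξ / ‖ξ‖) - 2 * Real.pi * inner ℝ (polarField ξ) x)
  have := le_abs_self (t * (axisDist ξ / ‖ξ‖) - 2 * Real.pi * inner ℝ (polarField ξ) x)
  have := (abs_le.1 h4).2
  linarith

theorem abs_phase_le {a b c t : ℝ} (ha : 0 < a) (hab : a ≤ b) (ht : 0 < t) {x : E3}
    (hx : 64 * Real.pi * ‖x‖ * b ≤ t * a ^ 2) {ξ : E3} (hξ : ξ ∈ shell a b c) :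
    |phase t x ξ| ≤ 2 * t := by
  have hb : 0 < b := ha.trans_le hab
  have hN := norm_pos_of_offAxis (shell_subset_offAxis hb hξ)
  have h1 : ‖ξ‖ ≤ 4 / a := by
    rw [le_div_iff₀ ha, mul_comm]; exact hξ.1.2
  have h2 : |Lam ξ| ≤ 1 := by
    rw [Lam, abs_div, abs_norm, div_le_one hN]
    exact abs_coord_le ξ 2
  have h3 : |2 * Real.pi * inner ℝ ξ x| ≤ t := by
    rw [abs_mul, abs_of_pos Real.two_pi_pos]
    have e1 : |inner ℝ ξ x| ≤ 4 / a * ‖x‖ := (abs_real_inner_le_norm _ _).trans (by gcongr)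
    calc 2 * Real.pi * |inner ℝ ξ x| ≤ 2 * Real.pi * (4 / a * ‖x‖) := by gcongr
      _ = (64 * Real.pi * ‖x‖ * b) / (8 * a * b) := by field_simp; ring
      _ ≤ t * a ^ 2 / (8 * a * b) := by gcongr
      _ = t * a / (8 * b) := by field_simp
      _ ≤ t := by
        rw [div_le_iff₀ (by positivity)]
        nlinarith
  calc |phase t x ξ| ≤ |2 * Real.pi * inner ℝ ξ x| + |t * Lam ξ| := abs_add_le _ _
    _ ≤ t + t * 1 := by
      rw [abs_mul t, abs_of_pos ht]
      gcongr
    _ = 2 * t := by ring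

theorem volume_shell_le {a b c : ℝ} (hb : 0 < b) (hc : 0 < c) :
    volume (shell a b c) ≤ ENNReal.ofReal (128 / (b ^ 2 * c)) := by
  refine (measure_mono (shell_subset_box hb hc)).trans ?_
  rw [volume_box (by positivity) (by positivity)]
  refine ENNReal.ofReal_le_ofReal (le_of_eq ?_)
  field_simp
  norm_num

/-- The integral of a pointwise bounded function against a function supported in the shell. -/
theorem enorm_integral_shell_le {a b c Cp M : ℝ} {D : ℝ≥0∞} (ha : 0 < a) (hb : 0 < b) (hc : 0 < c)
    (hCp : 0 ≤ Cp) {h G : E3 → ℂ}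
    (hp : ∀ᵐ ξ, ‖h ξ‖ₑ ≤ ENNReal.ofReal (Cp / (‖ξ‖ * √‖ξ‖)) * D)
    (hG : ∀ ξ, ‖G ξ‖ ≤ (shell a b c).indicator (fun _ => M) ξ) (hM : 0 ≤ M) :
    ‖∫ ξ, h ξ * G ξ‖ₑ ≤ ENNReal.ofReal (Cp * (a * √a) * M * (128 / (b ^ 2 * c))) * D := by
  have pt : ∀ᵐ ξ, ‖h ξ * G ξ‖ₑ ≤ (shell a b c).indicator
      (fun _ => ENNReal.ofReal (Cp * (a * √a) * M) * D) ξ := by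
    filter_upwards [hp] with ξ hξ
    have hGξ := hG ξ
    by_cases hin : ξ ∈ shell a b c
    · rw [indicator_of_mem hin] at hGξ ⊢
      rw [enorm_mul, ENNReal.ofReal_mul (by positivity), mul_right_comm]
      refine mul_le_mul' (enorm_le_of_pointwise ha hCp hin hξ) ?_
      rw [← ofReal_norm]
      exact ENNReal.ofReal_le_ofReal hGξ
    · rw [indicator_of_notMem hin] at hGξ ⊢
      simp [norm_le_zero_iff.1 hGξ]
  refine (enorm_integral_le_lintegral_enorm _).trans ((lintegral_mono_ae pt).trans ?_)
  rw [lintegral_indicator (isClosed_shell a b c).measurableSet, setLIntegral_const,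
    ENNReal.ofReal_mul (p := Cp * (a * √a) * M) (by positivity), mul_right_comm]
  gcongr
  exact volume_shell_le hb hc

/-- One integration by parts against e^{iΨ} m/(i ∂_φΨ). The term with ∂_φ h is estimated by
Cauchy-Schwarz, since w is only known in L²; the others use the pointwise bound and the volume of
the shell. -/
theorem oscIntegral_near {χ : RadialBump} {K a b c Cp t : ℝ} {D : ℝ≥0∞} (ha : 0 < a) (hab : a ≤ b)
    (hac : a ≤ c) (hCp : 0 ≤ Cp) (hK : 0 ≤ K) (ht : 0 < t) (k0 : ∀ ξ, |χ.symbol a b c ξ| ≤ K)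
    (k1 : ∀ ξ ∈ shell a b c, |fderiv ℝ (χ.symbol a b c) ξ (polarField ξ)| ≤ K * (b / c + c / b))
    {x : E3} (hx : 64 * Real.pi * ‖x‖ * b ≤ t * a ^ 2) {h w : L2} (hw : WeakPolar h w)
    (hwD : ‖w‖ₑ ≤ 2 * D) (hp : ∀ᵐ ξ, ‖h ξ‖ₑ ≤ ENNReal.ofReal (Cp / (‖ξ‖ * √‖ξ‖)) * D) :
    ‖oscIntegral (χ.symbol a b c) t x h‖ₑ ≤
      ENNReal.ofReal (22528 * (K * (1 + Cp)) / (t * (a * √a))) * D := by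
  have hb : 0 < b := ha.trans_le hab
  have hc : 0 < c := ha.trans_le hac
  have A := χ.annular_phi
  set m := χ.symbol a b c with hmdef
  have hm : ContDiff ℝ ∞ m := contDiff_amp ha hb hc A A A
  have ts : tsupport m ⊆ shell a b c := tsupport_amp_subset ha hb hc A A A
  have hs := ts.trans (shell_subset_offAxis hb)
  have hcs : HasCompactSupport m := (isCompact_shell ha).of_isClosed_subset (isClosed_tsupport _) ts
  set δ := t * a / (8 * b) with hδdef
  have hδ : 0 < δ := by positivity
  have hPδ : ∀ ξ ∈ shell a b c, δ ≤ |polarPhase t x ξ| := fun ξ hξ =>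
    le_abs_polarPhase ha hb ht hx hξ
  have hP : ∀ ξ ∈ shell a b c, polarPhase t x ξ ≠ 0 := fun ξ hξ =>
    abs_pos.1 (hδ.trans_le (hPδ ξ hξ))
  have hP' : ∀ ξ ∈ tsupport m, polarPhase t x ξ ≠ 0 := fun ξ hξ => hP ξ (ts hξ)
  have B := contDiff_polarTest hm hs hP'
  have Bts := tsupport_polarTest_subset t x m
  have Bcs : HasCompactSupport (polarTest t x m) :=
    hcs.of_isClosed_subset (isClosed_tsupport _) Bts
  obtain ⟨T1, T2⟩ := polar_test B Bcs (Bts.trans hs)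
  have hparts := hw (polarTest t x m) B Bcs (Bts.trans hs)
  set E : E3 → ℂ := fun ξ => Complex.exp ((phase t x ξ : ℂ) * Complex.I) * (m ξ : ℂ) with hE
  set T : E3 → ℂ := fun ξ => fderiv ℝ (polarTest t x m) ξ (polarField ξ) +
    ((ξ 2 / axisDist ξ : ℝ) : ℂ) * polarTest t x m ξ with hT
  have hEcont : Continuous E := by
    have : ContDiff ℝ ∞ E := by
      refine contDiff_of_tsupport_subset isOpen_offAxis ?_
        (((closure_mono fun ξ hξ => ?_ : tsupport E ⊆ tsupport m)).trans hs)
      · exact (((Complex.ofRealCLM.contDiff.comp_contDiffOn (contDiffOn_phase t x)).mul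
          contDiffOn_const).cexp).mul (Complex.ofRealCLM.contDiff.comp hm).contDiffOn
      · intro h0
        exact hξ (by simp [hE, h0])
    exact this.continuous
  have hEcs : HasCompactSupport E := by
    refine HasCompactSupport.intro hcs.isCompact fun ξ hξ => ?_
    simp [hE, image_eq_zero_of_notMem_tsupport hξ]
  have iE := integrable_L2_mul h hEcont hEcs
  have iT := integrable_L2_mul h T1 T2
  have split : oscIntegral m t x h = -(∫ ξ, w ξ * polarTest t x m ξ) -
      ∫ ξ, h ξ * (T ξ - E ξ) := by
    have e1 : oscIntegral m t x h = ∫ ξ, h ξ * E ξ := rfl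
    have e2 : ∫ ξ, h ξ * (T ξ - E ξ) = (∫ ξ, h ξ * T ξ) - ∫ ξ, h ξ * E ξ := by
      rw [← integral_sub iT iE]
      simp_rw [mul_sub]
    rw [e1, e2, hparts]
    ring
  have e0 : ∀ ξ ∉ shell a b c, m ξ = 0 := fun ξ hξ =>
    image_eq_zero_of_notMem_tsupport fun h => hξ (ts h)
  have hQ : ∀ ξ ∈ shell a b c, |m ξ / polarPhase t x ξ| ≤ K / δ := fun ξ hξ => by
    rw [abs_div]
    exact div_le_div₀ hK (k0 ξ) hδ (hPδ ξ hξ)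
  have hnB : ∀ ξ, ‖polarTest t x m ξ‖ = |m ξ / polarPhase t x ξ| := fun ξ => by
    rw [polarTest, norm_mul, norm_mul, Complex.norm_exp_ofReal_mul_I, norm_neg, Complex.norm_I,
      Complex.norm_real, Real.norm_eq_abs, one_mul, one_mul]
  have hB : ∀ ξ, ‖polarTest t x m ξ‖ ≤ (shell a b c).indicator (fun _ => K / δ) ξ := by
    intro ξ
    rw [hnB]
    by_cases hξ : ξ ∈ shell a b c
    · rw [indicator_of_mem hξ]
      exact hQ ξ hξ
    · rw [indicator_of_notMem hξ, e0 ξ hξ, zero_div, abs_zero]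
  -- In order: the derivative on the symbol, on 1/∂_φΨ (where |Ψ| ≤ 2t), and the divergence ξ₃/|ξ_h|
  -- of the polar field.
  set M := K * (b / c + c / b) / δ + K * (2 * t) / δ ^ 2 + 4 * b / c * (K / δ) with hMdef
  have hG : ∀ ξ, ‖T ξ - E ξ‖ ≤ (shell a b c).indicator (fun _ => M) ξ := by
    intro ξ
    by_cases hξ : ξ ∈ shell a b c
    · rw [indicator_of_mem hξ]
      have hoff := shell_subset_offAxis hb hξ
      have hr := mem_offAxis_iff.1 hoff
      simp only [hT, hE]
      rw [fderiv_polarTest hm hs hP' hoff (hP ξ hξ), add_assoc, add_sub_cancel_left]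
      refine (norm_add_le _ _).trans (add_le_add ?_ ?_)
      · rw [norm_mul, norm_mul, Complex.norm_exp_ofReal_mul_I, norm_neg, Complex.norm_I,
          Complex.norm_real, Real.norm_eq_abs, one_mul, one_mul]
        refine (abs_add_le _ _).trans (add_le_add ?_ ?_)
        · rw [abs_div]
          exact div_le_div₀ (by positivity) (k1 ξ hξ) hδ (hPδ ξ hξ)
        · rw [abs_div, abs_mul, abs_pow]
          refine div_le_div₀ (by positivity) ?_ (by positivity)
            (pow_le_pow_left₀ hδ.le (hPδ ξ hξ) 2)
          exact mul_le_mul (k0 ξ) (abs_phase_le ha hab ht hx hξ) (abs_nonneg _) hK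
      · rw [norm_mul, hnB, Complex.norm_real, Real.norm_eq_abs]
        refine mul_le_mul ?_ (hQ ξ hξ) (abs_nonneg _) (by positivity)
        have h1 : |ξ 2| ≤ 4 / c := by
          rw [le_div_iff₀ hc, mul_comm]; exact hξ.2.2.2
        have h2 : 1 / b ≤ axisDist ξ := by
          rw [div_le_iff₀ hb, mul_comm]; exact hξ.2.1.1
        rw [abs_div, abs_of_pos hr]
        calc |ξ 2| / axisDist ξ ≤ (4 / c) / (1 / b) := by gcongr
          _ = 4 * b / c := by field_simp
    · rw [indicator_of_notMem hξ]
      have hnt : ξ ∉ tsupport m := fun h => hξ (ts h)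
      have hnB' : ξ ∉ tsupport (polarTest t x m) := fun h => hnt (Bts h)
      have hf : fderiv ℝ (polarTest t x m) ξ = 0 := by
        by_contra h'
        exact hnB' (support_fderiv_subset ℝ h')
      simp [hT, hE, e0 ξ hξ, hf, image_eq_zero_of_notMem_tsupport hnB']
  have hMpos : 0 ≤ M := by positivity
  have hsa : √a * √a = a := Real.mul_self_sqrt ha.le
  have hsa0 : 0 < √a := Real.sqrt_pos.2 ha
  have I1 : ‖∫ ξ, w ξ * polarTest t x m ξ‖ₑ ≤ ENNReal.ofReal (256 * K / (t * (a * √a))) * D := by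
    have hsq := norm_integral_mul_le (f := w) (isClosed_shell a b c).measurableSet hB
    have hle : ‖∫ ξ, w ξ * polarTest t x m ξ‖ₑ ^ 2 ≤
        (ENNReal.ofReal (128 * K / (t * (a * √a))) * ‖w‖ₑ) ^ 2 := by
      refine hsq.trans ?_
      rw [mul_pow, ← mul_assoc]
      refine mul_le_mul' ?_ ((setLIntegral_le_lintegral _ _).trans (lintegral_enorm_sq_L2 w).le)
      refine (mul_le_mul_right (volume_shell_le hb hc) _).trans ?_
      rw [← ENNReal.ofReal_pow (by positivity), ← ENNReal.ofReal_pow (by positivity),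
        ← ENNReal.ofReal_mul (by positivity)]
      refine ENNReal.ofReal_le_ofReal ?_
      calc (K / δ) ^ 2 * (128 / (b ^ 2 * c)) = 8192 * K ^ 2 / (t ^ 2 * a ^ 2 * c) := by
            rw [hδdef]
            field_simp
            ring
        _ ≤ 16384 * K ^ 2 / (t ^ 2 * a ^ 2 * a) := by
            gcongr
            norm_num
        _ = (128 * K / (t * (a * √a))) ^ 2 := by
            rw [div_pow, mul_pow, mul_pow, mul_pow, Real.sq_sqrt ha.le]
            norm_num
            ring
    refine ((ENNReal.pow_le_pow_left_iff two_ne_zero).1 hle).trans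
      ((mul_le_mul_right hwD _).trans (le_of_eq ?_))
    rw [← mul_assoc, ← ENNReal.ofReal_ofNat, ← ENNReal.ofReal_mul (by positivity)]
    congr 2
    ring
  have I2 : ‖∫ ξ, h ξ * (T ξ - E ξ)‖ₑ ≤
      ENNReal.ofReal (22528 * (K * Cp) / (t * (a * √a))) * D := by
    refine (enorm_integral_shell_le ha hb hc hCp hp hG hMpos).trans ?_
    gcongr ENNReal.ofReal ?_ * _
    have e1 : M * (128 / (b ^ 2 * c)) =
        1024 * K / (t * a) * (5 / c ^ 2 + 1 / b ^ 2 + 16 / (a * c)) := by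
      rw [hMdef, hδdef]
      field_simp
      ring
    -- All powers of b in M are absorbed by the volume factor 1/(b²c); only a ≤ b and a ≤ c are then
    -- needed.
    have e2 : 5 / c ^ 2 + 1 / b ^ 2 + 16 / (a * c) ≤ 22 / a ^ 2 := by
      calc 5 / c ^ 2 + 1 / b ^ 2 + 16 / (a * c) ≤ 5 / a ^ 2 + 1 / a ^ 2 + 16 / (a * a) := by gcongr
        _ = 22 / a ^ 2 := by ring
    calc Cp * (a * √a) * M * (128 / (b ^ 2 * c)) =
          Cp * (a * √a) * (1024 * K / (t * a) * (5 / c ^ 2 + 1 / b ^ 2 + 16 / (a * c))) := by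
            rw [mul_assoc _ M, e1]
      _ ≤ Cp * (a * √a) * (1024 * K / (t * a) * (22 / a ^ 2)) := by gcongr
      _ = 22528 * (K * Cp) / (t * (a * √a)) := by
        field_simp
        rw [Real.sq_sqrt ha.le]
        ring
  rw [split]
  refine (enorm_sub_le).trans ?_
  rw [enorm_neg]
  refine (add_le_add I1 I2).trans ?_
  rw [← add_mul, ← ENNReal.ofReal_add (by positivity) (by positivity), ← add_div]
  gcongr ENNReal.ofReal (?_ / _) * _
  nlinarith

/-! ### The dispersive estimate -/

theorem RadialBump.enorm_oscIntegral_le (χ : RadialBump) : ∃ C : ℝ, 0 < C ∧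
    ∀ (D : ℝ≥0∞) (g u : Fin 4 → L2), IsAxisymmetric (g 0) →
    (∀ i : Fin 3, IsS (g i.castSucc) (g i.succ)) → (∀ i, IsUpsilon (g i) (u i)) →
    (∀ i, normB χ (g i) + ‖u i‖ₑ ≤ D) → ∀ a b c t : ℝ, 0 < a → a ≤ b → a ≤ c → 0 < t → ∀ x,
      ‖oscIntegral (χ.symbol a b c) t x (𝓕 (g 0) : L2)‖ₑ ≤
        ENNReal.ofReal (C / (t * (a * √a))) * D := by
  obtain ⟨Cp, hCp, hpw⟩ := pointwise_bound χ
  obtain ⟨K, hK, hsym⟩ := χ.symbol_bounds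
  refine ⟨425984 * (K * (1 + Cp)), by positivity,
    fun D g u hax hS hU hD a b c t ha hab hac ht x => ?_⟩
  have hb : 0 < b := ha.trans_le hab
  obtain ⟨k0, k1, k2, k3⟩ := hsym a b c ha hb (ha.trans_le hac)
  have s0 : IsS (g 0) (g 1) := hS 0
  have s1 : IsS (g 1) (g 2) := hS 1
  have s2 : IsS (g 2) (g 3) := hS 2
  have x1 := hax.of_weakLin_id s0.weakLin
  have x2 := x1.of_weakLin_id s1.weakLin
  have x3 := x2.of_weakLin_id s2.weakLin
  have p0 := hpw D _ _ _ _ hax x1 s0 (hU 0) (hU 1) (hD 0) (hD 1)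
  have p1 := hpw D _ _ _ _ x1 x2 s1 (hU 1) (hU 2) (hD 1) (hD 2)
  have p2 := hpw D _ _ _ _ x2 x3 s2 (hU 2) (hU 3) (hD 2) (hD 3)
  have hsa : 0 < √a := Real.sqrt_pos.2 ha
  have hπ : 0 < Real.pi := Real.pi_pos
  -- At this threshold both methods give t^{-1} a^{-3/2}. The far case converts √a/(b‖x‖) with 64π ≤
  -- 256, and 1664 · 256 = 425984.
  rcases le_or_gt (64 * Real.pi * ‖x‖ * b) (t * a ^ 2) with hx | hx
  · obtain ⟨w, hw1, hw2⟩ := (hU 0).weakPolar_fourier hax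
    have hwD : ‖w‖ₑ ≤ 2 * D := by
      calc ‖w‖ₑ ≤ 2 * ‖u 0‖ₑ := by
            rw [← ofReal_norm, ← ofReal_norm]
            refine (ENNReal.ofReal_le_ofReal hw1).trans_eq ?_
            rw [ENNReal.ofReal_mul zero_le_two, ENNReal.ofReal_ofNat]
        _ ≤ 2 * D := by
            gcongr
            exact le_add_self.trans (hD 0)
    refine (oscIntegral_near ha hab hac hCp.le hK.le ht k0 k3 hx hw2 hwD p0).trans ?_
    gcongr ENNReal.ofReal (?_ / _) * _
    have : 0 < K * (1 + Cp) := by positivity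
    linarith
  · have hx0 : 0 < ‖x‖ := by
      by_contra h
      have : ‖x‖ = 0 := le_antisymm (not_lt.1 h) (norm_nonneg x)
      rw [this] at hx
      have : 0 < t * a ^ 2 := by positivity
      linarith
    refine (oscIntegral_far ha hab hac hCp.le hK.le k0 k1 k2 hx0 s0.weakScale_fourier
      s1.weakScale_fourier p0 p1 p2).trans ?_
    gcongr ENNReal.ofReal ?_ * _
    have e1 : √a / (b * ‖x‖) ≤ 256 / (t * (a * √a)) := by
      rw [div_le_div_iff₀ (by positivity) (by positivity)]
      have e2 : √a * (t * (a * √a)) = t * a ^ 2 := by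
        rw [show √a * (t * (a * √a)) = t * a * (√a * √a) by ring, Real.mul_self_sqrt ha.le]
        ring
      have e3 : Real.pi * (‖x‖ * b) ≤ 4 * (‖x‖ * b) := by
        gcongr
        exact Real.pi_le_four
      linarith
    calc 1664 * (K * Cp) * (√a / (b * ‖x‖)) ≤ 1664 * (K * (1 + Cp)) * (256 / (t * (a * √a))) := by
          gcongr
          linarith
      _ = _ := by ring

theorem projSymbol_eq_symbol (χ : RadialBump) (k p q : ℤ) (ξ : E3) :
    projSymbol χ k p q ((2 * Real.pi) • ξ) =
      (χ.symbol (2 * Real.pi * 2 ^ (-k)) (2 * Real.pi * 2 ^ (-(p + k)))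
        (2 * Real.pi * 2 ^ (-q - k)) ξ : ℂ) := by
  have h2 : (2 : ℝ) ^ (-2 * (p + k)) = ((2 : ℝ) ^ (-(p + k))) ^ 2 := by
    rw [← zpow_natCast, ← zpow_mul]
    congr 1
    push_cast
    ring
  rw [projSymbol, RadialBump.symbol, amp, norm_smul, Real.norm_of_nonneg Real.two_pi_pos.le, h2]
  simp only [PiLp.smul_apply, smul_eq_mul]
  rw [show (2 : ℝ) ^ (-k) * (2 * Real.pi * ‖ξ‖) = 2 * Real.pi * 2 ^ (-k) * ‖ξ‖ by ring,
    show ((2 : ℝ) ^ (-(p + k))) ^ 2 * ((2 * Real.pi * ξ 0) ^ 2 + (2 * Real.pi * ξ 1) ^ 2) =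
      (2 * Real.pi * 2 ^ (-(p + k))) ^ 2 * (ξ 0 ^ 2 + ξ 1 ^ 2) by ring,
    show (2 : ℝ) ^ (-q - k) * (2 * Real.pi * ξ 2) = 2 * Real.pi * 2 ^ (-q - k) * ξ 2 by ring]

theorem RadialBump.eLpNorm_proj_flow_le (χ : RadialBump) : ∃ C : ℝ, 0 < C ∧
    ∀ (D : ℝ≥0∞) (g u : Fin 4 → L2), IsAxisymmetric (g 0) →
    (∀ i : Fin 3, IsS (g i.castSucc) (g i.succ)) → (∀ i, IsUpsilon (g i) (u i)) →
    (∀ i, normB χ (g i) + ‖u i‖ₑ ≤ D) → ∀ k p q : ℤ, p ≤ 0 → q ≤ 0 → ∀ t : ℝ, 0 < t →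
      eLpNorm (proj χ k p q (flow t (g 0))) ⊤ volume ≤
        ENNReal.ofReal (C * t⁻¹ * (2 : ℝ) ^ (3 * (k : ℝ) / 2)) * D := by
  obtain ⟨C, hC, hosc⟩ := χ.enorm_oscIntegral_le
  refine ⟨C, hC, fun D g u hax hS hU hD k p q hp hq t ht => ?_⟩
  have hπ := Real.pi_gt_three
  set y : ℝ := 2 ^ (-k) with hy
  have hy0 : 0 < y := by positivity
  have ha : 0 < 2 * Real.pi * y := by positivity
  have hab : 2 * Real.pi * y ≤ 2 * Real.pi * 2 ^ (-(p + k)) := by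
    gcongr
    exact zpow_le_zpow_right₀ (by norm_num) (by omega)
  have hac : 2 * Real.pi * y ≤ 2 * Real.pi * 2 ^ (-q - k) := by
    gcongr
    exact zpow_le_zpow_right₀ (by norm_num) (by omega)
  have A := χ.annular_phi
  have hcont : Continuous (χ.symbol (2 * Real.pi * y) (2 * Real.pi * 2 ^ (-(p + k)))
      (2 * Real.pi * 2 ^ (-q - k))) :=
    (contDiff_amp ha (ha.trans_le hab) (ha.trans_le hac) A A A).continuous
  have hcs : HasCompactSupport (χ.symbol (2 * Real.pi * y) (2 * Real.pi * 2 ^ (-(p + k)))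
      (2 * Real.pi * 2 ^ (-q - k))) :=
    (isCompact_shell ha).of_isClosed_subset (isClosed_tsupport _)
      (tsupport_amp_subset ha (ha.trans_le hab) (ha.trans_le hac) A A A)
  rw [eLpNorm_exponent_top]
  refine eLpNormEssSup_le_of_ae_enorm_bound ?_
  filter_upwards [proj_flow_ae_eq χ k p q t (g 0) (projSymbol_eq_symbol χ k p q) hcont hcs]
    with x hx
  rw [hx]
  refine (hosc D g u hax hS hU hD _ _ _ t ha hab hac ht x).trans ?_
  gcongr ENNReal.ofReal ?_ * _
  have hpow : (2 : ℝ) ^ (3 * (k : ℝ) / 2) = (y * √y)⁻¹ := by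
    have e1 : y = (2 : ℝ) ^ (-(k : ℝ)) := by
      rw [hy, ← Real.rpow_intCast]
      push_cast
      rfl
    rw [e1, Real.sqrt_eq_rpow, ← Real.rpow_mul (by norm_num), ← Real.rpow_add (by norm_num),
      ← Real.rpow_neg (by norm_num)]
    congr 1
    ring
  have hle : y ≤ 2 * Real.pi * y := by nlinarith
  calc C / (t * (2 * Real.pi * y * √(2 * Real.pi * y))) ≤ C / (t * (y * √y)) := by gcongr
    _ = _ := by
      rw [hpow, div_eq_mul_inv, mul_inv, mul_assoc]

/-! ### Passage to the infimum defining the norm. -/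

/-- A positive finite factor can be moved across the infimum over the families S^a f, ΥS^a f, so the
estimate may be proved for one family at a time. -/
theorem le_mul_normD {χ : RadialBump} {f : L2} {A : ℝ≥0∞} {c : ℝ} (hc : 0 < c)
    (h : ∀ g u : Fin 4 → L2, g 0 = f → (∀ a : Fin 3, IsS (g a.castSucc) (g a.succ)) →
      (∀ a, IsUpsilon (g a) (u a)) →
      A ≤ ENNReal.ofReal c * ⨆ a : Fin 4, (normB χ (g a) + ‖u a‖ₑ)) :
    A ≤ ENNReal.ofReal c * normD χ f := by
  have hc0 : ENNReal.ofReal c ≠ 0 := by simpa using hc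
  rw [← ENNReal.div_le_iff' hc0 ENNReal.ofReal_ne_top]
  refine le_iInf fun g => le_iInf fun u => le_iInf fun hgu => ?_
  rw [ENNReal.div_le_iff' hc0 ENNReal.ofReal_ne_top]
  exact h g u hgu.1 hgu.2.1 hgu.2.2

end RotatingEuler
end

theorem proposition4p1 (χ : RotatingEuler.RadialBump) :
    ∃ C : ℝ, 0 < C ∧ ∀ f : RotatingEuler.L2, RotatingEuler.IsAxisymmetric f →
      ∀ k p q : ℤ, p ≤ 0 → q ≤ 0 → ∀ t : ℝ, 0 < t →
        eLpNorm (RotatingEuler.proj χ k p q (RotatingEuler.flow t f)) ⊤ (volume : Measure RotatingEuler.E3) ≤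
          ENNReal.ofReal (C * t⁻¹ * (2 : ℝ) ^ (3 * (k : ℝ) / 2)) * RotatingEuler.normD χ f := by
  obtain ⟨C, hC, h⟩ := χ.eLpNorm_proj_flow_le
  refine ⟨C, hC, fun f hf k p q hp hq t ht => RotatingEuler.le_mul_normD (by positivity) ?_⟩
  rintro g u rfl hS hU
  exact h _ g u hf hS hU
    (le_iSup fun a => RotatingEuler.normB χ (g a) + ‖u a‖ₑ) k p q hp hq t ht
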